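/- **Setting.** Let $E$ be a finite-dimensional (Euclidean) real space with a norm $\|\cdot\|$ and conjugate norm $\|y\|_*=\sup_{\|x\|\le1}\langle y,x\rangle$, $X\subseteq E$ closed and convex, $(\Omega,P)$ a probability space, and $G:X\times\Omega\to\mathbb R$ such that, for every $\omega$, $G(\cdot,\omega)$ is convex and differentiable on $X$ with $\|\nabla G(x,\omega)-\nabla G(x',\omega)\|_*\le\mathcal L(\omega)\|x-x'\|$ for $x,x'\in X$, where $\mathcal L(\omega)\le\nu$ a.s. ($\nu>0$). Let $g(x)=\mathbf E\,G(x,\omega)$ be finite and differentiable on $X$ with $\nabla g(x)=\mathbf E\,\nabla G(x,\omega)$. Let $x_*\in X$ minimize $g$ over $X$, with $\nabla g(x_*)=0$ and $\mathbf E\exp(\|\nabla G(x_*,\omega)\|_*^2/\sigma_*^2)\le e$ for some $\sigma_*>0$. For $\kappa>0$ put $F_\kappa(x)=\frac12g(x)+\kappa\|x\|$. *Assumption [RSC]* (constants $\delta\ge1$, $\rho>0$ with $\rho\nu\ge1$, and an integer $s\ge1$): for all $\kappa>0$, $\upsilon\ge0$, $\varepsilon\ge0$ and every random point $\widehat x\in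 X$, if $F_\kappa(\widehat x)-F_\kappa(x_*)\le\upsilon$ with probability at least $1-\varepsilon$, then $\|\widehat x-x_*\|\le\delta[\rho s\kappa+\upsilon/\kappa]$ with probability at least $1-\varepsilon$. Let $\theta$ be a continuously differentiable convex function on the unit ball $B$ of $\|\cdot\|$ with $\langle\nabla\theta(z)-\nabla\theta(z'),z-z'\rangle\ge\|z-z'\|^2$ on $B$ and $\theta\ge\theta(0)=0$; let $\Theta=\max_B\theta$. For a center $z_0\in X$ and a radius $r>0$ put $\vartheta(z)=r^2\theta((z-z_0)/r)$ and $V(x,z)=\vartheta(z)-\vartheta(x)-\langle\nabla\vartheta(x),z-x\rangle$. **CSMD$(z_0,\gamma,\kappa,r,m,L)$** is the point $\frac1m\sum_{i=0}^{m-1}x_i$, where $x_0=z_0$ and $x_{i}$ is the minimizer of $\gamma\langle H_i,z\rangle+\gamma\kappa\|z\|+V(x_{i-1},z)$ over $\{z\in X:\|z-z_0\|\le r\}$, $H_i$ being the average of $\nabla G(x_{i-1},\cdot)$ over $L$ fresh independent samples from $P$; it uses $mL$ samples. **CSMD-SR.** Input: $x_0\in X$ and $R>0$ with $\|x_0-x_*\|\le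 R$, the constants above, $t$, and a total number $N$ of i.i.d. samples. With absolute constants $a_1,\dots,a_7>0$, put $$m_0=\lceil a_1 s\rho\nu\delta^2(\Theta+t)\rceil,\quad r_0=a_2\sigma_*\delta\sqrt{\rho s/\nu},\quad \overline K_1=\min\{\max(0,\lceil\log_2(R/r_0)\rceil),\lfloor N/m_0\rfloor\}.$$ *Preliminary phase:* for $k=1,\dots,\overline K_1$, starting from $z=x_0$, replace the current point $z$ with CSMD$(z,\frac1{4\nu},\kappa_k,R_{k-1},m_0,1)$, where $R_k=2^{-k}R$, $\kappa_k=a_3R_{k-1}/(\delta\rho s)$. *Asymptotic phase:* for $k=1,2,\dots$, as long as the remaining budget allows the whole stage, replace $z$ with CSMD$(z,a_5 4^{-k}\nu^{-1},\kappa_k,2^{-(k-1)}r_0,m_k,1)$, where $\kappa_k=a_4 2^{-k}\sigma_*(\rho\nu s)^{-1/2}$, $m_k=\lceil a_6 4^km_0\rceil$. The output $\widehat x_N$ is the last point. *Minibatch variant:* the asymptotic stages are instead CSMD$(z,\frac1{4\nu},\kappa_k,2^{-(k-1)}r_0,m_0,\ell_k)$ with $\kappa_k=a_4 2^{-k}\sigma_*(\rho\nu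 s)^{-1/2}$ and $\ell_k=\lceil a_7 4^k\Theta\rceil$. The output is $\widehat x^{(b)}_N$. **Theorem.** There are absolute constants $a_1,\dots,a_7>0$ and $c_0,C,c>0$ such that in every such setting, whenever $N\ge m_0$ and $t\ge c_0\sqrt{\ln N}$: with probability at least $1-C(\overline K_1+\overline K_2)e^{-t}$, where $\overline K_2=1+\ln(N/m_0)$, $$\|\widehat x_N-x_*\|\le C\Big(R\exp\Big\{-\frac{c}{\delta^2\rho\nu}\frac{N}{s(\Theta+t)}\Big\}+\delta^2\rho\sigma_*s\sqrt{\frac{\Theta+t}{N}}\Big),$$ and with probability at least $1-C(\overline K_1+\widetilde K_2)e^{-t}$, where $\widetilde K_2=1+\max\{0,\ln(N/(\Theta m_0))\}$, $$\|\widehat x^{(b)}_N-x_*\|\le C\Big(R\exp\Big\{-\frac{c}{\delta^2\rho\nu}\frac{N}{s(\Theta+t)}\Big\}+\delta^2\rho\sigma_*s\sqrt{\frac{\Theta(\Theta+t)}{N}}\Big).$$ -/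

import Mathlib

open MeasureTheory ProbabilityTheory

namespace CSMD

/-- The stochastic oracle: a closed convex feasible set `X` (see `Oracle.Regular`), a random
objective `G x ω` and its gradient `dG x ω` in `x`. Gradients are elements of the dual of the normed
space `E`, so that their operator norm is the conjugate norm `‖·‖_*` and `dG x ω v` is the pairing
`⟨∇G(x, ω), v⟩`. -/
structure Oracle (E Ω : Type*) [NormedAddCommGroup E] [NormedSpace ℝ E] where
  /-- feasible set -/
  X : Set E
  /-- random objective -/
  G : E → Ω → ℝ
  /-- stochastic gradient -/
  dG : E → Ω → StrongDual ℝ E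

/-- A distance-generating function of the unit ball: continuously differentiable, convex, strongly
convex with modulus `1` with respect to the norm, minimal at `0` with value `0`. -/
structure DGF (E : Type*) [NormedAddCommGroup E] [NormedSpace ℝ E] where
  /-- the function -/
  θ : E → ℝ
  /-- its gradient -/
  dθ : E → StrongDual ℝ E
  hasFDerivWithinAt : ∀ z ∈ Metric.closedBall (0 : E) 1,
    HasFDerivWithinAt θ (dθ z) (Metric.closedBall 0 1) z
  continuousOn : ContinuousOn dθ (Metric.closedBall 0 1)
  convexOn : ConvexOn ℝ (Metric.closedBall 0 1) θ
  strong : ∀ z ∈ Metric.closedBall (0 : E) 1, ∀ z' ∈ Metric.closedBall (0 : E) 1,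
    ‖z - z'‖ ^ 2 ≤ (dθ z - dθ z') (z - z')
  map_zero : θ 0 = 0
  nonneg : ∀ z ∈ Metric.closedBall (0 : E) 1, 0 ≤ θ z

section Algorithm

variable {E Ω : Type*} [NormedAddCommGroup E] [NormedSpace ℝ E]

/-- `Θ`, the maximum of `θ` over the unit ball. -/
noncomputable def DGF.Theta (d : DGF E) : ℝ := sSup (d.θ '' Metric.closedBall 0 1)

/-- The local distance-generating function `ϑ(z) = R² θ((z - x₀) / R)`. -/
noncomputable def DGF.loc (d : DGF E) (x₀ : E) (R : ℝ) (z : E) : ℝ :=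
  R ^ 2 * d.θ (R⁻¹ • (z - x₀))

/-- The gradient of `ϑ` (chain rule). -/
noncomputable def DGF.dloc (d : DGF E) (x₀ : E) (R : ℝ) (z : E) : StrongDual ℝ E :=
  R • d.dθ (R⁻¹ • (z - x₀))

/-- The Bregman divergence `V(x, z)` of `ϑ`. -/
noncomputable def DGF.bregman (d : DGF E) (x₀ : E) (R : ℝ) (x z : E) : ℝ :=
  d.loc x₀ R z - d.loc x₀ R x - d.dloc x₀ R x (z - x)

/-- `X_R(x₀)`. -/
def Oracle.localSet (o : Oracle E Ω) (x₀ : E) (R : ℝ) : Set E := {z ∈ o.X | ‖z - x₀‖ ≤ R}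

/-- The composite proximal mapping: the minimizer over `X_R(x₀)` of
`⟨ζ, z⟩ + h(z) + V(x, z)`. -/
noncomputable def prox (o : Oracle E Ω) (d : DGF E) (x₀ : E) (R : ℝ) (h : E → ℝ)
    (ζ : StrongDual ℝ E) (x : E) : E :=
  Classical.epsilon fun y => y ∈ o.localSet x₀ R ∧
    IsMinOn (fun z => ζ z + h z + d.bregman x₀ R x z) (o.localSet x₀ R) y

/-- Parameters of one run of the `L`-minibatch CSMD: step-size `γ`, penalty `κ`, radius `R`,
number `m` of iterations and batch size `L`. -/
structure Run where
  /-- step-size -/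
  γ : ℝ
  /-- penalty -/
  κ : ℝ
  /-- radius -/
  R : ℝ
  /-- number of iterations -/
  m : ℕ
  /-- batch size -/
  L : ℕ

/-- The averaged stochastic gradient over a batch. -/
noncomputable def Oracle.batchGrad (o : Oracle E Ω) (L : ℕ) (x : E) (w : ℕ → Ω) : StrongDual ℝ E :=
  (L : ℝ)⁻¹ • ∑ l ∈ Finset.range L, o.dG x (w l)

/-- The iterates of CSMD, with `h = κ ‖·‖`, fed with the sample stream `w`. Iteration `i + 1`
consumes the `L` samples `w (i L), …, w (i L + L - 1)`. -/
noncomputable def csmdIter (o : Oracle E Ω) (d : DGF E) (a : Run) (x₀ : E) (w : ℕ → Ω) : ℕ → E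
  | 0 => x₀
  | i + 1 =>
    prox o d x₀ a.R (fun z => a.γ * (a.κ * ‖z‖))
      (a.γ • o.batchGrad a.L (csmdIter o d a x₀ w i) fun l => w (i * a.L + l))
      (csmdIter o d a x₀ w i)

/-- The output `CSMD(x₀, γ, κ, R, m, L)`: with a constant step-size, the mean of the iterates
`x_0, …, x_{m-1}`. -/
noncomputable def csmd (o : Oracle E Ω) (d : DGF E) (a : Run) (x₀ : E) (w : ℕ → Ω) : E :=
  (a.m : ℝ)⁻¹ • ∑ i ∈ Finset.range a.m, csmdIter o d a x₀ w i

/-- Number of samples consumed by the first `k` runs. -/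
def cost (a : ℕ → Run) (k : ℕ) : ℕ := ∑ j ∈ Finset.range k, (a j).m * (a j).L

/-- The point reached after `k` successive runs with parameters `a 0, …, a (k-1)`; each run starts
(and centers its prox-function) at the output of the previous one and uses fresh samples. -/
noncomputable def stages (o : Oracle E Ω) (d : DGF E) (a : ℕ → Run) (x₀ : E) (w : ℕ → Ω) : ℕ → E
  | 0 => x₀
  | k + 1 => csmd o d (a k) (stages o d a x₀ w k) fun i => w (cost a k + i)

/-- Number of stages that the budget `B` allows: stages are run one after another as long as the
next one fits in what is left of the budget. (Every stage costs at least one sample.) -/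
def stageCount (a : ℕ → Run) (B : ℕ) : ℕ := Nat.findGreatest (fun k => cost a k ≤ B) B

/-- The data given to the algorithm: smoothness constant `ν`, constants `δ`, `ρ`, `s` of reduced
strong convexity, noise level `σ`, initial radius `R`, confidence level `t`, budget `N`. -/
structure Params where
  /-- Lipschitz constant of the stochastic gradients -/
  ν : ℝ
  /-- constant of reduced strong convexity -/
  δ : ℝ
  /-- constant of reduced strong convexity -/
  ρ : ℝ
  /-- sparsity -/
  s : ℕ
  /-- sub-Gaussian parameter of the stochastic gradient at the solution -/
  σ : ℝ
  /-- initial radius -/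
  R : ℝ
  /-- confidence level -/
  t : ℝ
  /-- total sample budget -/
  N : ℕ

/-- The absolute constants hidden in the order-of-magnitude prescriptions for the parameters of the
algorithm. -/
structure Tuning where
  /-- in the stage length of the preliminary phase -/
  len : ℝ
  /-- in the penalty of the preliminary phase -/
  pen : ℝ
  /-- in the radius at which the preliminary phase ends -/
  level : ℝ
  /-- in the penalty of the asymptotic phase -/
  pen' : ℝ
  /-- in the step-size of the asymptotic phase -/
  step : ℝ
  /-- in the stage lengths of the asymptotic phase -/
  grow : ℝ
  /-- in the batch sizes of the asymptotic phase -/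
  batch : ℝ
  len_pos : 0 < len
  pen_pos : 0 < pen
  level_pos : 0 < level
  pen'_pos : 0 < pen'
  step_pos : 0 < step
  grow_pos : 0 < grow
  batch_pos : 0 < batch

namespace Tuning

variable (T : Tuning) (p : Params) (o : Oracle E Ω) (d : DGF E)

/-- Stage length `m₀ ≍ s ρ ν δ² (Θ + t)` of the preliminary phase. -/
noncomputable def m₀ : ℕ := ⌈T.len * (p.s * p.ρ * p.ν * p.δ ^ 2 * (d.Theta + p.t))⌉₊

/-- The radius `r₀ ≍ σ δ √(ρ s / ν)` at which the preliminary phase is complete. -/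
noncomputable def r₀ : ℝ := T.level * (p.σ * p.δ * √(p.ρ * p.s / p.ν))

/-- Number `K₁ ≍ ln (R² ν / (δ² ρ σ² s)) ∧ N / m₀` of preliminary stages: the radius is halved until
it is at most `r₀`, within the budget. It vanishes when `R ≤ r₀`, i.e. one proceeds directly to the
asymptotic phase. -/
noncomputable def K₁ : ℕ := min ⌈Real.logb 2 (p.R / T.r₀ p)⌉₊ (p.N / T.m₀ p d)

/-- Parameters of the preliminary stage `k + 1`. -/
noncomputable def prelim (k : ℕ) : Run where
  γ := (4 * p.ν)⁻¹
  κ := T.pen * (p.R / 2 ^ k / (p.δ * p.ρ * p.s))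
  R := p.R / 2 ^ k
  m := T.m₀ p d
  L := 1

/-- Penalty `κ ≍ 2^{-k} σ (ρ ν s)^{-1/2}` of the `k`-th asymptotic stage. -/
noncomputable def asymPen (k : ℕ) : ℝ := T.pen' * (p.σ / (2 ^ k * √(p.ρ * p.ν * p.s)))

/-- Parameters of the asymptotic stage `k + 1`: step-size `≍ 4^{-(k+1)} / ν` and
`≍ 4^{k+1} m₀` iterations. -/
noncomputable def asym (k : ℕ) : Run where
  γ := T.step / (4 ^ (k + 1) * p.ν)
  κ := T.asymPen p (k + 1)
  R := T.r₀ p / 2 ^ k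
  m := ⌈T.grow * (4 ^ (k + 1) * T.m₀ p d)⌉₊
  L := 1

/-- Parameters of the asymptotic stage `k + 1` of the minibatch variant: `m₀` iterations with
batch size `≍ 4^{k+1} Θ`. -/
noncomputable def asymBatch (k : ℕ) : Run where
  γ := (4 * p.ν)⁻¹
  κ := T.asymPen p (k + 1)
  R := T.r₀ p / 2 ^ k
  m := T.m₀ p d
  L := ⌈T.batch * (4 ^ (k + 1) * d.Theta)⌉₊

/-- Preliminary phase followed by an asymptotic phase with parameters `a`, within the budget. -/
noncomputable def run (a : ℕ → Run) (x₀ : E) (w : ℕ → Ω) : E :=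
  stages o d a (stages o d (T.prelim p d) x₀ w (T.K₁ p d))
    (fun i => w (T.m₀ p d * T.K₁ p d + i)) (stageCount a (p.N - T.m₀ p d * T.K₁ p d))

/-- The output of CSMD-SR with sample stream `w`. -/
noncomputable def csmdSR (x₀ : E) (w : ℕ → Ω) : E := T.run p o d (T.asym p d) x₀ w

/-- The output of the minibatch variant of CSMD-SR with sample stream `w`. -/
noncomputable def csmdSRBatch (x₀ : E) (w : ℕ → Ω) : E := T.run p o d (T.asymBatch p d) x₀ w

/-- Bound `K₂ ≍ 1 + ln (N / m₀)` on the number of asymptotic stages. -/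
noncomputable def K₂ : ℝ := 1 + Real.log (p.N / T.m₀ p d)

/-- Bound `≍ 1 + ln (N / (Θ m₀))` on the number of asymptotic stages of the minibatch variant; the
logarithm is replaced with `0` when it is negative. -/
noncomputable def K₂Batch : ℝ := 1 + max 0 (Real.log (p.N / (d.Theta * T.m₀ p d)))

end Tuning

end Algorithm

section Assumptions

variable {E Ω : Type*} [NormedAddCommGroup E] [NormedSpace ℝ E] [MeasurableSpace Ω]

/-- The objective `g(x) = 𝐄 G(x, ω)`. -/
noncomputable def Oracle.g (o : Oracle E Ω) (P : Measure Ω) (x : E) : ℝ := ∫ ω, o.G x ω ∂P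

/-- The composite objective `F_κ = g / 2 + κ ‖·‖`. -/
noncomputable def Oracle.F (o : Oracle E Ω) (P : Measure Ω) (κ : ℝ) (x : E) : ℝ :=
  1 / 2 * o.g P x + κ * ‖x‖

/-- The standing assumptions on the stochastic optimization problem. -/
structure Oracle.Regular (o : Oracle E Ω) (P : Measure Ω) (ν : ℝ) : Prop where
  isClosed : IsClosed o.X
  convex : Convex ℝ o.X
  measurable_G : ∀ x ∈ o.X, Measurable (o.G x)
  measurable_dG : ∀ x ∈ o.X, Measurable (o.dG x)
  convexOn : ∀ ω, ConvexOn ℝ o.X fun x => o.G x ω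
  hasFDerivWithinAt : ∀ ω, ∀ x ∈ o.X, HasFDerivWithinAt (fun y => o.G y ω) (o.dG x ω) o.X x
  /-- the gradient is Lipschitz continuous, with an a.s. bounded Lipschitz constant -/
  lipschitz : ∃ Lip : Ω → ℝ,
    (∀ ω, ∀ x ∈ o.X, ∀ x' ∈ o.X, ‖o.dG x ω - o.dG x' ω‖ ≤ Lip ω * ‖x - x'‖) ∧
      ∀ᵐ ω ∂P, Lip ω ≤ ν
  /-- `g` is finite -/
  integrable_G : ∀ x ∈ o.X, Integrable (o.G x) P
  integrable_dG : ∀ x ∈ o.X, Integrable (o.dG x) P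
  /-- `g` is differentiable and the oracle is unbiased -/
  unbiased : ∀ x ∈ o.X, HasFDerivWithinAt (o.g P) (∫ ω, o.dG x ω ∂P) o.X x

/-- The solution `xs` is unconditional and the stochastic gradient at `xs` is sub-Gaussian with
parameter `σ`. -/
structure Oracle.IsSolution (o : Oracle E Ω) (P : Measure Ω) (σ : ℝ) (xs : E) : Prop where
  mem : xs ∈ o.X
  isMinOn : IsMinOn (o.g P) o.X xs
  grad_eq_zero : ∫ ω, o.dG xs ω ∂P = 0
  subGaussian : ∫⁻ ω, ENNReal.ofReal (Real.exp (‖o.dG xs ω‖ ^ 2 / σ ^ 2)) ∂P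
    ≤ ENNReal.ofReal (Real.exp 1)

/-- Reduced strong convexity: a random feasible point `xh` that is, with probability at least
`1 - ε`, an `υ`-solution of the composite problem is, with probability at least `1 - ε`, at distance
at most `δ (ρ s κ + υ / κ)` from `xs`. -/
def Oracle.RSC [MeasurableSpace E] (o : Oracle E Ω) (P : Measure Ω) (xs : E) (δ ρ : ℝ) (s : ℕ) :
    Prop :=
  ∀ (κ υ ε : ℝ), 0 < κ → 0 ≤ υ → 0 ≤ ε →
    ∀ (S : Type) [MeasurableSpace S] (μ : Measure S) [IsProbabilityMeasure μ] (xh : S → E),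
      Measurable xh → (∀ a, xh a ∈ o.X) →
      1 - ε ≤ μ.real {a | o.F P κ (xh a) - o.F P κ xs ≤ υ} →
      1 - ε ≤ μ.real {a | ‖xh a - xs‖ ≤ δ * (ρ * s * κ + υ / κ)}

end Assumptions

end CSMD

namespace CSMD

/-! ### Gradient inequalities on a convex set that may have empty interior. -/

section Deterministic

variable {E : Type*} [NormedAddCommGroup E] [NormedSpace ℝ E]

/-! Everything rests on one statement: if a run starts within its radius `R` of the solution, it
ends within `R / 2`, outside an event of probability at most `3 exp (-(Θ + t))`
(`measure_half_lt_le`, packaged as `Halves`). The theorem follows by chaining runs with a union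
bound (`measure_stages_le`) and counting samples (`budget_lt`, `stageCount_le_log`).

One run is analysed by mirror descent. The stochastic gradient at `x` is split as `Δ + ξ`, where `ξ`
is the gradient at the solution for the same samples and `Δ` is the difference. The noise `ξ` is
light-tailed, centered and does not depend on the iterate; `Δ` is tamed by smoothness of each
sampled objective. Since the feasible set may have no interior, the usual bound on `‖Δ‖²` is
replaced by `cocoercive`, which only moves in feasible directions and suffices for `prox_step`: with
`γ ν ≤ 1 / 4`, each step retains `2 / 3` of the progress `Δ (x - xs)` and pays `2 γ² ‖ξ‖²`.

Summed over a run (`csmd_gap_le`), three random sums remain: the progress, whose lower tail is light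
because its terms are nonnegative and bounded, so that `3 / 4` of its mean survives; the linear
noise `ξ (x - xs)`; and the squares `‖ξ‖²`. All three are handled by one Chernoff bound for
exponential supermartingales adapted to the sample stream (`measure_lt_sum_le`). The product `2 / 3
* 3 / 4 = 1 / 2` is the weight of `g` in `F_κ`. The gap in `F_κ` becomes a distance through reduced
strong convexity, applied to each realization separately; the penalty `κ = R / (8 δ ρ s)` then
leaves room for the factor `1 / 2`.

In the preliminary phase the radius dominates the noise, and `m₀` samples per halving give the
exponential term. From `r₀` on, each halving needs the noise variance to drop by `4`: through
smaller steps and longer runs, or through larger batches. Costs therefore grow like `4 ^ k`, which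
gives the `N ^ (-1/2)` term. For batches, the norm of an averaged gradient concentrates with the
price `Θ` in place of a dimension, thanks to smoothness of the convex conjugate of `θ`
(`lintegral_exp_conj_sum_le`); this is the source of the extra factor `Θ`. -/

lemma hasDerivWithinAt_segment {f : E → ℝ} {f' : StrongDual ℝ E} {s : Set E} (hs : Convex ℝ s)
    {x y : E} (hx : x ∈ s) (hy : y ∈ s) {r : ℝ}
    (hf : HasFDerivWithinAt f f' s (x + r • (y - x))) :
    HasDerivWithinAt (fun r : ℝ => f (x + r • (y - x))) (f' (y - x)) (Set.Icc 0 1) r := by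
  have h1 : HasDerivWithinAt (fun r : ℝ => x + r • (y - x)) (y - x) (Set.Icc 0 1) r := by
    simpa using (((hasDerivAt_id r).smul_const (y - x)).const_add x).hasDerivWithinAt
  exact hf.comp_hasDerivWithinAt r h1 fun r hr => hs.add_smul_sub_mem hx hy hr

/-- A function whose gradient is monotone with modulus `c` lies above its quadratic lower model. -/
lemma quadratic_lower_bound {f : E → ℝ} {f' : E → StrongDual ℝ E} {s : Set E} {c : ℝ}
    (hs : Convex ℝ s) (hf : ∀ x ∈ s, HasFDerivWithinAt f (f' x) s x)
    (hc : ∀ x ∈ s, ∀ y ∈ s, c * ‖x - y‖ ^ 2 ≤ (f' x - f' y) (x - y))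
    {x y : E} (hx : x ∈ s) (hy : y ∈ s) :
    f x + f' x (y - x) + c / 2 * ‖y - x‖ ^ 2 ≤ f y := by
  set φ : ℝ → ℝ := fun r => f (x + r • (y - x)) - (r * f' x (y - x) + c / 2 * r ^ 2 * ‖y - x‖ ^ 2)
  have hmem : ∀ r ∈ Set.Icc (0 : ℝ) 1, x + r • (y - x) ∈ s := fun r hr =>
    hs.add_smul_sub_mem hx hy hr
  have hd : ∀ r ∈ Set.Icc (0 : ℝ) 1, HasDerivWithinAt φ
      (f' (x + r • (y - x)) (y - x) - (f' x (y - x) + c * r * ‖y - x‖ ^ 2)) (Set.Icc 0 1) r := by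
    intro r hr
    refine (hasDerivWithinAt_segment hs hx hy (hf _ (hmem r hr))).sub ?_
    have h2 : HasDerivAt (fun r : ℝ => r * f' x (y - x) + c / 2 * r ^ 2 * ‖y - x‖ ^ 2)
        (1 * f' x (y - x) + c / 2 * (2 * r) * ‖y - x‖ ^ 2) r := by
      refine ((hasDerivAt_id r).mul_const _).add (HasDerivAt.mul_const ?_ _)
      simpa using ((hasDerivAt_id r).pow 2).const_mul (c / 2)
    convert h2.hasDerivWithinAt using 1
    ring
  have hmono : MonotoneOn φ (Set.Icc 0 1) := by
    refine monotoneOn_of_hasDerivWithinAt_nonneg (convex_Icc 0 1)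
      (fun r hr => (hd r hr).continuousWithinAt)
      (fun r hr => (hd r (interior_subset hr)).mono interior_subset) ?_
    intro r hr
    rw [interior_Icc] at hr
    have h := hc _ (hmem r ⟨hr.1.le, hr.2.le⟩) x hx
    have e : x + r • (y - x) - x = r • (y - x) := by abel
    rw [e, norm_smul, map_smul, smul_eq_mul, Real.norm_eq_abs, mul_pow, sq_abs,
      sub_apply] at h
    have h3 : 0 ≤ r * (f' (x + r • (y - x)) (y - x) - (f' x (y - x) + c * r * ‖y - x‖ ^ 2)) := by
      linarith
    exact nonneg_of_mul_nonneg_right h3 hr.1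
  have := hmono (Set.left_mem_Icc.2 zero_le_one) (Set.right_mem_Icc.2 zero_le_one) zero_le_one
  simp only [φ, zero_smul, add_zero, one_smul, add_sub_cancel, zero_mul, one_mul, one_pow,
    mul_one] at this
  norm_num at this
  rw [map_sub]
  linarith

/-- The gradient inequality. -/
lemma convexOn_gradient_le {f : E → ℝ} {f' : StrongDual ℝ E} {s : Set E} {x y : E}
    (hf : ConvexOn ℝ s f) (hx : x ∈ s) (hy : y ∈ s) (h : HasFDerivWithinAt f f' s x) :
    f x + f' (y - x) ≤ f y := by
  have hc : ConvexOn ℝ (Set.Icc (0 : ℝ) 1) fun r : ℝ => f (x + r • (y - x)) := by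
    refine ⟨convex_Icc 0 1, fun a ha b hb u v hu hv huv => ?_⟩
    have h1 := hf.2 (hf.1.add_smul_sub_mem hx hy ha) (hf.1.add_smul_sub_mem hx hy hb) hu hv huv
    refine le_trans (le_of_eq ?_) h1
    rw [smul_add, smul_add, add_add_add_comm, ← add_smul, huv, one_smul]
    simp only [smul_eq_mul, add_smul, mul_smul]
  have hd : HasDerivWithinAt (fun r : ℝ => f (x + r • (y - x))) (f' (y - x)) (Set.Icc 0 1) 0 :=
    hasDerivWithinAt_segment hf.1 hx hy (by simpa using h)
  have := hc.le_slope_of_hasDerivWithinAt (Set.left_mem_Icc.2 zero_le_one)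
    (Set.right_mem_Icc.2 zero_le_one) one_pos hd
  simp [slope_def_field] at this
  rw [map_sub]
  linarith

/-- A cocoercivity property of the gradient of a smooth convex function on a convex set, valid
without any interior: only directions pointing into the set enter. -/
lemma cocoercive {f : E → ℝ} {f' : E → StrongDual ℝ E} {s : Set E} {ν : ℝ}
    (hf : ConvexOn ℝ s f) (hd : ∀ x ∈ s, HasFDerivWithinAt f (f' x) s x)
    (hl : ∀ x ∈ s, ∀ y ∈ s, ‖f' x - f' y‖ ≤ ν * ‖x - y‖)
    {z x y : E} (hz : z ∈ s) (hx : x ∈ s) (hy : y ∈ s) :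
    3 * (f' x - f' z) (x - y) ≤ (f' x - f' z) (x - z) + 9 / 2 * ν * ‖x - y‖ ^ 2 := by
  have hs := hf.1
  have hlip : ∀ a ∈ s, ∀ b ∈ s, ∀ u, |(f' a - f' b) u| ≤ ν * ‖a - b‖ * ‖u‖ := fun a ha b hb u =>
    ((f' a - f' b).le_opNorm u).trans (mul_le_mul_of_nonneg_right (hl a ha b hb) (norm_nonneg _))
  have hdesc : ∀ a ∈ s, ∀ b ∈ s, f b ≤ f a + f' a (b - a) + ν / 2 * ‖b - a‖ ^ 2 := by
    intro a ha b hb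
    have := quadratic_lower_bound (f := fun x => -f x) (f' := fun x => -f' x) (c := -ν) hs
      (fun x hx => (hd x hx).neg) (fun x hx y hy => by
        have := (abs_le.1 (hlip x hx y hy (x - y))).2
        simp only [sub_apply, neg_apply] at this ⊢
        nlinarith) ha hb
    simp only [neg_apply] at this
    linarith
  have hmon : ∀ a ∈ s, ∀ b ∈ s, 0 ≤ (f' a - f' b) (a - b) := by
    intro a ha b hb
    have h1 := convexOn_gradient_le hf ha hb (hd a ha)
    have h2 := convexOn_gradient_le hf hb ha (hd b hb)
    have : f' a (b - a) = -f' a (a - b) := by rw [← map_neg, neg_sub]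
    rw [sub_apply]
    linarith
  set u := x - z
  set v := y - x
  -- the partition of the segment
  have key : ∀ n : ℕ, 3 ≤ n → 3 * (f' x - f' z) (x - y) ≤
      (f' x - f' z) u + 9 / 2 * ν * ‖v‖ ^ 2 + (6 * ν * ‖u‖ * ‖v‖ + |ν| * 9 * ‖v‖ ^ 2) / n := by
    intro n hn
    have hn0 : (0 : ℝ) < n := by positivity
    set p : ℕ → E := fun j => z + ((j : ℝ) / n) • u
    have hp : ∀ j ≤ n, p j ∈ s := fun j hj => hs.add_smul_sub_mem hz hx
      ⟨by positivity, (div_le_one hn0).2 (by exact_mod_cast hj)⟩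
    have hpsub : ∀ i j : ℕ, p i - p j = (((i : ℝ) - j) / n) • u := by
      intro i j
      simp only [p, add_sub_add_left_eq_sub, ← sub_smul, sub_div]
    -- The test point is `p (j + 1) + (3 / n) • v`. Its value is bounded above by the descent
    -- inequality at `p (j + 1)` and below by the gradient inequality at `p j`; convexity at `p (j +
    -- 1)` links the two. The point is a convex combination of `z`, `x`, `y` because `j + 1 ≥ 3`,
    -- which is why the first two nodes are treated apart.
    have hstep : ∀ j, 2 ≤ j → j + 1 ≤ n →
        3 / n * (f' (p j) - f' (p (j + 1))) v ≤
          1 / n * (f' (p (j + 1)) - f' (p j)) u + ν * (9 / n ^ 2) / 2 * ‖v‖ ^ 2 := by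
      intro j hj hjn
      have hq := hp j (by omega)
      have hp1 := hp (j + 1) hjn
      have hj3 : (3 : ℝ) ≤ j + 1 := by exact_mod_cast (by omega : 3 ≤ j + 1)
      have hjn' : (j : ℝ) + 1 ≤ n := by exact_mod_cast hjn
      have hw : p (j + 1) + (3 / (n : ℝ)) • v ∈ s := by
        have e : p (j + 1) + (3 / (n : ℝ)) • v =
            (1 - ((j : ℝ) + 1) / n) • z +
              ((((j : ℝ) + 1) / n - 3 / n) • x + (3 / (n : ℝ)) • y) := by
          simp only [p, u, v]; push_cast; module
        have hconv : Convex ℝ s := hs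
        rw [e]
        have a1 : 0 ≤ 1 - ((j : ℝ) + 1) / n := sub_nonneg.2 ((div_le_one hn0).2 hjn')
        have a2 : 0 ≤ ((j : ℝ) + 1) / n - 3 / n :=
          sub_nonneg.2 (div_le_div_of_nonneg_right hj3 hn0.le)
        have a3 : 0 ≤ 3 / (n : ℝ) := by positivity
        have := hconv.sum_mem (t := Finset.univ)
          (w := ![1 - ((j : ℝ) + 1) / n, ((j : ℝ) + 1) / n - 3 / n, 3 / (n : ℝ)]) (z := ![z, x, y])
          (by intro i _; fin_cases i <;> assumption)
          (by simp [Fin.sum_univ_three]) (by intro i _; fin_cases i <;> simpa)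
        simpa [Fin.sum_univ_three, add_assoc] using this
      have h1 := hdesc _ hp1 _ hw
      have h2 := convexOn_gradient_le hf hq hw (hd _ hq)
      have h3 := convexOn_gradient_le hf hp1 hq (hd _ hp1)
      have e1 : p (j + 1) + (3 / (n : ℝ)) • v - p (j + 1) = (3 / (n : ℝ)) • v := by abel
      have e2 : p (j + 1) + (3 / (n : ℝ)) • v - p j = (1 / (n : ℝ)) • u + (3 / (n : ℝ)) • v := by
        rw [add_sub_right_comm, hpsub]; push_cast; congr 2; ring
      have e3 : p j - p (j + 1) = -((1 / (n : ℝ)) • u) := by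
        rw [hpsub, ← neg_smul]; push_cast; congr 1; ring
      rw [e1, map_smul, norm_smul, smul_eq_mul, Real.norm_of_nonneg (by positivity), mul_pow,
        div_pow] at h1
      rw [e2, map_add, map_smul, map_smul, smul_eq_mul, smul_eq_mul] at h2
      rw [e3, map_neg, map_smul, smul_eq_mul] at h3
      simp only [sub_apply]
      norm_num at h1
      linarith
    have hsum : ∀ k, 2 + k ≤ n → 3 / n * (f' (p 2) - f' (p (2 + k))) v ≤
          1 / n * (f' (p (2 + k)) - f' (p 2)) u + k * (ν * (9 / n ^ 2) / 2 * ‖v‖ ^ 2) := by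
      intro k
      induction k with
      | zero => intro _; simp
      | succ k ih =>
        intro hk
        have h1 := ih (by omega)
        have h2 := hstep (2 + k) (by omega) (by omega)
        simp only [sub_apply, ← add_assoc] at h1 h2 ⊢
        push_cast
        linarith
    have h2n := hsum (n - 2) (by omega)
    have hpn : p (2 + (n - 2)) = x := by
      rw [show 2 + (n - 2) = n by omega]
      simp [p, u, div_self hn0.ne']
    have hp0 : p 0 = z := by simp [p]
    rw [hpn] at h2n
    have hq2 := hp 2 (by omega)
    -- the gap between `z` and `p 2`
    have hm := hmon _ hq2 _ hz
    have hl2 := (abs_le.1 (hlip _ hz _ hq2 v)).2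
    have e4 : p 2 - z = (2 / (n : ℝ)) • u := by
      have := hpsub 2 0
      rw [hp0] at this
      rw [this]; norm_num
    rw [e4, map_smul, smul_eq_mul] at hm
    have hm' : 0 ≤ (f' (p 2) - f' z) u := nonneg_of_mul_nonneg_right hm (by positivity)
    rw [norm_sub_rev, e4, norm_smul, Real.norm_of_nonneg (by positivity)] at hl2
    have hexy : (f' x - f' z) (x - y) = (f' z - f' x) v := by
      simp only [v, sub_apply, map_sub]; ring
    rw [hexy]
    have hcast : ((n - 2 : ℕ) : ℝ) = n - 2 := by
      rw [Nat.cast_sub (by omega)]; norm_num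
    rw [hcast] at h2n
    simp only [sub_apply] at h2n hm' hl2 ⊢
    have h5 : 3 * (f' (p 2) v - f' x v) ≤ (f' x u - f' (p 2) u) +
        (n - 2) / n * (ν * 9 / 2 * ‖v‖ ^ 2) := by
      have := mul_le_mul_of_nonneg_left h2n hn0.le
      have e6 : (n : ℝ) * (3 / n * (f' (p 2) v - f' x v)) = 3 * (f' (p 2) v - f' x v) := by
        field_simp
      have e7 : (n : ℝ) * (1 / n * (f' x u - f' (p 2) u) +
          (n - 2) * (ν * (9 / n ^ 2) / 2 * ‖v‖ ^ 2)) = (f' x u - f' (p 2) u) +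
        (n - 2) / n * (ν * 9 / 2 * ‖v‖ ^ 2) := by
        field_simp
      rwa [e6, e7] at this
    have h6 : ((n : ℝ) - 2) / n * (ν * 9 / 2 * ‖v‖ ^ 2) =
        9 / 2 * ν * ‖v‖ ^ 2 - (ν * 9 * ‖v‖ ^ 2) / n := by
      field_simp
    have h7 : -((ν * 9 * ‖v‖ ^ 2) / n) ≤ (|ν| * 9 * ‖v‖ ^ 2) / n := by
      rw [← neg_div]
      gcongr
      have := neg_abs_le ν
      nlinarith [sq_nonneg ‖v‖]
    have h8 : ν * (2 / n * ‖u‖) * ‖v‖ * 3 = (6 * ν * ‖u‖ * ‖v‖) / n := by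
      field_simp; ring
    rw [add_div]
    linarith
  rw [norm_sub_rev x y]
  refine le_of_forall_pos_le_add fun ε hε => ?_
  -- Refining the partition removes the error of order `1 / n` left by the first two nodes.
  obtain ⟨n, hn⟩ := exists_nat_gt ((6 * ν * ‖u‖ * ‖v‖ + |ν| * 9 * ‖v‖ ^ 2) / ε)
  have h1 := key (n + 3) (by omega)
  have h2 : (6 * ν * ‖u‖ * ‖v‖ + |ν| * 9 * ‖v‖ ^ 2) / ((n + 3 : ℕ) : ℝ) ≤ ε := by
    rw [div_le_iff₀ (by positivity)]
    rw [div_lt_iff₀ hε] at hn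
    push_cast
    nlinarith
  linarith

end Deterministic

/-! ### The composite proximal step. -/

section Prox

variable {E Ω : Type*} [NormedAddCommGroup E] [NormedSpace ℝ E]

lemma smul_sub_mem_unitBall {x₀ z : E} {R : ℝ} (hR : 0 < R) (hz : ‖z - x₀‖ ≤ R) :
    R⁻¹ • (z - x₀) ∈ Metric.closedBall (0 : E) 1 := by
  rw [mem_closedBall_zero_iff, norm_smul, norm_inv, Real.norm_of_nonneg hR.le,
    inv_mul_le_iff₀ hR, mul_one]
  exact hz

lemma DGF.hasFDerivWithinAt_loc (d : DGF E) {x₀ z : E} {R : ℝ} (hR : 0 < R)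
    (hz : z ∈ Metric.closedBall x₀ R) :
    HasFDerivWithinAt (d.loc x₀ R) (d.dloc x₀ R z) (Metric.closedBall x₀ R) z := by
  have h1 : HasFDerivWithinAt (fun z : E => R⁻¹ • (z - x₀)) (R⁻¹ • ContinuousLinearMap.id ℝ E)
      (Metric.closedBall x₀ R) z :=
    (((hasFDerivAt_id z).sub_const x₀).const_smul R⁻¹).hasFDerivWithinAt
  have hmaps : Set.MapsTo (fun z : E => R⁻¹ • (z - x₀)) (Metric.closedBall x₀ R)
      (Metric.closedBall 0 1) := fun y hy =>
    smul_sub_mem_unitBall hR (by rwa [← dist_eq_norm])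
  have h2 := ((d.hasFDerivWithinAt _ (hmaps hz)).comp z h1 hmaps).const_mul (R ^ 2)
  refine h2.congr_fderiv ?_
  ext v
  simp only [DGF.dloc, FunLike.coe_smul, Pi.smul_apply, smul_eq_mul,
    ContinuousLinearMap.comp_apply, ContinuousLinearMap.coe_id', id, map_smul]
  field_simp

lemma DGF.dloc_strong (d : DGF E) {x₀ : E} {R : ℝ} (hR : 0 < R) :
    ∀ x ∈ Metric.closedBall x₀ R, ∀ y ∈ Metric.closedBall x₀ R,
      1 * ‖x - y‖ ^ 2 ≤ (d.dloc x₀ R x - d.dloc x₀ R y) (x - y) := by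
  intro x hx y hy
  have hx' := smul_sub_mem_unitBall hR (x₀ := x₀) (z := x) (by rwa [← dist_eq_norm])
  have hy' := smul_sub_mem_unitBall hR (x₀ := x₀) (z := y) (by rwa [← dist_eq_norm])
  have h := d.strong _ hx' _ hy'
  have e : R⁻¹ • (x - x₀) - R⁻¹ • (y - x₀) = R⁻¹ • (x - y) := by
    rw [← smul_sub]; congr 1; abel
  rw [e, norm_smul, norm_inv, Real.norm_of_nonneg hR.le, map_smul, smul_eq_mul, mul_pow] at h
  simp only [DGF.dloc, sub_apply, smul_apply, smul_eq_mul] at h ⊢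
  rw [← mul_sub]
  have := mul_le_mul_of_nonneg_left h (sq_nonneg R)
  calc 1 * ‖x - y‖ ^ 2 = R ^ 2 * (R⁻¹ ^ 2 * ‖x - y‖ ^ 2) := by field_simp
    _ ≤ _ := this
    _ = _ := by field_simp

lemma DGF.half_sq_le_bregman (d : DGF E) {x₀ x z : E} {R : ℝ} (hR : 0 < R)
    (hx : x ∈ Metric.closedBall x₀ R) (hz : z ∈ Metric.closedBall x₀ R) :
    1 / 2 * ‖z - x‖ ^ 2 ≤ d.bregman x₀ R x z := by
  have := quadratic_lower_bound (convex_closedBall x₀ R)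
    (fun z hz => d.hasFDerivWithinAt_loc hR hz) (d.dloc_strong hR) hx hz
  rw [DGF.bregman]
  linarith

lemma DGF.continuousOn_bregman (d : DGF E) {x₀ : E} (x : E) {R : ℝ} (hR : 0 < R) :
    ContinuousOn (d.bregman x₀ R x) (Metric.closedBall x₀ R) := by
  have h1 : ContinuousOn (d.loc x₀ R) (Metric.closedBall x₀ R) := fun z hz =>
    (d.hasFDerivWithinAt_loc hR hz).continuousWithinAt
  unfold DGF.bregman
  fun_prop

lemma localSet_eq (o : Oracle E Ω) (x₀ : E) (R : ℝ) :
    o.localSet x₀ R = o.X ∩ Metric.closedBall x₀ R := by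
  ext z
  simp [Oracle.localSet, dist_eq_norm]

lemma convex_localSet {o : Oracle E Ω} (hX : Convex ℝ o.X) (x₀ : E) (R : ℝ) :
    Convex ℝ (o.localSet x₀ R) := by
  rw [localSet_eq]
  exact hX.inter (convex_closedBall _ _)

lemma prox_mem [FiniteDimensional ℝ E] {o : Oracle E Ω} (hX : IsClosed o.X) (d : DGF E) {x₀ : E}
    {R : ℝ} (hR : 0 < R) (hx₀ : x₀ ∈ o.X) {h : E → ℝ} (hh : Continuous h) (ζ : StrongDual ℝ E)
    (x : E) :
    prox o d x₀ R h ζ x ∈ o.localSet x₀ R ∧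
      IsMinOn (fun z => ζ z + h z + d.bregman x₀ R x z) (o.localSet x₀ R)
        (prox o d x₀ R h ζ x) := by
  refine Classical.epsilon_spec (p := fun y => y ∈ o.localSet x₀ R ∧
    IsMinOn (fun z => ζ z + h z + d.bregman x₀ R x z) (o.localSet x₀ R) y) ?_
  have := FiniteDimensional.proper_real E
  have hc : IsCompact (o.localSet x₀ R) := by
    rw [localSet_eq]
    exact (isCompact_closedBall _ _).inter_left hX
  refine hc.exists_isMinOn ⟨x₀, hx₀, by simp [hR.le]⟩ ?_
  have h1 := (d.continuousOn_bregman (x₀ := x₀) x hR).mono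
    (localSet_eq o x₀ R ▸ Set.inter_subset_right)
  fun_prop

/-- The three-point inequality for the composite proximal mapping. -/
lemma prox_three_point [FiniteDimensional ℝ E] {o : Oracle E Ω} (hX : IsClosed o.X)
    (hXc : Convex ℝ o.X) (d : DGF E) {x₀ : E} {R : ℝ} (hR : 0 < R) (hx₀ : x₀ ∈ o.X) {h : E → ℝ}
    (hh : Continuous h) (hhc : ConvexOn ℝ Set.univ h) (ζ : StrongDual ℝ E) (x : E) {z : E}
    (hz : z ∈ o.localSet x₀ R) :
    ζ (prox o d x₀ R h ζ x) + h (prox o d x₀ R h ζ x) + d.bregman x₀ R x (prox o d x₀ R h ζ x) +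
      d.bregman x₀ R (prox o d x₀ R h ζ x) z ≤ ζ z + h z + d.bregman x₀ R x z := by
  obtain ⟨hy, hmin⟩ := prox_mem hX d hR hx₀ hh ζ x
  set y := prox o d x₀ R h ζ x
  have hball : ∀ w ∈ o.localSet x₀ R, w ∈ Metric.closedBall x₀ R := fun w hw =>
    (localSet_eq o x₀ R ▸ hw : w ∈ o.X ∩ Metric.closedBall x₀ R).2
  set c := ζ (z - y) + (h z - h y) - d.dloc x₀ R x (z - y)
  have hder : HasDerivWithinAt (fun r : ℝ => r * c + d.loc x₀ R (y + r • (z - y)))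
      (1 * c + d.dloc x₀ R y (z - y)) (Set.Icc 0 1) 0 := by
    refine ((hasDerivAt_id (0 : ℝ)).mul_const c).hasDerivWithinAt.add ?_
    exact hasDerivWithinAt_segment (convex_closedBall _ _) (hball _ hy) (hball _ hz)
      (by simpa using d.hasFDerivWithinAt_loc hR (hball _ hy))
  -- The penalty need not be differentiable: along the segment it is replaced with its chord, which
  -- lies above it and agrees with it at `r = 0`, so minimality at `0` persists and the right
  -- derivative there is nonnegative.
  have hm : IsMinOn (fun r : ℝ => r * c + d.loc x₀ R (y + r • (z - y))) (Set.Icc 0 1) 0 := by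
    intro r hr
    have h1 := hmin ((convex_localSet hXc x₀ R).add_smul_sub_mem hy hz hr)
    have h2 := hhc.2 (Set.mem_univ y) (Set.mem_univ z) (sub_nonneg.2 hr.2) hr.1 (by ring)
    have e : (1 - r) • y + r • z = y + r • (z - y) := by module
    rw [e, smul_eq_mul, smul_eq_mul] at h2
    simp only [Set.mem_ofPred_eq, DGF.bregman] at h1 ⊢
    have e2 : y + r • (z - y) - x = (y - x) + r • (z - y) := by abel
    rw [e2, map_add, map_add, map_smul, map_smul, smul_eq_mul, smul_eq_mul] at h1
    simp only [c, zero_mul, zero_smul, add_zero, zero_add]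
    nlinarith
  have hnn : 0 ≤ 1 * c + d.dloc x₀ R y (z - y) := by
    have h1 : (1 : ℝ) ∈ posTangentConeAt (Set.Icc (0 : ℝ) 1) 0 :=
      mem_posTangentConeAt_of_segment_subset (by rw [zero_add, segment_eq_Icc zero_le_one])
    simpa using hm.localize.hasFDerivWithinAt_nonneg hder.hasFDerivWithinAt h1
  simp only [c, DGF.bregman, map_sub] at hnn ⊢
  linarith

/-- The mirror descent recursion for one composite proximal step with a stochastic gradient
`Δ + ξ`, where `Δ` is cocoercive. -/
lemma prox_step [FiniteDimensional ℝ E] {o : Oracle E Ω} (hX : IsClosed o.X)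
    (hXc : Convex ℝ o.X) (d : DGF E) {x₀ x xs : E} {R γ κ ν : ℝ} (hR : 0 < R) (hx₀ : x₀ ∈ o.X)
    (hx : x ∈ o.localSet x₀ R) (hxs : xs ∈ o.localSet x₀ R) (hγ : 0 < γ) (hκ : 0 ≤ κ)
    (hγν : γ * ν ≤ 1 / 4) (Δ ξ : StrongDual ℝ E)
    (hΔ : ∀ y ∈ o.X, 3 * Δ (x - y) ≤ Δ (x - xs) + 9 / 2 * ν * ‖x - y‖ ^ 2) :
    2 / 3 * γ * Δ (x - xs) + γ * ξ (x - xs) +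
        γ * κ * (‖prox o d x₀ R (fun z => γ * (κ * ‖z‖)) (γ • (Δ + ξ)) x‖ - ‖xs‖) ≤
      d.bregman x₀ R x xs -
        d.bregman x₀ R (prox o d x₀ R (fun z => γ * (κ * ‖z‖)) (γ • (Δ + ξ)) x) xs +
        2 * γ ^ 2 * ‖ξ‖ ^ 2 := by
  have hh : Continuous fun z : E => γ * (κ * ‖z‖) := by fun_prop
  have hhc : ConvexOn ℝ Set.univ fun z : E => γ * (κ * ‖z‖) := by
    have := (convexOn_univ_norm (E := E)).smul (mul_nonneg hγ.le hκ)
    simpa [smul_eq_mul, mul_assoc] using this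
  have h1 := prox_three_point hX hXc d hR hx₀ hh hhc (γ • (Δ + ξ)) x hxs
  obtain ⟨hy, -⟩ := prox_mem hX d hR hx₀ hh (γ • (Δ + ξ)) x
  set y := prox o d x₀ R (fun z => γ * (κ * ‖z‖)) (γ • (Δ + ξ)) x
  have hball : ∀ w ∈ o.localSet x₀ R, w ∈ Metric.closedBall x₀ R := fun w hw =>
    (localSet_eq o x₀ R ▸ hw : w ∈ o.X ∩ Metric.closedBall x₀ R).2
  have h2 := d.half_sq_le_bregman hR (hball _ hx) (hball _ hy)
  have h3 := hΔ y hy.1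
  have h4 : ξ (x - y) ≤ ‖ξ‖ * ‖x - y‖ := (le_abs_self _).trans (ξ.le_opNorm _)
  rw [norm_sub_rev] at h2
  simp only [smul_apply, add_apply, smul_eq_mul] at h1
  have h5 := mul_le_mul_of_nonneg_left h3 hγ.le
  have h6 := mul_le_mul_of_nonneg_left h4 hγ.le
  have h7 : γ * ν * ‖x - y‖ ^ 2 ≤ 1 / 4 * ‖x - y‖ ^ 2 :=
    mul_le_mul_of_nonneg_right hγν (sq_nonneg _)
  simp only [map_sub] at h5 h6 ⊢
  -- The proximal term `‖x - y‖² / 2` is spent exactly: `3 / 8` on the quadratic error of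
  -- cocoercivity, where `γ ν ≤ 1 / 4`, and `1 / 8` on `γ ‖ξ‖ ‖x - y‖ ≤ 2 γ² ‖ξ‖² + ‖x - y‖² / 8`.
  nlinarith [sq_nonneg (4 * γ * ‖ξ‖ - ‖x - y‖)]

end Prox

/-! ### Measurability of the proximal mapping. -/

section Measurability

variable {E Ω : Type*} [NormedAddCommGroup E] [NormedSpace ℝ E] [FiniteDimensional ℝ E]
  [MeasurableSpace E] [BorelSpace E]

/-- Nothing is known about `θ` and its gradient off the unit ball, so both are cut off to zero
there; this restores measurability and changes nothing where the divergence is used. -/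
lemma DGF.measurable_bregman {S : Type*} {_ : MeasurableSpace S} (d : DGF E) {R : ℝ} (hR : 0 < R)
    {x₀ x : S → E} (hx₀ : Measurable x₀) (hx : Measurable x) (z : E)
    (hx_mem : ∀ s, ‖x s - x₀ s‖ ≤ R) :
    ∃ f : S → ℝ, Measurable f ∧
      ∀ s, ‖z - x₀ s‖ ≤ R → d.bregman (x₀ s) R (x s) z = f s := by
  classical
  have := FiniteDimensional.proper_real E
  set θ' : E → ℝ := (Metric.closedBall (0 : E) 1).piecewise d.θ 0
  set dθ' : E → StrongDual ℝ E := (Metric.closedBall (0 : E) 1).piecewise d.dθ 0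
  have hθ : Measurable θ' := ContinuousOn.measurable_piecewise
    (fun z hz => (d.hasFDerivWithinAt z hz).continuousWithinAt) continuousOn_const
    Metric.isClosed_closedBall.measurableSet
  have hdθ : Measurable dθ' := ContinuousOn.measurable_piecewise
    d.continuousOn continuousOn_const Metric.isClosed_closedBall.measurableSet
  refine ⟨fun s => R ^ 2 * θ' (R⁻¹ • (z - x₀ s)) - R ^ 2 * θ' (R⁻¹ • (x s - x₀ s)) -
    (R • dθ' (R⁻¹ • (x s - x₀ s))) (z - x s), ?_, fun s hs => ?_⟩
  · have h1 : Measurable fun s => dθ' (R⁻¹ • (x s - x₀ s)) := by fun_prop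
    have h2 : Measurable fun s => (R • dθ' (R⁻¹ • (x s - x₀ s))) (z - x s) :=
      (isBoundedBilinearMap_apply (𝕜 := ℝ) (E := E) (F := ℝ)).continuous.measurable.comp
        ((h1.const_smul R).prodMk (hx.const_sub z))
    fun_prop
  · have h1 := smul_sub_mem_unitBall hR hs
    have h2 := smul_sub_mem_unitBall hR (hx_mem s)
    simp only [DGF.bregman, DGF.loc, DGF.dloc, θ', dθ', Set.piecewise_eq_of_mem _ _ _ h1,
      Set.piecewise_eq_of_mem _ _ _ h2]

/-- The composite proximal mapping is jointly measurable in the center, the point and the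
gradient. -/
lemma measurable_prox {S : Type*} {_ : MeasurableSpace S} {o : Oracle E Ω} (hX : IsClosed o.X)
    (hXc : Convex ℝ o.X) (d : DGF E) {R : ℝ} (hR : 0 < R) {x₀ x : S → E}
    {ζ : S → StrongDual ℝ E} (hx₀ : Measurable x₀) (hx : Measurable x) (hζ : Measurable ζ)
    (hx₀X : ∀ s, x₀ s ∈ o.X) (hx_mem : ∀ s, x s ∈ o.localSet (x₀ s) R) {h : E → ℝ}
    (hh : Continuous h) (hhc : ConvexOn ℝ Set.univ h) :
    Measurable fun s => prox o d (x₀ s) R h (ζ s) (x s) := by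
  classical
  rcases isEmpty_or_nonempty S with hS | ⟨⟨s₀⟩⟩
  · exact measurable_of_empty _
  have := FiniteDimensional.proper_real E
  have : Nonempty o.X := ⟨⟨x₀ s₀, hx₀X s₀⟩⟩
  obtain ⟨z', hz'⟩ := TopologicalSpace.exists_dense_seq o.X
  set z : ℕ → E := fun n => z' n
  have hzX : ∀ n, z n ∈ o.X := fun n => (z' n).2
  set F : S → E → ℝ := fun s w => ζ s w + h w + d.bregman (x₀ s) R (x s) w
  set y : S → E := fun s => prox o d (x₀ s) R h (ζ s) (x s)
  have hy : ∀ s, y s ∈ o.localSet (x₀ s) R := fun s =>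
    (prox_mem hX d hR (hx₀X s) hh (ζ s) (x s)).1
  have hball : ∀ s, ∀ w ∈ o.localSet (x₀ s) R, w ∈ Metric.closedBall (x₀ s) R := fun s w hw =>
    (localSet_eq o (x₀ s) R ▸ hw : w ∈ o.X ∩ Metric.closedBall (x₀ s) R).2
  -- Quadratic growth makes the minimizer unique and turns approximate minimality into proximity, so
  -- the minimizer is a limit of near-minimizers chosen measurably from a countable set.
  have hstrong : ∀ s, ∀ w ∈ o.localSet (x₀ s) R, F s (y s) + 1 / 2 * ‖w - y s‖ ^ 2 ≤ F s w :=
    fun s w hw => by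
      have h1 := prox_three_point hX hXc d hR (hx₀X s) hh hhc (ζ s) (x s) hw
      have h2 := d.half_sq_le_bregman hR (hball s _ (hy s)) (hball s _ hw)
      simp only [F, y] at h1 h2 ⊢
      linarith
  have hcont : ∀ s, ContinuousOn (F s) (o.localSet (x₀ s) R) := fun s => by
    have h1 := (d.continuousOn_bregman (x₀ := x₀ s) (x s) hR).mono (hball s)
    simp only [F]
    fun_prop
  -- The minimizer may lie on the sphere, where points of a sequence dense in `X` can fall outside
  -- the ball. It is first pushed slightly towards the center, into the open ball.
  have happrox : ∀ s, ∀ ε > 0, ∃ n, ‖z n - x₀ s‖ ≤ R ∧ F s (z n) < F s (y s) + ε := by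
    intro s ε hε
    have hseg : ∀ r ∈ Set.Icc (0 : ℝ) 1, y s + r • (x₀ s - y s) ∈ o.localSet (x₀ s) R := fun r hr =>
      (convex_localSet hXc _ _).add_smul_sub_mem (hy s) ⟨hx₀X s, by simp [hR.le]⟩ hr
    have hc : ContinuousWithinAt (fun r : ℝ => F s (y s + r • (x₀ s - y s))) (Set.Icc 0 1) 0 := by
      have h0 : ContinuousWithinAt (F s) (o.localSet (x₀ s) R) (y s + (0 : ℝ) • (x₀ s - y s)) := by
        simpa using hcont s _ (hy s)
      exact h0.comp (f := fun r : ℝ => y s + r • (x₀ s - y s))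
        (by fun_prop) hseg
    have hlt : ∀ᶠ r in nhdsWithin (0 : ℝ) (Set.Icc 0 1),
        F s (y s + r • (x₀ s - y s)) < F s (y s) + ε := by
      refine hc.eventually_lt continuousWithinAt_const ?_
      simpa using hε
    have hlt2 : ∀ᶠ r in nhdsWithin (0 : ℝ) (Set.Ioo 0 1),
        F s (y s + r • (x₀ s - y s)) < F s (y s) + ε :=
      hlt.filter_mono (nhdsWithin_mono _ Set.Ioo_subset_Icc_self)
    have : (nhdsWithin (0 : ℝ) (Set.Ioo 0 1)).NeBot := by
      rw [nhdsWithin_Ioo_eq_nhdsGT zero_lt_one]; infer_instance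
    obtain ⟨r, hr1, hr2⟩ := (hlt2.and self_mem_nhdsWithin).exists
    set v := y s + r • (x₀ s - y s)
    have hv := hseg r ⟨hr2.1.le, hr2.2.le⟩
    have hvR : v ∈ Metric.ball (x₀ s) R := by
      rw [Metric.mem_ball, dist_eq_norm]
      have e : v - x₀ s = (1 - r) • (y s - x₀ s) := by simp only [v]; module
      rw [e, norm_smul, Real.norm_of_nonneg (by linarith [hr2.2])]
      have := (hy s).2
      nlinarith [hr2.1, hr2.2, norm_nonneg (y s - x₀ s)]
    have hev : ∀ᶠ w in nhdsWithin v o.X, F s w < F s (y s) + ε ∧ ‖w - x₀ s‖ ≤ R := by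
      have hn : o.localSet (x₀ s) R ∈ nhdsWithin v o.X := by
        rw [localSet_eq]
        exact Filter.inter_mem self_mem_nhdsWithin (mem_nhdsWithin_of_mem_nhds
          (Filter.mem_of_superset (Metric.isOpen_ball.mem_nhds hvR) Metric.ball_subset_closedBall))
      have h1 := ((hcont s v hv).mono_of_mem_nhdsWithin hn).eventually_lt
        (continuousWithinAt_const (b := F s (y s) + ε)) hr1
      filter_upwards [h1, hn] with w hw1 hw2
      exact ⟨hw1, hw2.2⟩
    have hev' : ∀ᶠ w : o.X in nhds ⟨v, hv.1⟩, F s w < F s (y s) + ε ∧ ‖(w : E) - x₀ s‖ ≤ R := by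
      rw [nhds_subtype_eq_comap_nhdsWithin]
      exact Filter.Eventually.comap hev _
    obtain ⟨w, ⟨n, rfl⟩, hw⟩ := hz'.inter_nhds_nonempty hev'
    exact ⟨n, hw.2, hw.1⟩
  choose f hf hfe using fun n => d.measurable_bregman hR hx₀ hx (z n) (fun s => (hx_mem s).2)
  -- Near-minimality is tested only against the dense sequence, so it is a countable conjunction of
  -- measurable conditions; the least admissible index is then measurable.
  set p : ℕ → S → ℕ → Prop := fun k s n => ‖z n - x₀ s‖ ≤ R ∧ ∀ m, ‖z m - x₀ s‖ ≤ R →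
    ζ s (z n) + h (z n) + f n s ≤ ζ s (z m) + h (z m) + f m s + 1 / ((k : ℝ) + 1)
  have hF : ∀ n s, ‖z n - x₀ s‖ ≤ R → F s (z n) = ζ s (z n) + h (z n) + f n s := fun n s hn => by
    simp only [F, hfe n s hn]
  have hex : ∀ k s, ∃ n, p k s n := by
    intro k s
    obtain ⟨n, hn1, hn2⟩ := happrox s (1 / ((k : ℝ) + 1)) (by positivity)
    refine ⟨n, hn1, fun m hm => ?_⟩
    rw [← hF n s hn1, ← hF m s hm]
    have := hstrong s (z m) ⟨hzX m, hm⟩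
    nlinarith [sq_nonneg ‖z m - y s‖]
  have hpm : ∀ k n, MeasurableSet {s | p k s n} := by
    intro k n
    have hC : ∀ m, MeasurableSet {s | ‖z m - x₀ s‖ ≤ R} := fun m =>
      measurableSet_le (hx₀.const_sub (z m)).norm measurable_const
    have hφ : ∀ m, Measurable fun s => ζ s (z m) + h (z m) + f m s := fun m => by
      have : Measurable fun s => ζ s (z m) :=
        (ContinuousLinearMap.apply ℝ ℝ (z m)).continuous.measurable.comp hζ
      exact (this.add_const _).add (hf m)
    have : {s | p k s n} = {s | ‖z n - x₀ s‖ ≤ R} ∩ ⋂ m, ({s | ‖z m - x₀ s‖ ≤ R}ᶜ ∪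
        {s | ζ s (z n) + h (z n) + f n s ≤
          ζ s (z m) + h (z m) + f m s + 1 / ((k : ℝ) + 1)}) := by
      ext s
      simp only [p, Set.mem_ofPred_eq, Set.mem_inter_iff, Set.mem_iInter, Set.mem_union,
        Set.mem_compl_iff, imp_iff_not_or]
    rw [this]
    exact (hC n).inter (MeasurableSet.iInter fun m => (hC m).compl.union
      (measurableSet_le (hφ n) ((hφ m).add_const _)))
  have hsel : ∀ k, Measurable fun s => z (Nat.find (hex k s)) := fun k =>
    (measurable_from_nat (f := z)).comp (measurable_find (hex k) (hpm k))
  refine measurable_of_tendsto_metrizable hsel ?_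
  rw [tendsto_pi_nhds]
  intro s
  rw [tendsto_iff_norm_sub_tendsto_zero]
  have hb : ∀ k : ℕ, ‖z (Nat.find (hex k s)) - y s‖ ^ 2 ≤ 2 * (1 / ((k : ℝ) + 1)) := by
    intro k
    obtain ⟨h1, h2⟩ := Nat.find_spec (hex k s)
    have h3 := hstrong s _ ⟨hzX _, h1⟩
    have h4 : F s (z (Nat.find (hex k s))) ≤ F s (y s) + 1 / ((k : ℝ) + 1) := by
      refine le_of_forall_pos_le_add fun ε hε => ?_
      obtain ⟨m, hm1, hm2⟩ := happrox s ε hε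
      have h5 := h2 m hm1
      rw [← hF _ s h1, ← hF _ s hm1] at h5
      linarith
    linarith
  have hsq : Filter.Tendsto (fun k : ℕ => ‖z (Nat.find (hex k s)) - y s‖ ^ 2) Filter.atTop
      (nhds 0) := by
    refine squeeze_zero (fun k => sq_nonneg _) hb ?_
    simpa using tendsto_one_div_add_atTop_nhds_zero_nat.const_mul (2 : ℝ)
  simpa [Real.sqrt_sq_eq_abs] using hsq.sqrt

end Measurability

/-! ### Moment generating functions under the light-tail condition. -/

section SubGaussian

/-- Under expectation the linear term vanishes by centering, leaving an exponential of a square. -/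
lemma exp_le_add_exp_sq (x : ℝ) : Real.exp x ≤ x + Real.exp (x ^ 2) := by
  have h0 := Real.add_one_le_exp (x ^ 2)
  rcases le_or_gt |x| 1 with h | h
  · have := (abs_le.1 (Real.abs_exp_sub_one_sub_id_le h)).2
    linarith
  · rcases lt_abs.1 h with h | h
    · have : Real.exp x ≤ Real.exp (x ^ 2) := Real.exp_le_exp.2 (by nlinarith)
      linarith
    · have : Real.exp x ≤ 1 := Real.exp_le_one_iff.2 (by linarith)
      nlinarith

variable {E Ω : Type*} [NormedAddCommGroup E] [NormedSpace ℝ E] [MeasurableSpace Ω]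
  {P : Measure Ω} {ξ : Ω → StrongDual ℝ E} {σ : ℝ}

lemma abs_apply_le_of_pos (ξ : StrongDual ℝ E) (v : E) (hσ : 0 < σ) :
    |ξ v| ≤ ‖v‖ ^ 2 * σ ^ 2 / 4 + ‖ξ‖ ^ 2 / σ ^ 2 := by
  have h1 : |ξ v| ≤ ‖ξ‖ * ‖v‖ := ξ.le_opNorm v
  have h2 : ‖ξ‖ * ‖v‖ = (‖ξ‖ / σ) * (‖v‖ * σ) := by field_simp
  have h3 : ‖ξ‖ ^ 2 / σ ^ 2 = (‖ξ‖ / σ) ^ 2 := by rw [div_pow]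
  rw [h3]
  nlinarith [sq_nonneg (‖ξ‖ / σ - ‖v‖ * σ / 2)]

lemma integrable_exp_smul_sq (hm : AEStronglyMeasurable ξ P)
    (hi : Integrable (fun ω => Real.exp (‖ξ ω‖ ^ 2 / σ ^ 2)) P) {c : ℝ} (hc1 : c ≤ 1) :
    Integrable (fun ω => Real.exp (c * (‖ξ ω‖ ^ 2 / σ ^ 2))) P := by
  refine hi.mono' ?_ (Filter.Eventually.of_forall fun ω => ?_)
  · exact (by fun_prop : Continuous fun ζ : StrongDual ℝ E =>
      Real.exp (c * (‖ζ‖ ^ 2 / σ ^ 2))).comp_aestronglyMeasurable hm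
  · rw [Real.norm_of_nonneg (Real.exp_pos _).le]
    exact Real.exp_le_exp.2 (mul_le_of_le_one_left (by positivity) hc1)

lemma integrable_exp_apply (hm : AEStronglyMeasurable ξ P) (hσ : 0 < σ)
    (hi : Integrable (fun ω => Real.exp (‖ξ ω‖ ^ 2 / σ ^ 2)) P) (v : E) :
    Integrable (fun ω => Real.exp (ξ ω v)) P := by
  refine (hi.const_mul (Real.exp (‖v‖ ^ 2 * σ ^ 2 / 4))).mono' ?_
    (Filter.Eventually.of_forall fun ω => ?_)
  · exact Real.continuous_exp.comp_aestronglyMeasurable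
      ((ContinuousLinearMap.apply ℝ ℝ v).continuous.comp_aestronglyMeasurable hm)
  · rw [Real.norm_of_nonneg (Real.exp_pos _).le, ← Real.exp_add]
    exact Real.exp_le_exp.2 ((le_abs_self _).trans (abs_apply_le_of_pos _ _ hσ))

/-- Young's inequality with no use of centering: the constant `1` in the exponent is harmless when
`l σ ≥ 1`, the regime in which this bound serves. -/
lemma lintegral_exp_mul_norm_le (hσ : 0 < σ)
    (hle : ∫⁻ ω, ENNReal.ofReal (Real.exp (‖ξ ω‖ ^ 2 / σ ^ 2)) ∂P ≤ ENNReal.ofReal (Real.exp 1))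
    (l : ℝ) :
    ∫⁻ ω, ENNReal.ofReal (Real.exp (l * ‖ξ ω‖)) ∂P ≤
      ENNReal.ofReal (Real.exp (l ^ 2 * σ ^ 2 / 4 + 1)) := by
  calc _ ≤ ∫⁻ ω, ENNReal.ofReal (Real.exp (l ^ 2 * σ ^ 2 / 4)) *
          ENNReal.ofReal (Real.exp (‖ξ ω‖ ^ 2 / σ ^ 2)) ∂P := by
        refine lintegral_mono fun ω => ?_
        rw [← ENNReal.ofReal_mul (Real.exp_pos _).le, ← Real.exp_add]
        refine ENNReal.ofReal_le_ofReal (Real.exp_le_exp.2 ?_)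
        have h3 : ‖ξ ω‖ ^ 2 / σ ^ 2 = (‖ξ ω‖ / σ) ^ 2 := by rw [div_pow]
        have h2 : l * ‖ξ ω‖ = (‖ξ ω‖ / σ) * (l * σ) := by field_simp
        rw [h3, h2]
        nlinarith [sq_nonneg (‖ξ ω‖ / σ - l * σ / 2)]
    _ ≤ ENNReal.ofReal (Real.exp (l ^ 2 * σ ^ 2 / 4)) * ENNReal.ofReal (Real.exp 1) := by
        rw [lintegral_const_mul' _ _ ENNReal.ofReal_ne_top]
        gcongr
    _ = _ := by rw [← ENNReal.ofReal_mul (Real.exp_pos _).le, ← Real.exp_add]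

variable [IsProbabilityMeasure P]

/-- Convexity of `exp` between `0` and `‖ξ‖² / σ² - 1` with weight `c`; the second endpoint has
exponential moment at most `1`. -/
lemma integral_exp_smul_sq_le (hm : AEStronglyMeasurable ξ P)
    (hi : Integrable (fun ω => Real.exp (‖ξ ω‖ ^ 2 / σ ^ 2)) P)
    (hle : ∫ ω, Real.exp (‖ξ ω‖ ^ 2 / σ ^ 2) ∂P ≤ Real.exp 1) {c : ℝ} (hc0 : 0 ≤ c)
    (hc1 : c ≤ 1) :
    ∫ ω, Real.exp (c * (‖ξ ω‖ ^ 2 / σ ^ 2)) ∂P ≤ Real.exp c := by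
  have hpt : ∀ ω, Real.exp (c * (‖ξ ω‖ ^ 2 / σ ^ 2)) ≤
      Real.exp c * (1 - c) + Real.exp c * c * Real.exp (-1) * Real.exp (‖ξ ω‖ ^ 2 / σ ^ 2) := by
    intro ω
    have h := convexOn_exp.2 (Set.mem_univ (0 : ℝ)) (Set.mem_univ (‖ξ ω‖ ^ 2 / σ ^ 2 - 1))
      (sub_nonneg.2 hc1) hc0 (by ring)
    simp only [smul_eq_mul, mul_zero, zero_add, Real.exp_zero, mul_one] at h
    have h2 : Real.exp (c * (‖ξ ω‖ ^ 2 / σ ^ 2)) =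
        Real.exp c * Real.exp (c * (‖ξ ω‖ ^ 2 / σ ^ 2 - 1)) := by
      rw [← Real.exp_add]; ring_nf
    have h3 : Real.exp (‖ξ ω‖ ^ 2 / σ ^ 2 - 1) = Real.exp (-1) * Real.exp (‖ξ ω‖ ^ 2 / σ ^ 2) := by
      rw [← Real.exp_add]; ring_nf
    rw [h2, mul_assoc (Real.exp c * c), mul_assoc (Real.exp c), ← mul_add, ← h3]
    exact mul_le_mul_of_nonneg_left h (Real.exp_pos _).le
  calc _ ≤ ∫ ω, (Real.exp c * (1 - c) +
        Real.exp c * c * Real.exp (-1) * Real.exp (‖ξ ω‖ ^ 2 / σ ^ 2)) ∂P :=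
        integral_mono (integrable_exp_smul_sq hm hi hc1)
          ((integrable_const _).add (hi.const_mul _)) hpt
    _ = Real.exp c * (1 - c) +
        Real.exp c * c * Real.exp (-1) * ∫ ω, Real.exp (‖ξ ω‖ ^ 2 / σ ^ 2) ∂P := by
        rw [integral_add (integrable_const _) (hi.const_mul _), integral_const,
          integral_const_mul]
        simp
    _ ≤ Real.exp c * (1 - c) + Real.exp c * c * Real.exp (-1) * Real.exp 1 := by gcongr
    _ = Real.exp c := by
        rw [mul_assoc (Real.exp c * c), ← Real.exp_add]; simp; ring

/-- The moment generating function of a centered vector with `𝐄 exp (‖ξ‖² / σ²) ≤ e`. -/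
lemma integral_exp_apply_le (hm : Integrable ξ P) (hσ : 0 < σ) (h0 : ∫ ω, ξ ω ∂P = 0)
    (hi : Integrable (fun ω => Real.exp (‖ξ ω‖ ^ 2 / σ ^ 2)) P)
    (hle : ∫ ω, Real.exp (‖ξ ω‖ ^ 2 / σ ^ 2) ∂P ≤ Real.exp 1) (v : E) :
    ∫ ω, Real.exp (ξ ω v) ∂P ≤ Real.exp (5 / 4 * ‖v‖ ^ 2 * σ ^ 2) := by
  have hm' := hm.aestronglyMeasurable
  -- For short `v` centering gives the exponent `‖v‖² σ²`. For long `v` Young's inequality gives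
  -- `‖v‖² σ² / 4 + 1`, and `1 ≤ ‖v‖² σ²`; hence `5 / 4`.
  rcases le_total (‖v‖ * σ) 1 with hv | hv
  · have hc : ‖v‖ ^ 2 * σ ^ 2 ≤ 1 := by
      rw [← mul_pow]; exact pow_le_one₀ (by positivity) hv
    have hpt : ∀ ω, Real.exp (ξ ω v) ≤
        ξ ω v + Real.exp (‖v‖ ^ 2 * σ ^ 2 * (‖ξ ω‖ ^ 2 / σ ^ 2)) := by
      intro ω
      refine (exp_le_add_exp_sq _).trans (add_le_add_right (Real.exp_le_exp.2 ?_) _)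
      have h1 : |ξ ω v| ≤ ‖ξ ω‖ * ‖v‖ := (ξ ω).le_opNorm v
      have h2 : ‖v‖ ^ 2 * σ ^ 2 * (‖ξ ω‖ ^ 2 / σ ^ 2) = (‖ξ ω‖ * ‖v‖) ^ 2 := by
        field_simp
      rw [h2, ← sq_abs]
      exact pow_le_pow_left₀ (abs_nonneg _) h1 2
    have hlin : Integrable (fun ω => ξ ω v) P := hm.apply_continuousLinearMap v
    calc _ ≤ ∫ ω, (ξ ω v + Real.exp (‖v‖ ^ 2 * σ ^ 2 * (‖ξ ω‖ ^ 2 / σ ^ 2))) ∂P :=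
          integral_mono (integrable_exp_apply hm' hσ hi v)
            (hlin.add (integrable_exp_smul_sq hm' hi hc)) hpt
      _ = ∫ ω, Real.exp (‖v‖ ^ 2 * σ ^ 2 * (‖ξ ω‖ ^ 2 / σ ^ 2)) ∂P := by
          rw [integral_add hlin (integrable_exp_smul_sq hm' hi hc),
            ← ContinuousLinearMap.integral_apply hm, h0]
          simp
      _ ≤ Real.exp (‖v‖ ^ 2 * σ ^ 2) := integral_exp_smul_sq_le hm' hi hle (by positivity) hc
      _ ≤ _ := Real.exp_le_exp.2 (by nlinarith [sq_nonneg (‖v‖ * σ)])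
  · calc _ ≤ ∫ ω, Real.exp (‖v‖ ^ 2 * σ ^ 2 / 4) * Real.exp (‖ξ ω‖ ^ 2 / σ ^ 2) ∂P := by
          refine integral_mono (integrable_exp_apply hm' hσ hi v) (hi.const_mul _) fun ω => ?_
          simp only
          rw [← Real.exp_add]
          exact Real.exp_le_exp.2 ((le_abs_self _).trans (abs_apply_le_of_pos _ _ hσ))
      _ ≤ Real.exp (‖v‖ ^ 2 * σ ^ 2 / 4) * Real.exp 1 := by
          rw [integral_const_mul]; gcongr
      _ ≤ _ := by
          rw [← Real.exp_add]
          exact Real.exp_le_exp.2 (by nlinarith)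

lemma lintegral_exp_apply_le (hm : Integrable ξ P) (hσ : 0 < σ) (h0 : ∫ ω, ξ ω ∂P = 0)
    (hi : Integrable (fun ω => Real.exp (‖ξ ω‖ ^ 2 / σ ^ 2)) P)
    (hle : ∫ ω, Real.exp (‖ξ ω‖ ^ 2 / σ ^ 2) ∂P ≤ Real.exp 1) (v : E) :
    ∫⁻ ω, ENNReal.ofReal (Real.exp (ξ ω v)) ∂P ≤
      ENNReal.ofReal (Real.exp (5 / 4 * ‖v‖ ^ 2 * σ ^ 2)) := by
  rw [← ofReal_integral_eq_lintegral_ofReal (integrable_exp_apply hm.aestronglyMeasurable hσ hi v)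
    (Filter.Eventually.of_forall fun ω => (Real.exp_pos _).le)]
  exact ENNReal.ofReal_le_ofReal (integral_exp_apply_le hm hσ h0 hi hle v)

/-- The exponent has the shape of the smoothness bound for the conjugate of `θ`. The exponential of
a mean is at most the mean of the exponentials of the doubled terms; doubling turns `5 / 4` into
`5`. -/
lemma lintegral_exp_apply_add_sq_le (hm : Integrable ξ P) (hσ : 0 < σ) (h0 : ∫ ω, ξ ω ∂P = 0)
    (hi : Integrable (fun ω => Real.exp (‖ξ ω‖ ^ 2 / σ ^ 2)) P)
    (hle : ∫ ω, Real.exp (‖ξ ω‖ ^ 2 / σ ^ 2) ∂P ≤ Real.exp 1) {z : E} (hz : ‖z‖ ≤ 1) {l : ℝ}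
    (hl : l ^ 2 * σ ^ 2 ≤ 1) :
    ∫⁻ ω, ENNReal.ofReal (Real.exp (l * ξ ω z + l ^ 2 * ‖ξ ω‖ ^ 2 / 2)) ∂P ≤
      ENNReal.ofReal (Real.exp (5 * l ^ 2 * σ ^ 2)) := by
  have i1 := integrable_exp_apply hm.aestronglyMeasurable hσ hi ((2 * l) • z)
  have i2 := integrable_exp_smul_sq hm.aestronglyMeasurable hi hl
  calc _ ≤ ∫⁻ ω, ENNReal.ofReal (1 / 2 * Real.exp (ξ ω ((2 * l) • z)) +
          1 / 2 * Real.exp (l ^ 2 * σ ^ 2 * (‖ξ ω‖ ^ 2 / σ ^ 2))) ∂P := by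
        refine lintegral_mono fun ω => ENNReal.ofReal_le_ofReal ?_
        have h := convexOn_exp.2 (Set.mem_univ (ξ ω ((2 * l) • z)))
          (Set.mem_univ (l ^ 2 * σ ^ 2 * (‖ξ ω‖ ^ 2 / σ ^ 2)))
          (by norm_num : (0 : ℝ) ≤ 1 / 2) (by norm_num : (0 : ℝ) ≤ 1 / 2) (by norm_num)
        simp only [smul_eq_mul] at h
        refine le_trans (Real.exp_le_exp.2 (le_of_eq ?_)) h
        rw [map_smul, smul_eq_mul]
        field_simp
    _ = ENNReal.ofReal (∫ ω, (1 / 2 * Real.exp (ξ ω ((2 * l) • z)) +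
          1 / 2 * Real.exp (l ^ 2 * σ ^ 2 * (‖ξ ω‖ ^ 2 / σ ^ 2))) ∂P) :=
        (ofReal_integral_eq_lintegral_ofReal ((i1.const_mul _).add (i2.const_mul _))
          (Filter.Eventually.of_forall fun ω => by
            simp only [Pi.zero_apply, Pi.add_apply]; positivity)).symm
    _ ≤ _ := by
        refine ENNReal.ofReal_le_ofReal ?_
        rw [integral_add (i1.const_mul _) (i2.const_mul _), integral_const_mul, integral_const_mul]
        have h1 := integral_exp_apply_le hm hσ h0 hi hle ((2 * l) • z)
        have h2 := integral_exp_smul_sq_le hm.aestronglyMeasurable hi hle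
          (mul_nonneg (sq_nonneg l) (sq_nonneg σ)) hl
        have h3 : Real.exp (5 / 4 * ‖(2 * l) • z‖ ^ 2 * σ ^ 2) ≤ Real.exp (5 * l ^ 2 * σ ^ 2) := by
          refine Real.exp_le_exp.2 ?_
          rw [norm_smul, mul_pow, Real.norm_eq_abs, sq_abs]
          have : ‖z‖ ^ 2 ≤ 1 := pow_le_one₀ (norm_nonneg _) hz
          nlinarith [mul_nonneg (sq_nonneg l) (sq_nonneg σ)]
        have h4 : Real.exp (l ^ 2 * σ ^ 2) ≤ Real.exp (5 * l ^ 2 * σ ^ 2) :=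
          Real.exp_le_exp.2 (by nlinarith [mul_nonneg (sq_nonneg l) (sq_nonneg σ)])
        linarith

/-- A nonnegative random variable with values in `[0, 1 / 2]` has a small lower tail. -/
lemma lintegral_exp_neg_le {Y : Ω → ℝ} (hY : Integrable Y P) (h0 : ∀ᵐ ω ∂P, 0 ≤ Y ω)
    (h1 : ∀ᵐ ω ∂P, Y ω ≤ 1 / 2) :
    ∫⁻ ω, ENNReal.ofReal (Real.exp (-Y ω)) ∂P ≤
      ENNReal.ofReal (Real.exp (-(3 / 4 * ∫ ω, Y ω ∂P))) := by
  have hi : Integrable (fun ω => 1 - 3 / 4 * Y ω) P := (integrable_const _).sub (hY.const_mul _)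
  calc _ ≤ ∫⁻ ω, ENNReal.ofReal (1 - 3 / 4 * Y ω) ∂P := by
        refine lintegral_mono_ae ?_
        filter_upwards [h0, h1] with ω ha hb
        refine ENNReal.ofReal_le_ofReal ?_
        have h2 := Real.add_one_le_exp (Y ω)
        have h3 := Real.quadratic_le_exp_of_nonneg ha
        rw [Real.exp_neg, inv_le_iff_one_le_mul₀ (Real.exp_pos _)]
        nlinarith
    _ = ENNReal.ofReal (∫ ω, (1 - 3 / 4 * Y ω) ∂P) := by
        refine (ofReal_integral_eq_lintegral_ofReal hi ?_).symm
        filter_upwards [h1] with ω hb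
        simp only [Pi.zero_apply]
        linarith
    _ ≤ _ := by
        refine ENNReal.ofReal_le_ofReal ?_
        rw [integral_sub (integrable_const _) (hY.const_mul _), integral_const_mul]
        have := Real.add_one_le_exp (-(3 / 4 * ∫ ω, Y ω ∂P))
        simp only [integral_const, probReal_univ, smul_eq_mul, mul_one]
        linarith

end SubGaussian

/-! ### Past and future of the sample stream. -/

section Independence

variable {Ω S : Type*} [MeasurableSpace Ω]

/-- The information carried by the first `n` samples. -/
abbrev past (w : ℕ → S → Ω) (n : ℕ) : MeasurableSpace S :=
  ⨆ j ∈ Set.Iio n, MeasurableSpace.comap (w j) inferInstance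

/-- The information carried by all samples but the first `n`. -/
abbrev future (w : ℕ → S → Ω) (n : ℕ) : MeasurableSpace S :=
  ⨆ j ∈ Set.Ici n, MeasurableSpace.comap (w j) inferInstance

lemma past_mono (w : ℕ → S → Ω) {m n : ℕ} (h : m ≤ n) : past w m ≤ past w n :=
  biSup_mono fun _ hj => lt_of_lt_of_le hj h

lemma measurable_past (w : ℕ → S → Ω) {j n : ℕ} (h : j < n) : Measurable[past w n] (w j) :=
  measurable_iff_comap_le.2
    (le_iSup₂ (f := fun j (_ : j ∈ Set.Iio n) => MeasurableSpace.comap (w j) _) j h)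

lemma measurable_future (w : ℕ → S → Ω) {j n : ℕ} (h : n ≤ j) : Measurable[future w n] (w j) :=
  measurable_iff_comap_le.2
    (le_iSup₂ (f := fun j (_ : j ∈ Set.Ici n) => MeasurableSpace.comap (w j) _) j h)

lemma measurable_future_shift (w : ℕ → S → Ω) (n : ℕ) :
    Measurable[future w n] fun s l => w (n + l) s :=
  @measurable_pi_lambda S ℕ _ (future w n) _ _
    fun _ => measurable_future w (Nat.le_add_right _ _)

variable [mS : MeasurableSpace S] {μ : Measure S} {w : ℕ → S → Ω}

lemma past_le (hw : ∀ i, Measurable (w i)) (n : ℕ) : past w n ≤ mS :=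
  iSup₂_le fun j _ => (hw j).comap_le

lemma future_le (hw : ∀ i, Measurable (w i)) (n : ℕ) : future w n ≤ mS :=
  iSup₂_le fun j _ => (hw j).comap_le

lemma indep_past_future (hw : ∀ i, Measurable (w i)) (hi : iIndepFun w μ) (n : ℕ) :
    Indep (past w n) (future w n) μ :=
  indep_iSup_of_disjoint (fun i => (hw i).comap_le) hi.iIndep
    (Set.disjoint_left.2 fun _ h1 h2 => not_lt_of_ge (Set.mem_Ici.1 h2) (Set.mem_Iio.1 h1))

/-- One step of the exponential supermartingale argument: a future factor whose expectation is
bounded by `c`, uniformly in the past, multiplies the expectation by at most `c`. -/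
lemma lintegral_mul_le_of_indep [IsProbabilityMeasure μ] (hw : ∀ i, Measurable (w i))
    (hi : iIndepFun w μ) {n : ℕ} {α β : Type*} [MeasurableSpace α] [MeasurableSpace β]
    {M : S → ENNReal} (hM : Measurable[past w n] M) {X : S → α} (hX : Measurable[past w n] X)
    {V : S → β} (hV : Measurable[future w n] V) {φ : α → β → ENNReal}
    (hφ : Measurable (Function.uncurry φ)) {c : ENNReal}
    (hc : ∀ s, M s ≠ 0 → ∫⁻ s', φ (X s) (V s') ∂μ ≤ c) :
    ∫⁻ s, M s * φ (X s) (V s) ∂μ ≤ (∫⁻ s, M s ∂μ) * c := by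
  have hM' := hM.mono (past_le hw n) le_rfl
  have hX' := hX.mono (past_le hw n) le_rfl
  have hV' := hV.mono (future_le hw n) le_rfl
  have hU : Measurable[past w n] fun s => (M s, X s) :=
    hM.prodMk hX
  have hind : IndepFun (fun s => (M s, X s)) V μ := by
    rw [IndepFun_iff_Indep]
    exact indep_of_indep_of_le (indep_past_future hw hi n) (measurable_iff_comap_le.1 hU)
      (measurable_iff_comap_le.1 hV)
  have hmap := (indepFun_iff_map_prod_eq_prod_map_map (hM'.prodMk hX').aemeasurable
    hV'.aemeasurable).1 hind
  set g : (ENNReal × α) × β → ENNReal := fun p => p.1.1 * φ p.1.2 p.2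
  have hg : Measurable g := by
    have : Measurable fun p : (ENNReal × α) × β => φ p.1.2 p.2 :=
      hφ.comp ((measurable_snd.comp measurable_fst).prodMk measurable_snd)
    exact (measurable_fst.comp measurable_fst).mul this
  have hUm : Measurable fun s => (M s, X s) := hM'.prodMk hX'
  calc ∫⁻ s, M s * φ (X s) (V s) ∂μ
      = ∫⁻ p, g p ∂(μ.map fun s => ((M s, X s), V s)) :=
        (lintegral_map hg (hUm.prodMk hV')).symm
    _ = ∫⁻ u, ∫⁻ v, g (u, v) ∂(μ.map V) ∂(μ.map fun s => (M s, X s)) := by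
        have := Measure.isProbabilityMeasure_map (μ := μ) hV'.aemeasurable
        rw [hmap, lintegral_prod _ hg.aemeasurable]
    _ = ∫⁻ s, ∫⁻ v, g ((M s, X s), v) ∂(μ.map V) ∂μ := by
        have := Measure.isProbabilityMeasure_map (μ := μ) hV'.aemeasurable
        exact lintegral_map hg.lintegral_prod_right' hUm
    _ ≤ ∫⁻ s, M s * c ∂μ := by
        refine lintegral_mono fun s => ?_
        simp only [g]
        have hφs : Measurable (φ (X s)) := hφ.of_uncurry_left
        have hφV : Measurable fun a => φ (X s) (V a) := hφs.comp hV'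
        rw [lintegral_map (hφs.const_mul _) hV', lintegral_const_mul _ hφV]
        rcases eq_or_ne (M s) 0 with h | h
        · simp [h]
        · gcongr
          exact hc s h
    _ = _ := lintegral_mul_const _ hM'

lemma lintegral_prod_le [IsProbabilityMeasure μ] {P : Measure Ω}
    (hw : ∀ i, MeasurePreserving (w i) μ P) (hi : iIndepFun w μ) {f : Ω → ENNReal}
    (hf : Measurable f) {c : ENNReal} (hc : ∫⁻ ω, f ω ∂P ≤ c) (k L : ℕ) :
    ∫⁻ s, ∏ l ∈ Finset.range L, f (w (k + l) s) ∂μ ≤ c ^ L := by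
  have hwm := fun i => (hw i).measurable
  induction L with
  | zero => simp
  | succ L ih =>
    simp_rw [Finset.prod_range_succ]
    have hM : Measurable[past w (k + L)] fun s => ∏ l ∈ Finset.range L, f (w (k + l) s) :=
      @Finset.measurable_fun_prod _ _ _ _ _ _ (past w (k + L)) _ _ fun l hl =>
        hf.comp (measurable_past w (by simpa using hl))
    refine (lintegral_mul_le_of_indep hwm hi (n := k + L) (X := fun _ => ()) hM
      (@measurable_const _ _ _ (past w (k + L)) _) (measurable_future w le_rfl)
      (φ := fun _ => f) (hf.comp measurable_snd) (c := c) fun s _ => ?_).trans ?_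
    · rw [← lintegral_map hf (hwm _), (hw _).map_eq]
      exact hc
    · rw [pow_succ]
      gcongr

end Independence

/-- Chernoff with `l = r / (2 D)` and `r² = 8 D k` gives the tail `exp (a - 2 k)` at level `k` of
`Z² / (8 D)`, which beats the weight `exp (k + 1)` of that level. The resulting geometric series
sums to at most `exp (a + 2)`. -/
lemma lintegral_exp_sq_le_of_mgf {S : Type*} [MeasurableSpace S] {μ : Measure S} {Z : S → ℝ}
    (hZ : Measurable Z) (hZ0 : ∀ s, 0 ≤ Z s) {a D : ℝ} (hD : 0 < D)
    (h : ∀ l : ℝ, 0 ≤ l → ∫⁻ s, ENNReal.ofReal (Real.exp (l * Z s)) ∂μ ≤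
      ENNReal.ofReal (Real.exp (a + D * l ^ 2))) :
    ∫⁻ s, ENNReal.ofReal (Real.exp (Z s ^ 2 / (8 * D))) ∂μ ≤
      ENNReal.ofReal (Real.exp (a + 2)) := by
  have htail : ∀ k : ℕ, μ {s | (k : ℝ) ≤ Z s ^ 2 / (8 * D)} ≤
      ENNReal.ofReal (Real.exp (a - 2 * k)) := by
    intro k
    set r := √(8 * D * k)
    have hr : r ^ 2 = 8 * D * k := Real.sq_sqrt (by positivity)
    have hsub : {s | (k : ℝ) ≤ Z s ^ 2 / (8 * D)} ⊆
        {s | ENNReal.ofReal (Real.exp (r / (2 * D) * r)) ≤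
          ENNReal.ofReal (Real.exp (r / (2 * D) * Z s))} := by
      intro s hs
      refine ENNReal.ofReal_le_ofReal (Real.exp_le_exp.2 ?_)
      have : r ≤ Z s := by
        refine Real.sqrt_le_iff.2 ⟨hZ0 s, ?_⟩
        have := (le_div_iff₀ (by positivity : 0 < 8 * D)).1 hs
        linarith
      gcongr
    have hm : AEMeasurable (fun s => ENNReal.ofReal (Real.exp (r / (2 * D) * Z s))) μ := by
      fun_prop
    calc μ {s | (k : ℝ) ≤ Z s ^ 2 / (8 * D)} ≤ _ := measure_mono hsub
      _ ≤ (∫⁻ s, ENNReal.ofReal (Real.exp (r / (2 * D) * Z s)) ∂μ) /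
          ENNReal.ofReal (Real.exp (r / (2 * D) * r)) :=
          meas_ge_le_lintegral_div hm (by simp [Real.exp_pos]) ENNReal.ofReal_ne_top
      _ ≤ ENNReal.ofReal (Real.exp (a + D * (r / (2 * D)) ^ 2)) /
          ENNReal.ofReal (Real.exp (r / (2 * D) * r)) := by
          gcongr
          exact h _ (by positivity)
      _ = ENNReal.ofReal (Real.exp (a - 2 * k)) := by
          rw [← ENNReal.ofReal_div_of_pos (Real.exp_pos _), ← Real.exp_sub]
          congr 2
          field_simp
          rw [hr]; ring
  have hr0 : (0 : ℝ) ≤ Real.exp (-1) := (Real.exp_pos _).le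
  have hr1 : Real.exp (-1) < 1 := Real.exp_lt_one_iff.2 (by norm_num)
  have hmeas : ∀ k : ℕ, MeasurableSet {s | (k : ℝ) ≤ Z s ^ 2 / (8 * D)} := fun k =>
    measurableSet_le measurable_const (by fun_prop)
  calc ∫⁻ s, ENNReal.ofReal (Real.exp (Z s ^ 2 / (8 * D))) ∂μ
      ≤ ∫⁻ s, ∑' k : ℕ, Set.indicator {s | (k : ℝ) ≤ Z s ^ 2 / (8 * D)}
          (fun _ => ENNReal.ofReal (Real.exp (k + 1))) s ∂μ := by
        refine lintegral_mono fun s => ?_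
        have hx : 0 ≤ Z s ^ 2 / (8 * D) := by positivity
        refine le_trans ?_ (ENNReal.le_tsum ⌊Z s ^ 2 / (8 * D)⌋₊)
        rw [Set.indicator_of_mem (by exact Nat.floor_le hx)]
        exact ENNReal.ofReal_le_ofReal (Real.exp_le_exp.2 (Nat.lt_floor_add_one _).le)
    _ = ∑' k : ℕ, ENNReal.ofReal (Real.exp (k + 1)) * μ {s | (k : ℝ) ≤ Z s ^ 2 / (8 * D)} := by
        rw [lintegral_tsum fun k => (measurable_const.indicator (hmeas k)).aemeasurable]
        congr 1 with k
        rw [lintegral_indicator_const (hmeas k)]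
    _ ≤ ∑' k : ℕ, ENNReal.ofReal (Real.exp (a + 1) * Real.exp (-1) ^ k) := by
        refine ENNReal.tsum_le_tsum fun k => ?_
        refine (mul_le_mul_right (htail k) _).trans (le_of_eq ?_)
        rw [← ENNReal.ofReal_mul (Real.exp_pos _).le, ← Real.exp_add, ← Real.exp_nat_mul,
          ← Real.exp_add]
        congr 2; ring
    _ = ENNReal.ofReal (Real.exp (a + 1) * (1 - Real.exp (-1))⁻¹) := by
        rw [← ENNReal.ofReal_tsum_of_nonneg (fun k => by positivity)
          ((summable_geometric_of_lt_one hr0 hr1).mul_left _), tsum_mul_left,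
          tsum_geometric_of_lt_one hr0 hr1]
    _ ≤ _ := by
        refine ENNReal.ofReal_le_ofReal ?_
        rw [← div_eq_mul_inv, div_le_iff₀ (sub_pos.2 hr1), mul_sub, mul_one, ← Real.exp_add,
          show a + 2 + -1 = a + 1 by ring]
        have h1 : Real.exp (a + 2) = Real.exp 1 * Real.exp (a + 1) := by
          rw [← Real.exp_add]; ring_nf
        have h2 := Real.add_one_le_exp (1 : ℝ)
        rw [h1]
        nlinarith [Real.exp_pos (a + 1)]

/-! ### The conjugate of the distance-generating function as a smooth proxy for the dual norm. -/

section Conjugate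

variable {E : Type*} [NormedAddCommGroup E] [NormedSpace ℝ E]

lemma DGF.dθ_zero (d : DGF E) : d.dθ 0 = 0 := by
  have h0 : (0 : E) ∈ Metric.closedBall (0 : E) 1 := by simp
  have hd : HasFDerivAt d.θ (d.dθ 0) 0 :=
    (d.hasFDerivWithinAt 0 h0).hasFDerivAt (Metric.closedBall_mem_nhds _ one_pos)
  have hm : IsLocalMin d.θ 0 := by
    filter_upwards [Metric.closedBall_mem_nhds (0 : E) one_pos] with z hz
    rw [d.map_zero]
    exact d.nonneg z hz
  exact hm.hasFDerivAt_eq_zero hd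

lemma DGF.bregman_center (d : DGF E) (x₀ z : E) (R : ℝ) :
    d.bregman x₀ R x₀ z = d.loc x₀ R z := by
  simp [DGF.bregman, DGF.loc, DGF.dloc, d.map_zero, d.dθ_zero]

lemma DGF.continuousOn_θ (d : DGF E) : ContinuousOn d.θ (Metric.closedBall 0 1) :=
  fun z hz => (d.hasFDerivWithinAt z hz).continuousWithinAt

/-- The conjugate of `θ` on the dual space. -/
noncomputable def DGF.conj (d : DGF E) (ζ : StrongDual ℝ E) : ℝ :=
  sSup ((fun z => ζ z - d.θ z) '' Metric.closedBall 0 1)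

lemma DGF.conj_le (d : DGF E) {ζ : StrongDual ℝ E} {c : ℝ}
    (h : ∀ z ∈ Metric.closedBall (0 : E) 1, ζ z - d.θ z ≤ c) : d.conj ζ ≤ c :=
  csSup_le ((Metric.nonempty_closedBall.2 zero_le_one).image _)
    (by rintro _ ⟨z, hz, rfl⟩; exact h z hz)

lemma DGF.conj_zero_le (d : DGF E) : d.conj 0 ≤ 0 :=
  d.conj_le fun z hz => by simpa using d.nonneg z hz

variable [FiniteDimensional ℝ E]

lemma DGF.le_Theta (d : DGF E) {z : E} (hz : z ∈ Metric.closedBall (0 : E) 1) :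
    d.θ z ≤ d.Theta := by
  have := FiniteDimensional.proper_real E
  exact le_csSup ((isCompact_closedBall _ _).bddAbove_image d.continuousOn_θ)
    (Set.mem_image_of_mem _ hz)

lemma DGF.Theta_nonneg (d : DGF E) : 0 ≤ d.Theta := by
  have := d.le_Theta (z := 0) (by simp)
  rwa [d.map_zero] at this

/-- Strong convexity at a unit vector, which exists only in a nontrivial space. This lower bound
lets `Θ + t` absorb numerical constants and rounding later. -/
lemma DGF.half_le_Theta [Nontrivial E] (d : DGF E) : 1 / 2 ≤ d.Theta := by
  obtain ⟨z, hz⟩ := exists_norm_eq E zero_le_one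
  have h1 : z ∈ Metric.closedBall (0 : E) 1 := by simp [hz]
  have h := d.half_sq_le_bregman (x₀ := 0) (x := 0) (z := z) one_pos (by simp) h1
  rw [d.bregman_center, DGF.loc] at h
  simp [hz] at h
  have := d.le_Theta h1
  linarith

lemma DGF.loc_le (d : DGF E) {x₀ z : E} {R : ℝ} (hR : 0 < R) (hz : ‖z - x₀‖ ≤ R) :
    d.loc x₀ R z ≤ R ^ 2 * d.Theta :=
  mul_le_mul_of_nonneg_left (d.le_Theta (smul_sub_mem_unitBall hR hz)) (sq_nonneg R)

lemma DGF.le_conj (d : DGF E) (ζ : StrongDual ℝ E) {z : E}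
    (hz : z ∈ Metric.closedBall (0 : E) 1) : ζ z - d.θ z ≤ d.conj ζ := by
  have := FiniteDimensional.proper_real E
  have hc : ContinuousOn (fun z => ζ z - d.θ z) (Metric.closedBall 0 1) :=
    ζ.continuous.continuousOn.sub d.continuousOn_θ
  exact le_csSup ((isCompact_closedBall _ _).bddAbove_image hc) (Set.mem_image_of_mem _ hz)

/-- Fenchel's inequality at unit vectors and their opposites. The dual norm itself is not smooth;
this proxy is, at the additive cost `Θ`. -/
lemma DGF.norm_le_conj (d : DGF E) (ζ : StrongDual ℝ E) : ‖ζ‖ ≤ d.Theta + d.conj ζ := by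
  have h : ∀ z ∈ Metric.closedBall (0 : E) 1, ζ z ≤ d.Theta + d.conj ζ := fun z hz => by
    have h1 := d.le_conj ζ hz
    have h2 := d.le_Theta hz
    linarith
  have h0 : 0 ≤ d.Theta + d.conj ζ := by simpa using h 0 (by simp)
  refine ζ.opNorm_le_of_unit_norm h0 fun z hz => ?_
  rw [Real.norm_eq_abs, abs_le]
  have h1 := h z (by simp [hz])
  have h2 := h (-z) (by simp [hz])
  rw [map_neg] at h2
  exact ⟨by linarith, h1⟩

lemma DGF.lipschitzWith_conj (d : DGF E) : LipschitzWith 1 d.conj := by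
  refine LipschitzWith.of_le_add fun ζ η => d.conj_le fun z hz => ?_
  have h1 := d.le_conj η hz
  have h2 : (ζ - η) z ≤ ‖ζ - η‖ * ‖z‖ := (le_abs_self _).trans ((ζ - η).le_opNorm z)
  have h3 : ‖z‖ ≤ 1 := by simpa using hz
  rw [sub_apply] at h2
  rw [dist_eq_norm]
  nlinarith [norm_nonneg (ζ - η)]

/-- The conjugate of a strongly convex function is smooth. -/
lemma DGF.exists_conj_add_le (d : DGF E) (ζ : StrongDual ℝ E) :
    ∃ y : E, ‖y‖ ≤ 1 ∧ ∀ η, d.conj (ζ + η) ≤ d.conj ζ + η y + ‖η‖ ^ 2 / 2 := by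
  -- A dummy oracle on the whole space: the proximal point for the gradient `-ζ` centered at `0`
  -- maximizes `ζ z - θ z` over the unit ball, and the three-point inequality supplies quadratic
  -- decay around it.
  set o : Oracle E Unit := ⟨Set.univ, fun _ _ => 0, fun _ _ => 0⟩
  have hc : Continuous fun _ : E => (0 : ℝ) := continuous_const
  have hmem := (prox_mem (o := o) isClosed_univ d one_pos (Set.mem_univ 0) hc (-ζ) 0).1
  have h3 := fun z => prox_three_point (o := o) (z := z) isClosed_univ convex_univ d one_pos
    (Set.mem_univ 0) hc (convexOn_const 0 convex_univ) (-ζ) 0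
  set y := prox o d 0 1 (fun _ => (0 : ℝ)) (-ζ) 0
  have hball : ∀ z, z ∈ Metric.closedBall (0 : E) 1 → z ∈ o.localSet 0 1 := fun z hz =>
    ⟨Set.mem_univ z, by simpa using hz⟩
  have hloc : ∀ z, d.bregman 0 1 0 z = d.θ z := fun z => by
    rw [d.bregman_center, DGF.loc]; simp
  have hy : y ∈ Metric.closedBall (0 : E) 1 := by simpa using hmem.2
  refine ⟨y, by simpa using hy, fun η => d.conj_le fun z hz => ?_⟩
  have h4 := h3 z (hball z hz)
  rw [hloc, hloc] at h4
  have h5 := d.half_sq_le_bregman (x₀ := 0) (x := y) (z := z) one_pos hy hz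
  have h6 := d.le_conj ζ hy
  have h7 : η (z - y) ≤ ‖η‖ * ‖z - y‖ := (le_abs_self _).trans (η.le_opNorm _)
  simp only [map_sub, neg_apply, add_apply] at h4 h7 ⊢
  nlinarith [sq_nonneg (‖η‖ - ‖z - y‖)]

end Conjugate

/-! ### Concentration for batches of samples. -/

section Batch

variable {E Ω S : Type*} [NormedAddCommGroup E] [NormedSpace ℝ E] [FiniteDimensional ℝ E]
  [MeasurableSpace Ω] [MeasurableSpace S]
  {P : Measure Ω} [IsProbabilityMeasure P] {μ : Measure S} [IsProbabilityMeasure μ]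
  {w : ℕ → S → Ω} {ξ : Ω → StrongDual ℝ E} {σ : ℝ}

/-- Adding one sample to the sum changes the conjugate by at most a linear term plus half a squared
norm, with the linear direction in the unit ball and fixed by the past. By independence each sample
then costs one factor, with no dimension involved. -/
lemma lintegral_exp_conj_sum_le (d : DGF E) (hw : ∀ i, MeasurePreserving (w i) μ P)
    (hi : iIndepFun w μ) (hm : Integrable ξ P) (hξm : Measurable ξ) (hσ : 0 < σ)
    (h0 : ∫ ω, ξ ω ∂P = 0)
    (hint : Integrable (fun ω => Real.exp (‖ξ ω‖ ^ 2 / σ ^ 2)) P)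
    (hle : ∫ ω, Real.exp (‖ξ ω‖ ^ 2 / σ ^ 2) ∂P ≤ Real.exp 1) {l : ℝ}
    (hl : l ^ 2 * σ ^ 2 ≤ 1) (k L : ℕ) :
    ∫⁻ s, ENNReal.ofReal (Real.exp (d.conj (∑ j ∈ Finset.range L, l • ξ (w (k + j) s)))) ∂μ ≤
      ENNReal.ofReal (Real.exp (5 * l ^ 2 * σ ^ 2)) ^ L := by
  have hwm := fun i => (hw i).measurable
  have hcm : Measurable d.conj := d.lipschitzWith_conj.continuous.measurable
  induction L with
  | zero =>
    simp only [Finset.range_zero, Finset.sum_empty, lintegral_const, measure_univ, mul_one,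
      pow_zero]
    exact ENNReal.ofReal_le_one.2 (Real.exp_le_one_iff.2 d.conj_zero_le)
  | succ L ih =>
    have hX : Measurable[past w (k + L)] fun s => ∑ j ∈ Finset.range L, l • ξ (w (k + j) s) :=
      Finset.measurable_fun_sum _ fun j hj =>
        (hξm.comp (measurable_past w (by simpa using hj))).const_smul l
    have hM : Measurable[past w (k + L)] fun s =>
        ENNReal.ofReal (Real.exp (d.conj (∑ j ∈ Finset.range L, l • ξ (w (k + j) s)))) :=
      (Real.measurable_exp.comp (hcm.comp hX)).ennreal_ofReal
    set φ : StrongDual ℝ E → Ω → ENNReal := fun ζ ω =>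
      ENNReal.ofReal (Real.exp (d.conj (ζ + l • ξ ω) - d.conj ζ))
    have hφ : Measurable (Function.uncurry φ) := by
      have h1 : Measurable fun p : StrongDual ℝ E × Ω => d.conj (p.1 + l • ξ p.2) :=
        hcm.comp (measurable_fst.add ((hξm.comp measurable_snd).const_smul l))
      have h2 : Measurable fun p : StrongDual ℝ E × Ω => d.conj p.1 := hcm.comp measurable_fst
      exact (Real.measurable_exp.comp (h1.sub h2)).ennreal_ofReal
    have hc : ∀ ζ, ∫⁻ s, φ ζ (w (k + L) s) ∂μ ≤ ENNReal.ofReal (Real.exp (5 * l ^ 2 * σ ^ 2)) := by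
      intro ζ
      obtain ⟨y, hy, hyc⟩ := d.exists_conj_add_le ζ
      have hf : Measurable (φ ζ) := hφ.of_uncurry_left
      rw [← lintegral_map hf (hwm _), (hw _).map_eq]
      refine (lintegral_mono fun ω => ?_).trans
        (lintegral_exp_apply_add_sq_le hm hσ h0 hint hle hy hl)
      refine ENNReal.ofReal_le_ofReal (Real.exp_le_exp.2 ?_)
      have := hyc (l • ξ ω)
      rw [norm_smul, mul_pow, Real.norm_eq_abs, sq_abs, smul_apply, smul_eq_mul] at this
      linarith
    have key := lintegral_mul_le_of_indep hwm hi hM hX (V := w (k + L))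
      (measurable_future w le_rfl) hφ fun s _ => hc _
    rw [pow_succ]
    refine le_trans (le_of_eq ?_) (key.trans (mul_le_mul_left ih _))
    refine lintegral_congr fun s => ?_
    rw [← ENNReal.ofReal_mul (Real.exp_pos _).le, ← Real.exp_add, Finset.sum_range_succ]
    congr 3
    ring_nf

/-- Concentration of the norm of a sum of independent centered sub-Gaussian vectors. -/
lemma lintegral_exp_norm_sum_le (d : DGF E) (hw : ∀ i, MeasurePreserving (w i) μ P)
    (hi : iIndepFun w μ) (hm : Integrable ξ P) (hξm : Measurable ξ) (hσ : 0 < σ)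
    (h0 : ∫ ω, ξ ω ∂P = 0)
    (hsub : ∫⁻ ω, ENNReal.ofReal (Real.exp (‖ξ ω‖ ^ 2 / σ ^ 2)) ∂P ≤
      ENNReal.ofReal (Real.exp 1))
    (hint : Integrable (fun ω => Real.exp (‖ξ ω‖ ^ 2 / σ ^ 2)) P)
    (hle : ∫ ω, Real.exp (‖ξ ω‖ ^ 2 / σ ^ 2) ∂P ≤ Real.exp 1) {l : ℝ} (hl : 0 ≤ l)
    (k L : ℕ) :
    ∫⁻ s, ENNReal.ofReal (Real.exp (l * ‖∑ j ∈ Finset.range L, ξ (w (k + j) s)‖)) ∂μ ≤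
      ENNReal.ofReal (Real.exp (d.Theta + 5 * L * σ ^ 2 * l ^ 2)) := by
  -- Small `l`: the conjugate bound. Large `l`: the triangle inequality suffices, since `l² σ² / 4 +
  -- 1 ≤ 5 l² σ²`.
  rcases le_total (l ^ 2 * σ ^ 2) 1 with h | h
  · calc _ ≤ ∫⁻ s, ENNReal.ofReal (Real.exp d.Theta) * ENNReal.ofReal
          (Real.exp (d.conj (∑ j ∈ Finset.range L, l • ξ (w (k + j) s)))) ∂μ := by
          refine lintegral_mono fun s => ?_
          rw [← ENNReal.ofReal_mul (Real.exp_pos _).le, ← Real.exp_add]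
          refine ENNReal.ofReal_le_ofReal (Real.exp_le_exp.2 ?_)
          have := d.norm_le_conj (∑ j ∈ Finset.range L, l • ξ (w (k + j) s))
          rwa [← Finset.smul_sum, norm_smul, Real.norm_of_nonneg hl, Finset.smul_sum] at this
      _ ≤ ENNReal.ofReal (Real.exp d.Theta) *
          ENNReal.ofReal (Real.exp (5 * l ^ 2 * σ ^ 2)) ^ L := by
          rw [lintegral_const_mul' _ _ ENNReal.ofReal_ne_top]
          gcongr
          exact lintegral_exp_conj_sum_le d hw hi hm hξm hσ h0 hint hle h k L
      _ = _ := by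
          rw [← ENNReal.ofReal_pow (Real.exp_pos _).le, ← ENNReal.ofReal_mul (Real.exp_pos _).le,
            ← Real.exp_nat_mul, ← Real.exp_add]
          congr 2; ring
  · calc _ ≤ ∫⁻ s, ∏ j ∈ Finset.range L, ENNReal.ofReal (Real.exp (l * ‖ξ (w (k + j) s)‖)) ∂μ := by
          refine lintegral_mono fun s => ?_
          rw [← ENNReal.ofReal_prod_of_nonneg fun _ _ => (Real.exp_pos _).le, ← Real.exp_sum,
            ← Finset.mul_sum]
          refine ENNReal.ofReal_le_ofReal (Real.exp_le_exp.2 ?_)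
          gcongr
          exact norm_sum_le _ _
      _ ≤ ENNReal.ofReal (Real.exp (l ^ 2 * σ ^ 2 / 4 + 1)) ^ L :=
          lintegral_prod_le hw hi (f := fun ω => ENNReal.ofReal (Real.exp (l * ‖ξ ω‖)))
            (by fun_prop) (lintegral_exp_mul_norm_le hσ hsub l) k L
      _ ≤ _ := by
          rw [← ENNReal.ofReal_pow (Real.exp_pos _).le, ← Real.exp_nat_mul]
          refine ENNReal.ofReal_le_ofReal (Real.exp_le_exp.2 ?_)
          have := d.Theta_nonneg
          have hL : (0 : ℝ) ≤ L := Nat.cast_nonneg L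
          nlinarith

end Batch

/-! ### Pathwise and mean properties of the oracle. -/

section OracleFacts

variable {E Ω : Type*} [NormedAddCommGroup E] [NormedSpace ℝ E] [MeasurableSpace Ω]
  {o : Oracle E Ω} {P : Measure Ω} {ν σ : ℝ} {xs : E}

/-- The exceptional null set is the one where `Lip ω` exceeds `ν`, hence common to all pairs of
points; random iterates may be inserted. -/
lemma Oracle.Regular.ae_lipschitz (hr : o.Regular P ν) :
    ∀ᵐ ω ∂P, ∀ x ∈ o.X, ∀ x' ∈ o.X, ‖o.dG x ω - o.dG x' ω‖ ≤ ν * ‖x - x'‖ := by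
  obtain ⟨Lip, h1, h2⟩ := hr.lipschitz
  filter_upwards [h2] with ω hω x hx x' hx'
  exact (h1 ω x hx x' hx').trans (mul_le_mul_of_nonneg_right hω (norm_nonneg _))

lemma Oracle.Regular.gradient_le (hr : o.Regular P ν) (ω : Ω) {x y : E} (hx : x ∈ o.X)
    (hy : y ∈ o.X) : o.G x ω + o.dG x ω (y - x) ≤ o.G y ω :=
  convexOn_gradient_le (hr.convexOn ω) hx hy (hr.hasFDerivWithinAt ω x hx)

lemma Oracle.Regular.monotone (hr : o.Regular P ν) (ω : Ω) {x y : E} (hx : x ∈ o.X)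
    (hy : y ∈ o.X) : 0 ≤ (o.dG x ω - o.dG y ω) (x - y) := by
  have h1 := hr.gradient_le ω hx hy
  have h2 := hr.gradient_le ω hy hx
  simp only [sub_apply, map_sub] at h1 h2 ⊢
  linarith

lemma Oracle.IsSolution.integrable_exp (hr : o.Regular P ν) (hs : o.IsSolution P σ xs) :
    Integrable (fun ω => Real.exp (‖o.dG xs ω‖ ^ 2 / σ ^ 2)) P := by
  have hm : AEStronglyMeasurable (fun ω => Real.exp (‖o.dG xs ω‖ ^ 2 / σ ^ 2)) P :=
    (by fun_prop : Continuous fun ζ : StrongDual ℝ E =>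
      Real.exp (‖ζ‖ ^ 2 / σ ^ 2)).comp_aestronglyMeasurable
        (hr.integrable_dG xs hs.mem).aestronglyMeasurable
  refine ⟨hm, ?_⟩
  rw [hasFiniteIntegral_iff_ofReal (Filter.Eventually.of_forall fun ω => (Real.exp_pos _).le)]
  exact hs.subGaussian.trans_lt ENNReal.ofReal_lt_top

lemma Oracle.IsSolution.integral_exp_le (hr : o.Regular P ν) (hs : o.IsSolution P σ xs) :
    ∫ ω, Real.exp (‖o.dG xs ω‖ ^ 2 / σ ^ 2) ∂P ≤ Real.exp 1 := by
  have h := hs.subGaussian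
  rw [← ofReal_integral_eq_lintegral_ofReal (hs.integrable_exp hr)
    (Filter.Eventually.of_forall fun ω => (Real.exp_pos _).le)] at h
  exact (ENNReal.ofReal_le_ofReal_iff (Real.exp_pos _).le).1 h

/-- The gradient of `g`. -/
noncomputable def Oracle.meanGrad (o : Oracle E Ω) (P : Measure Ω) (x : E) : StrongDual ℝ E :=
  ∫ ω, o.dG x ω ∂P

lemma Oracle.Regular.sub_le_meanGrad (hr : o.Regular P ν) {x y : E} (hx : x ∈ o.X)
    (hy : y ∈ o.X) : o.g P x - o.g P y ≤ o.meanGrad P x (x - y) := by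
  rw [Oracle.meanGrad, ContinuousLinearMap.integral_apply (hr.integrable_dG x hx), Oracle.g,
    Oracle.g, ← integral_sub (hr.integrable_G x hx) (hr.integrable_G y hy)]
  refine integral_mono ((hr.integrable_G x hx).sub (hr.integrable_G y hy))
    ((hr.integrable_dG x hx).apply_continuousLinearMap _) fun ω => ?_
  have := hr.gradient_le ω hx hy
  simp only [map_sub] at this ⊢
  linarith

lemma Oracle.Regular.convexOn_g (hr : o.Regular P ν) : ConvexOn ℝ o.X (o.g P) := by
  refine ⟨hr.convex, fun x hx y hy a b ha hb hab => ?_⟩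
  simp only [Oracle.g, smul_eq_mul]
  rw [← integral_const_mul, ← integral_const_mul, ← integral_add
    ((hr.integrable_G x hx).const_mul a) ((hr.integrable_G y hy).const_mul b)]
  exact integral_mono (hr.integrable_G _ (hr.convex hx hy ha hb hab))
    (((hr.integrable_G x hx).const_mul a).add ((hr.integrable_G y hy).const_mul b))
    fun ω => (hr.convexOn ω).2 hx hy ha hb hab

/-- Reduced strong convexity, for deterministic points. -/
lemma Oracle.RSC.norm_sub_le [MeasurableSpace E] {δ ρ : ℝ} {s : ℕ} (h : o.RSC P xs δ ρ s)
    {κ υ : ℝ} (hκ : 0 < κ) (hυ : 0 ≤ υ) {x : E} (hx : x ∈ o.X)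
    (hF : o.F P κ x - o.F P κ xs ≤ υ) : ‖x - xs‖ ≤ δ * (ρ * s * κ + υ / κ) := by
  -- A point mass with `ε = 0` forces the distance bound to hold surely, so the assumption can be
  -- used realization by realization.
  have h1 := h κ υ 0 hκ hυ le_rfl Unit (Measure.dirac ()) (fun _ => x) measurable_const
    (fun _ => hx) (by simp [hF])
  by_contra hc
  simp [hc] at h1
  linarith

end OracleFacts

/-! ### Batch gradients: cocoercivity and joint measurability. -/

section BatchGradient

variable {E Ω : Type*} [NormedAddCommGroup E] [NormedSpace ℝ E]
  {o : Oracle E Ω}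

lemma Oracle.batchGrad_apply (o : Oracle E Ω) (L : ℕ) (x : E) (v : ℕ → Ω) (u : E) :
    o.batchGrad L x v u = (L : ℝ)⁻¹ * ∑ l ∈ Finset.range L, o.dG x (v l) u := by
  simp [Oracle.batchGrad, sum_apply]

lemma Oracle.batchGrad_sub_apply (o : Oracle E Ω) (L : ℕ) (x y : E) (v : ℕ → Ω) (u : E) :
    (o.batchGrad L x v - o.batchGrad L y v) u =
      (L : ℝ)⁻¹ * ∑ l ∈ Finset.range L, (o.dG x (v l) - o.dG y (v l)) u := by
  simp only [sub_apply, o.batchGrad_apply, Finset.sum_sub_distrib]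
  ring

variable [MeasurableSpace Ω] {P : Measure Ω} {ν : ℝ}

/-- The inequality of `cocoercive` is linear in the gradients, so it passes to averages. -/
lemma Oracle.Regular.batchGrad_cocoercive (hr : o.Regular P ν) {L : ℕ} (hL : 1 ≤ L)
    {v : ℕ → Ω}
    (hv : ∀ l, ∀ x ∈ o.X, ∀ x' ∈ o.X, ‖o.dG x (v l) - o.dG x' (v l)‖ ≤ ν * ‖x - x'‖)
    {x y z : E} (hz : z ∈ o.X) (hx : x ∈ o.X) (hy : y ∈ o.X) :
    3 * (o.batchGrad L x v - o.batchGrad L z v) (x - y) ≤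
      (o.batchGrad L x v - o.batchGrad L z v) (x - z) + 9 / 2 * ν * ‖x - y‖ ^ 2 := by
  have hL' : (0 : ℝ) < L := by exact_mod_cast hL
  rw [o.batchGrad_sub_apply, o.batchGrad_sub_apply]
  have h : ∑ l ∈ Finset.range L, 3 * (o.dG x (v l) - o.dG z (v l)) (x - y) ≤
      ∑ l ∈ Finset.range L,
        ((o.dG x (v l) - o.dG z (v l)) (x - z) + 9 / 2 * ν * ‖x - y‖ ^ 2) :=
    Finset.sum_le_sum fun l _ => cocoercive (hr.convexOn (v l)) (hr.hasFDerivWithinAt (v l))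
      (hv l) hz hx hy
  rw [← Finset.mul_sum, Finset.sum_add_distrib, Finset.sum_const, Finset.card_range,
    nsmul_eq_mul] at h
  have h2 := mul_le_mul_of_nonneg_left h (inv_pos.2 hL').le
  rw [mul_add, ← mul_assoc (L : ℝ)⁻¹ (L : ℝ), inv_mul_cancel₀ hL'.ne'] at h2
  linarith

variable [FiniteDimensional ℝ E] [MeasurableSpace E] [BorelSpace E]

/-- A Carathéodory argument: the gradient is continuous in the point for every sample, by the
Lipschitz bound, and measurable in the sample for every point. -/
lemma Oracle.Regular.measurable_dG_comp {S : Type*} {_ : MeasurableSpace S} (hr : o.Regular P ν)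
    {x : S → E} {v : S → Ω} (hx : Measurable x) (hv : Measurable v) (hxX : ∀ s, x s ∈ o.X) :
    Measurable fun s => o.dG (x s) (v s) := by
  have := FiniteDimensional.proper_real E
  obtain ⟨Lip, h1, -⟩ := hr.lipschitz
  have hu : Measurable (Function.uncurry fun (x : o.X) (ω : Ω) => o.dG x ω) := by
    refine measurable_uncurry_of_continuous_of_measurable (fun ω => ?_)
      fun x => hr.measurable_dG x x.2
    refine (LipschitzWith.of_dist_le_mul (K := (Lip ω).toNNReal) fun x y => ?_).continuous
    rw [dist_eq_norm, Subtype.dist_eq, dist_eq_norm]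
    exact (h1 ω x x.2 y y.2).trans
      (mul_le_mul_of_nonneg_right (Real.le_coe_toNNReal _) (norm_nonneg _))
  exact hu.comp ((hx.subtype_mk (h := hxX)).prodMk hv)

lemma Oracle.Regular.measurable_batchGrad {S : Type*} {_ : MeasurableSpace S}
    (hr : o.Regular P ν) {L : ℕ} {x : S → E} {v : S → ℕ → Ω} (hx : Measurable x)
    (hv : ∀ l < L, Measurable fun s => v s l) (hxX : ∀ s, x s ∈ o.X) :
    Measurable fun s => o.batchGrad L (x s) (v s) := by
  have h : Measurable fun s => ∑ l ∈ Finset.range L, o.dG (x s) (v s l) :=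
    Finset.measurable_fun_sum _ fun l hl =>
      hr.measurable_dG_comp hx (hv l (Finset.mem_range.1 hl)) hxX
  exact Measurable.const_smul h ((L : ℝ)⁻¹)

lemma Oracle.Regular.measurable_meanGrad [SFinite P] (hr : o.Regular P ν) :
    Measurable fun x : o.X => o.meanGrad P x := by
  have h : Measurable (Function.uncurry fun (x : o.X) (ω : Ω) => o.dG x ω) :=
    hr.measurable_dG_comp (measurable_subtype_coe.comp measurable_fst) measurable_snd
      fun p => p.1.2
  exact (h.stronglyMeasurable.integral_prod_right).measurable

end BatchGradient

/-! ### Exponential moment bounds for the three stochastic terms of one iteration. -/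

section Concentration

variable {E Ω S : Type*} [NormedAddCommGroup E] [NormedSpace ℝ E] [MeasurableSpace Ω]
  [MeasurableSpace S] {o : Oracle E Ω} {P : Measure Ω} {ν σ : ℝ} {xs : E} {μ : Measure S}
  {w : ℕ → S → Ω}

lemma lintegral_exp_sub_le_one {f : S → ℝ} {q : ℝ}
    (h : ∫⁻ s, ENNReal.ofReal (Real.exp (f s)) ∂μ ≤ ENNReal.ofReal (Real.exp q)) :
    ∫⁻ s, ENNReal.ofReal (Real.exp (f s - q)) ∂μ ≤ 1 := by
  calc _ = ∫⁻ s, ENNReal.ofReal (Real.exp (-q)) * ENNReal.ofReal (Real.exp (f s)) ∂μ := by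
        refine lintegral_congr fun s => ?_
        rw [← ENNReal.ofReal_mul (Real.exp_pos _).le, ← Real.exp_add, neg_add_eq_sub]
    _ ≤ ENNReal.ofReal (Real.exp (-q)) * ENNReal.ofReal (Real.exp q) := by
        rw [lintegral_const_mul' _ _ ENNReal.ofReal_ne_top]
        gcongr
    _ = 1 := by
        rw [← ENNReal.ofReal_mul (Real.exp_pos _).le, ← Real.exp_add]
        simp

/-- `batchGrad L xs` is light-tailed: the expectation of `exp (‖·‖² / τ)` is at most `exp q`. -/
def LightTailed (o : Oracle E Ω) (xs : E) (μ : Measure S) (w : ℕ → S → Ω) (L : ℕ) (τ q : ℝ) :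
    Prop :=
  ∀ k, ∫⁻ s, ENNReal.ofReal (Real.exp (‖o.batchGrad L xs (fun i => w (k + i) s)‖ ^ 2 / τ - q)) ∂μ
    ≤ 1

lemma lightTailed_one (hr : o.Regular P ν) (hs : o.IsSolution P σ xs)
    (hw : ∀ i, MeasurePreserving (w i) μ P) : LightTailed o xs μ w 1 (σ ^ 2) 1 := by
  intro k
  refine lintegral_exp_sub_le_one ?_
  have hm : Measurable fun ω => ENNReal.ofReal (Real.exp (‖o.dG xs ω‖ ^ 2 / σ ^ 2)) := by
    have := (hr.measurable_dG xs hs.mem).norm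
    fun_prop
  have h := hs.subGaussian
  rw [← (hw k).map_eq, lintegral_map hm (hw k).measurable] at h
  simpa [Oracle.batchGrad] using h

variable [IsProbabilityMeasure P] [IsProbabilityMeasure μ]

/-- The averaged noise is sub-Gaussian in every direction. -/
lemma lintegral_exp_noise_le (hr : o.Regular P ν) (hs : o.IsSolution P σ xs) (hσ : 0 < σ)
    (hw : ∀ i, MeasurePreserving (w i) μ P) (hi : iIndepFun w μ) {L : ℕ} (hL : 1 ≤ L)
    (v : E) (k : ℕ) :
    ∫⁻ s, ENNReal.ofReal (Real.exp (o.batchGrad L xs (fun i => w (k + i) s) v -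
      5 / 4 * ‖v‖ ^ 2 * σ ^ 2 / L)) ∂μ ≤ 1 := by
  have hL' : (0 : ℝ) < L := by exact_mod_cast hL
  have h1 := lintegral_exp_apply_le (hr.integrable_dG xs hs.mem) hσ hs.grad_eq_zero
    (hs.integrable_exp hr) (hs.integral_exp_le hr) ((L : ℝ)⁻¹ • v)
  have hm : Measurable fun ω => o.dG xs ω ((L : ℝ)⁻¹ • v) :=
    (ContinuousLinearMap.apply ℝ ℝ _).continuous.measurable.comp (hr.measurable_dG xs hs.mem)
  have h2 := lintegral_prod_le hw hi
    (f := fun ω => ENNReal.ofReal (Real.exp (o.dG xs ω ((L : ℝ)⁻¹ • v))))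
    (by fun_prop) h1 k L
  calc _ = ∫⁻ s, ENNReal.ofReal (Real.exp (-(5 / 4 * ‖v‖ ^ 2 * σ ^ 2 / L))) *
        ∏ j ∈ Finset.range L,
          ENNReal.ofReal (Real.exp (o.dG xs (w (k + j) s) ((L : ℝ)⁻¹ • v))) ∂μ := by
        refine lintegral_congr fun s => ?_
        rw [← ENNReal.ofReal_prod_of_nonneg fun _ _ => (Real.exp_pos _).le, ← Real.exp_sum,
          ← ENNReal.ofReal_mul (Real.exp_pos _).le, ← Real.exp_add, o.batchGrad_apply]
        simp only [map_smul, smul_eq_mul, ← Finset.mul_sum]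
        congr 2
        ring
    _ ≤ ENNReal.ofReal (Real.exp (-(5 / 4 * ‖v‖ ^ 2 * σ ^ 2 / L))) *
        ENNReal.ofReal (Real.exp (5 / 4 * ‖(L : ℝ)⁻¹ • v‖ ^ 2 * σ ^ 2)) ^ L := by
        rw [lintegral_const_mul' _ _ ENNReal.ofReal_ne_top]
        gcongr
    _ = 1 := by
        rw [← ENNReal.ofReal_pow (Real.exp_pos _).le, ← ENNReal.ofReal_mul (Real.exp_pos _).le,
          ← Real.exp_nat_mul, ← Real.exp_add, norm_smul, norm_inv, Real.norm_of_nonneg hL'.le]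
        have : -(5 / 4 * ‖v‖ ^ 2 * σ ^ 2 / L) +
            L * (5 / 4 * ((L : ℝ)⁻¹ * ‖v‖) ^ 2 * σ ^ 2) = 0 := by
          field_simp; ring
        rw [this]; simp

variable [FiniteDimensional ℝ E]

/-- The lower tail of the progress of the averaged gradient. -/
lemma lintegral_exp_progress_le (hr : o.Regular P ν) (hs : o.IsSolution P σ xs)
    (hw : ∀ i, MeasurePreserving (w i) μ P) (hi : iIndepFun w μ) {L : ℕ} (hL : 1 ≤ L)
    {x : E} (hx : x ∈ o.X) {l : ℝ} (hl : 0 ≤ l) (hlν : l * (ν * ‖x - xs‖ ^ 2) ≤ 1 / 2) (k : ℕ) :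
    ∫⁻ s, ENNReal.ofReal (Real.exp (3 / 4 * l * o.meanGrad P x (x - xs) -
      l * (o.batchGrad L x (fun i => w (k + i) s) - o.batchGrad L xs (fun i => w (k + i) s))
        (x - xs))) ∂μ ≤ 1 := by
  have hL' : (0 : ℝ) < L := by exact_mod_cast hL
  -- Monotonicity of the gradient gives `0 ≤ Y` and the Lipschitz bound gives `Y ≤ 1 / 2` almost
  -- surely; the mean is the progress of `g`, because its gradient vanishes at `xs`.
  set Y : Ω → ℝ := fun ω => l / L * (o.dG x ω - o.dG xs ω) (x - xs)
  have hdm : Measurable fun ω => o.dG x ω - o.dG xs ω :=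
    (hr.measurable_dG x hx).sub (hr.measurable_dG xs hs.mem)
  have hYm : Measurable Y :=
    ((ContinuousLinearMap.apply ℝ ℝ (x - xs)).continuous.measurable.comp hdm).const_mul _
  have hdi : Integrable (fun ω => o.dG x ω - o.dG xs ω) P :=
    (hr.integrable_dG x hx).sub (hr.integrable_dG xs hs.mem)
  have hYi : Integrable Y P := (hdi.apply_continuousLinearMap (x - xs)).const_mul _
  have hY0 : ∀ᵐ ω ∂P, 0 ≤ Y ω := Filter.Eventually.of_forall fun ω =>
    mul_nonneg (by positivity) (hr.monotone ω hx hs.mem)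
  have hY1 : ∀ᵐ ω ∂P, Y ω ≤ 1 / 2 := by
    filter_upwards [hr.ae_lipschitz] with ω hω
    have h1 : (o.dG x ω - o.dG xs ω) (x - xs) ≤ ν * ‖x - xs‖ ^ 2 := by
      refine (le_abs_self _).trans (((o.dG x ω - o.dG xs ω).le_opNorm _).trans ?_)
      have := mul_le_mul_of_nonneg_right (hω x hx xs hs.mem) (norm_nonneg (x - xs))
      linarith
    have h2 : l / L ≤ l := div_le_self hl (by exact_mod_cast hL)
    calc Y ω ≤ l * (o.dG x ω - o.dG xs ω) (x - xs) :=
          mul_le_mul_of_nonneg_right h2 (hr.monotone ω hx hs.mem)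
      _ ≤ l * (ν * ‖x - xs‖ ^ 2) := by gcongr
      _ ≤ _ := hlν
  have hint : ∫ ω, Y ω ∂P = l / L * o.meanGrad P x (x - xs) := by
    simp only [Y]
    rw [integral_const_mul, ← ContinuousLinearMap.integral_apply hdi,
      integral_sub (hr.integrable_dG x hx) (hr.integrable_dG xs hs.mem), hs.grad_eq_zero, sub_zero]
    rfl
  have h1 := lintegral_exp_neg_le hYi hY0 hY1
  have h2 := lintegral_prod_le hw hi (f := fun ω => ENNReal.ofReal (Real.exp (-Y ω)))
    (by fun_prop) h1 k L
  rw [hint] at h2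
  calc _ = ∫⁻ s, ENNReal.ofReal (Real.exp (3 / 4 * l * o.meanGrad P x (x - xs))) *
        ∏ j ∈ Finset.range L, ENNReal.ofReal (Real.exp (-Y (w (k + j) s))) ∂μ := by
        refine lintegral_congr fun s => ?_
        rw [← ENNReal.ofReal_prod_of_nonneg fun _ _ => (Real.exp_pos _).le, ← Real.exp_sum,
          ← ENNReal.ofReal_mul (Real.exp_pos _).le, ← Real.exp_add, o.batchGrad_sub_apply,
          Finset.sum_neg_distrib, ← Finset.mul_sum]
        congr 2
        ring
    _ ≤ ENNReal.ofReal (Real.exp (3 / 4 * l * o.meanGrad P x (x - xs))) *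
        ENNReal.ofReal (Real.exp (-(3 / 4 * (l / L * o.meanGrad P x (x - xs))))) ^ L := by
        rw [lintegral_const_mul' _ _ ENNReal.ofReal_ne_top]
        gcongr
    _ = 1 := by
        rw [← ENNReal.ofReal_pow (Real.exp_pos _).le, ← ENNReal.ofReal_mul (Real.exp_pos _).le,
          ← Real.exp_nat_mul, ← Real.exp_add]
        have : 3 / 4 * l * o.meanGrad P x (x - xs) +
            L * -(3 / 4 * (l / L * o.meanGrad P x (x - xs))) = 0 := by
          field_simp; ring
        rw [this]; simp

/-- The sum of `L` gradients satisfies the hypothesis of `lintegral_exp_sq_le_of_mgf` with `D = 5 L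
σ²`; dividing `8 D` by `L²` gives `40 σ² / L`. -/
lemma lightTailed_batch (d : DGF E) (hr : o.Regular P ν) (hs : o.IsSolution P σ xs) (hσ : 0 < σ)
    (hw : ∀ i, MeasurePreserving (w i) μ P) (hi : iIndepFun w μ) {L : ℕ} (hL : 1 ≤ L) :
    LightTailed o xs μ w L (40 * σ ^ 2 / L) (d.Theta + 2) := by
  have hL' : (0 : ℝ) < L := by exact_mod_cast hL
  intro k
  refine lintegral_exp_sub_le_one ?_
  have hm : Measurable fun s => ∑ j ∈ Finset.range L, o.dG xs (w (k + j) s) :=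
    Finset.measurable_fun_sum _ fun j _ => (hr.measurable_dG xs hs.mem).comp (hw _).measurable
  have h := lintegral_exp_sq_le_of_mgf (μ := μ)
    (Z := fun s => ‖∑ j ∈ Finset.range L, o.dG xs (w (k + j) s)‖) hm.norm
    (fun s => norm_nonneg _) (a := d.Theta) (D := 5 * L * σ ^ 2) (by positivity) fun l hl =>
      lintegral_exp_norm_sum_le d hw hi (hr.integrable_dG xs hs.mem) (hr.measurable_dG xs hs.mem)
        hσ hs.grad_eq_zero hs.subGaussian (hs.integrable_exp hr) (hs.integral_exp_le hr) hl k L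
  refine le_trans (le_of_eq (lintegral_congr fun s => ?_)) h
  rw [Oracle.batchGrad, norm_smul, norm_inv, Real.norm_of_nonneg hL'.le]
  congr 2
  field_simp
  ring

end Concentration

/-! ### Deterministic analysis of one run. -/

section Run

variable {E Ω : Type*} [NormedAddCommGroup E] [NormedSpace ℝ E] [FiniteDimensional ℝ E]
  {o : Oracle E Ω} {d : DGF E} {a : Run}

/-- The average stochastic gradient at `x` over the samples of iteration `i`. -/
noncomputable def iterGrad (o : Oracle E Ω) (a : Run) (w : ℕ → Ω) (i : ℕ) (x : E) :
    StrongDual ℝ E :=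
  o.batchGrad a.L x fun l => w (i * a.L + l)

lemma csmdIter_mem (hX : IsClosed o.X) (hR : 0 < a.R) {x₀ : E} (hx₀ : x₀ ∈ o.X) (w : ℕ → Ω)
    (i : ℕ) : csmdIter o d a x₀ w i ∈ o.localSet x₀ a.R := by
  cases i with
  | zero => exact ⟨hx₀, by simp [csmdIter, hR.le]⟩
  | succ i => exact (prox_mem hX d hR hx₀ (by fun_prop) _ _).1

lemma csmd_mem (hX : IsClosed o.X) (hXc : Convex ℝ o.X) (hR : 0 < a.R) (hm : 1 ≤ a.m) {x₀ : E}
    (hx₀ : x₀ ∈ o.X) (w : ℕ → Ω) : csmd o d a x₀ w ∈ o.X := by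
  have hm' : (a.m : ℝ) ≠ 0 := by exact_mod_cast (by omega : a.m ≠ 0)
  rw [csmd, Finset.smul_sum]
  exact hXc.sum_mem (fun _ _ => by positivity) (by simp [hm'])
    fun i _ => (csmdIter_mem hX hR hx₀ w i).1

variable [MeasurableSpace Ω] {P : Measure Ω} {ν σ : ℝ} {xs : E}

/-- The optimality gap of the output of one run, on the event that the stochastic terms are under
control. -/
lemma csmd_gap_le (hr : o.Regular P ν) (hs : o.IsSolution P σ xs) (hR : 0 < a.R)
    (hγ : 0 < a.γ) (hκ : 0 ≤ a.κ) (hm : 1 ≤ a.m) (hL : 1 ≤ a.L) (hγν : a.γ * ν ≤ 1 / 4)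
    {x₀ : E} (hx₀ : x₀ ∈ o.X) (hx₀s : ‖x₀ - xs‖ ≤ a.R) {w : ℕ → Ω}
    (hw : ∀ l, ∀ x ∈ o.X, ∀ x' ∈ o.X, ‖o.dG x (w l) - o.dG x' (w l)‖ ≤ ν * ‖x - x'‖)
    {B₁ B₂ B₃ : ℝ}
    (h1 : 3 / 4 * ∑ i ∈ Finset.range a.m,
        o.meanGrad P (csmdIter o d a x₀ w i) (csmdIter o d a x₀ w i - xs) ≤
      ∑ i ∈ Finset.range a.m, (iterGrad o a w i (csmdIter o d a x₀ w i) - iterGrad o a w i xs)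
        (csmdIter o d a x₀ w i - xs) + B₁)
    (h2 : -∑ i ∈ Finset.range a.m, iterGrad o a w i xs (csmdIter o d a x₀ w i - xs) ≤ B₂)
    (h3 : ∑ i ∈ Finset.range a.m, ‖iterGrad o a w i xs‖ ^ 2 ≤ B₃) :
    a.m * (o.F P a.κ (csmd o d a x₀ w) - o.F P a.κ xs) ≤
      a.R ^ 2 * d.Theta / a.γ + a.κ * a.R + 2 * a.γ * B₃ + B₂ + 2 / 3 * B₁ := by
  have hm' : (0 : ℝ) < a.m := by exact_mod_cast hm
  set X := csmdIter o d a x₀ w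
  have hmem : ∀ i, X i ∈ o.localSet x₀ a.R := csmdIter_mem hr.isClosed hR hx₀ w
  have hxs : xs ∈ o.localSet x₀ a.R := ⟨hs.mem, by rwa [norm_sub_rev]⟩
  have hball : ∀ z ∈ o.localSet x₀ a.R, z ∈ Metric.closedBall x₀ a.R := fun z hz =>
    (localSet_eq o x₀ a.R ▸ hz : z ∈ o.X ∩ Metric.closedBall x₀ a.R).2
  set V : ℕ → ℝ := fun i => d.bregman x₀ a.R (X i) xs
  have hstep : ∀ i, 2 / 3 * a.γ * (iterGrad o a w i (X i) - iterGrad o a w i xs) (X i - xs) +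
      a.γ * iterGrad o a w i xs (X i - xs) + a.γ * a.κ * (‖X (i + 1)‖ - ‖xs‖) ≤
      V i - V (i + 1) + 2 * a.γ ^ 2 * ‖iterGrad o a w i xs‖ ^ 2 := by
    intro i
    have h := prox_step hr.isClosed hr.convex d hR hx₀ (hmem i) hxs hγ hκ hγν
      (iterGrad o a w i (X i) - iterGrad o a w i xs) (iterGrad o a w i xs) fun y hy =>
        hr.batchGrad_cocoercive hL (fun l => hw (i * a.L + l)) hs.mem (hmem i).1 hy
    rw [sub_add_cancel] at h
    exact h
  have hsum := Finset.sum_le_sum fun i (_ : i ∈ Finset.range a.m) => hstep i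
  rw [Finset.sum_add_distrib, Finset.sum_add_distrib, Finset.sum_add_distrib, ← Finset.mul_sum,
    ← Finset.mul_sum, ← Finset.mul_sum, ← Finset.mul_sum, Finset.sum_range_sub'] at hsum
  have hV0 : V 0 ≤ a.R ^ 2 * d.Theta := by
    simp only [V, X, csmdIter]
    rw [d.bregman_center]
    exact d.loc_le hR (by rwa [norm_sub_rev])
  have hVm : 0 ≤ V a.m :=
    le_trans (by positivity) (d.half_sq_le_bregman hR (hball _ (hmem a.m)) (hball _ hxs))
  -- The proximal step controls the norm of the new iterate, while the output averages `X 0` to `X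
  -- (m - 1)`. The shift of index costs `‖X 0‖ - ‖X m‖ ≤ R` once, not at each step.
  have htel : ∑ i ∈ Finset.range a.m, (‖X i‖ - ‖xs‖) ≤
      ∑ i ∈ Finset.range a.m, (‖X (i + 1)‖ - ‖xs‖) + a.R := by
    have e : ∑ i ∈ Finset.range a.m, (‖X i‖ - ‖xs‖) =
        ∑ i ∈ Finset.range a.m, (‖X (i + 1)‖ - ‖xs‖) + (‖X 0‖ - ‖X a.m‖) := by
      rw [← Finset.sum_range_sub' (fun i => ‖X i‖), ← Finset.sum_add_distrib]
      exact Finset.sum_congr rfl fun i _ => by ring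
    have h0 : ‖X 0‖ - ‖X a.m‖ ≤ a.R := by
      have := (norm_sub_norm_le (X 0) (X a.m)).trans (norm_sub_rev _ _).le
      exact this.trans (hmem a.m).2
    linarith
  have havg : a.m * (o.F P a.κ (csmd o d a x₀ w) - o.F P a.κ xs) ≤
      1 / 2 * ∑ i ∈ Finset.range a.m, o.meanGrad P (X i) (X i - xs) +
        a.κ * ∑ i ∈ Finset.range a.m, (‖X i‖ - ‖xs‖) := by
    have hg : o.g P (csmd o d a x₀ w) ≤ (a.m : ℝ)⁻¹ * ∑ i ∈ Finset.range a.m, o.g P (X i) := by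
      rw [csmd, Finset.smul_sum, Finset.mul_sum]
      exact hr.convexOn_g.map_sum_le (fun _ _ => by positivity) (by simp [hm'.ne'])
        fun i _ => (hmem i).1
    have hn : ‖csmd o d a x₀ w‖ ≤ (a.m : ℝ)⁻¹ * ∑ i ∈ Finset.range a.m, ‖X i‖ := by
      rw [csmd, norm_smul, norm_inv, Real.norm_of_nonneg hm'.le]
      gcongr
      exact norm_sum_le _ _
    have hgs : ∑ i ∈ Finset.range a.m, (o.g P (X i) - o.g P xs) ≤
        ∑ i ∈ Finset.range a.m, o.meanGrad P (X i) (X i - xs) :=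
      Finset.sum_le_sum fun i _ => hr.sub_le_meanGrad (hmem i).1 hs.mem
    have hg' := mul_le_mul_of_nonneg_left hg hm'.le
    have hn' := mul_le_mul_of_nonneg_left (mul_le_mul_of_nonneg_left hn hm'.le) hκ
    rw [mul_inv_cancel_left₀ hm'.ne'] at hg' hn'
    rw [Finset.sum_sub_distrib, Finset.sum_const, Finset.card_range, nsmul_eq_mul] at hgs ⊢
    simp only [Oracle.F]
    linarith
  -- The weight `2 / 3` of `hstep` times the `3 / 4` of `h1` is the `1 / 2` in front of `g`.
  have hγm : a.γ * (a.m * (o.F P a.κ (csmd o d a x₀ w) - o.F P a.κ xs)) ≤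
      a.R ^ 2 * d.Theta + a.γ * (a.κ * a.R + 2 * a.γ * B₃ + B₂ + 2 / 3 * B₁) := by
    have e1 := mul_le_mul_of_nonneg_left havg hγ.le
    have e2 := mul_le_mul_of_nonneg_left htel (mul_nonneg hγ.le hκ)
    have e3 := mul_le_mul_of_nonneg_left h1 hγ.le
    have e4 := mul_le_mul_of_nonneg_left h2 hγ.le
    have e5 := mul_le_mul_of_nonneg_left h3 (sq_nonneg a.γ)
    linarith
  have e : a.R ^ 2 * d.Theta / a.γ + a.κ * a.R + 2 * a.γ * B₃ + B₂ + 2 / 3 * B₁ =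
      (a.R ^ 2 * d.Theta + a.γ * (a.κ * a.R + 2 * a.γ * B₃ + B₂ + 2 / 3 * B₁)) / a.γ := by
    field_simp
    ring
  rw [e, le_div_iff₀ hγ]
  linarith

end Run

/-! ### Adaptedness of the iterates and the exponential supermartingale. -/

section Supermartingale

variable {E Ω S : Type*} [NormedAddCommGroup E] [NormedSpace ℝ E] [FiniteDimensional ℝ E]
  [MeasurableSpace E] [BorelSpace E] [MeasurableSpace Ω]
  {o : Oracle E Ω} {d : DGF E} {a : Run} {P : Measure Ω} {ν σ : ℝ} {xs : E} {w : ℕ → S → Ω}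
  {n₀ : ℕ} {z : S → E}

lemma measurable_iterGrad (hr : o.Regular P ν) {m : MeasurableSpace S} {i : ℕ} {x : S → E}
    (hx : Measurable x) (hxX : ∀ s, x s ∈ o.X)
    (hw : ∀ j < (i + 1) * a.L, Measurable (w (n₀ + j))) :
    Measurable fun s => iterGrad o a (fun j => w (n₀ + j) s) i (x s) :=
  hr.measurable_batchGrad hx (fun l hl => hw _ (by rw [add_mul, one_mul]; omega)) hxX

/-- The filtration index counts consumed samples: before iteration `i + 1` only `n₀ + i L` of them
have been seen, so the next batch is independent of the current iterate. -/
lemma measurable_csmdIter (hr : o.Regular P ν) (hR : 0 < a.R) (hγ : 0 ≤ a.γ) (hκ : 0 ≤ a.κ)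
    (hz : Measurable[past w n₀] z) (hzX : ∀ s, z s ∈ o.X) (i : ℕ) :
    Measurable[past w (n₀ + i * a.L)]
      fun s => csmdIter o d a (z s) (fun j => w (n₀ + j) s) i := by
  induction i with
  | zero => exact hz.mono (past_mono w (Nat.le_add_right n₀ _)) le_rfl
  | succ i ih =>
    have hle : n₀ + i * a.L ≤ n₀ + (i + 1) * a.L := by gcongr; omega
    have hx := ih.mono (past_mono w hle) le_rfl
    have hz' := hz.mono (past_mono w (Nat.le_add_right n₀ ((i + 1) * a.L))) le_rfl
    have hmem : ∀ s, csmdIter o d a (z s) (fun j => w (n₀ + j) s) i ∈ o.localSet (z s) a.R :=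
      fun s => csmdIter_mem hr.isClosed hR (hzX s) _ i
    have hH := measurable_iterGrad (n₀ := n₀) (a := a) (i := i) hr hx (fun s => (hmem s).1)
      fun j hj => measurable_past w (Nat.add_lt_add_left hj n₀)
    have hh : Continuous fun z : E => a.γ * (a.κ * ‖z‖) := by fun_prop
    have hhc : ConvexOn ℝ Set.univ fun z : E => a.γ * (a.κ * ‖z‖) := by
      have := (convexOn_univ_norm (E := E)).smul (mul_nonneg hγ hκ)
      simpa [smul_eq_mul, mul_assoc] using this
    exact measurable_prox hr.isClosed hr.convex d hR hz' hx (Measurable.const_smul hH a.γ) hzX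
      hmem hh hhc

lemma measurable_csmd (hr : o.Regular P ν) (hR : 0 < a.R) (hγ : 0 ≤ a.γ) (hκ : 0 ≤ a.κ)
    (hz : Measurable[past w n₀] z) (hzX : ∀ s, z s ∈ o.X) :
    Measurable[past w (n₀ + a.m * a.L)]
      fun s => csmd o d a (z s) (fun j => w (n₀ + j) s) := by
  have h : Measurable[past w (n₀ + a.m * a.L)] fun s =>
      ∑ i ∈ Finset.range a.m, csmdIter o d a (z s) (fun j => w (n₀ + j) s) i :=
    Finset.measurable_fun_sum _ fun i hi =>
      (measurable_csmdIter hr hR hγ hκ hz hzX i).mono (past_mono w (by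
        have := (Finset.mem_range.1 hi).le
        gcongr)) le_rfl
  exact Measurable.const_smul h ((a.m : ℝ)⁻¹)

variable [MeasurableSpace S] {μ : Measure S} [IsProbabilityMeasure μ]

/-- A Chernoff bound along the iterations of one run. -/
lemma measure_lt_sum_le (hr : o.Regular P ν) (hs : o.IsSolution P σ xs) (hR : 0 < a.R)
    (hγ : 0 ≤ a.γ) (hκ : 0 ≤ a.κ) (hw : ∀ i, Measurable (w i)) (hi : iIndepFun w μ)
    (hz : Measurable[past w n₀] z) (hzX : ∀ s, z s ∈ o.X)
    {ψ : o.X → StrongDual ℝ E → StrongDual ℝ E → ℝ}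
    (hψ : Measurable fun p : o.X × StrongDual ℝ E × StrongDual ℝ E => ψ p.1 p.2.1 p.2.2)
    (hbound : ∀ x : o.X, ‖(x : E) - xs‖ ≤ 2 * a.R → ∀ k,
      ∫⁻ s, ENNReal.ofReal (Real.exp (ψ x (o.batchGrad a.L x fun i => w (k + i) s)
        (o.batchGrad a.L xs fun i => w (k + i) s))) ∂μ ≤ 1) (T : ℝ) :
    μ {s | ‖z s - xs‖ ≤ a.R ∧ T < ∑ i ∈ Finset.range a.m,
      ψ ⟨csmdIter o d a (z s) (fun j => w (n₀ + j) s) i,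
          (csmdIter_mem hr.isClosed hR (hzX s) _ i).1⟩
        (iterGrad o a (fun j => w (n₀ + j) s) i (csmdIter o d a (z s) (fun j => w (n₀ + j) s) i))
        (iterGrad o a (fun j => w (n₀ + j) s) i xs)} ≤ ENNReal.ofReal (Real.exp (-T)) := by
  classical
  set x : ℕ → S → o.X := fun i s => ⟨csmdIter o d a (z s) (fun j => w (n₀ + j) s) i,
    (csmdIter_mem hr.isClosed hR (hzX s) _ i).1⟩
  set Ψ : ℕ → S → ℝ := fun i s => ψ (x i s) (iterGrad o a (fun j => w (n₀ + j) s) i (x i s))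
    (iterGrad o a (fun j => w (n₀ + j) s) i xs)
  set A : Set S := {s | ‖z s - xs‖ ≤ a.R}
  -- The indicator restricts to starts within the radius, an event known before the run; no
  -- conditioning is needed.
  set M : ℕ → S → ENNReal := fun i => A.indicator
    fun s => ENNReal.ofReal (Real.exp (∑ j ∈ Finset.range i, Ψ j s))
  have hA : MeasurableSet[past w n₀] A :=
    (measurable_norm.comp (hz.sub_const xs)) measurableSet_Iic
  have hxm : ∀ i, Measurable[past w (n₀ + i * a.L)] (x i) := fun i =>
    (measurable_csmdIter hr hR hγ hκ hz hzX i).subtype_mk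
  have hΨm : ∀ i, Measurable[past w (n₀ + (i + 1) * a.L)] (Ψ i) := by
    intro i
    have hle : n₀ + i * a.L ≤ n₀ + (i + 1) * a.L := by gcongr; omega
    have hx' := (hxm i).mono (past_mono w hle) le_rfl
    have h1 := measurable_iterGrad (n₀ := n₀) (a := a) (i := i) hr
      (measurable_subtype_coe.comp hx') (fun s => (x i s).2)
      fun j hj => measurable_past w (Nat.add_lt_add_left hj n₀)
    have h2 := measurable_iterGrad (m := past w (n₀ + (i + 1) * a.L)) (n₀ := n₀) (a := a)
      (i := i) (x := fun _ => xs) hr measurable_const (fun s => hs.mem)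
      fun j hj => measurable_past w (Nat.add_lt_add_left hj n₀)
    exact hψ.comp (hx'.prodMk (h1.prodMk h2))
  have hMm : ∀ i, Measurable[past w (n₀ + i * a.L)] (M i) := by
    intro i
    have h1 : Measurable[past w (n₀ + i * a.L)] fun s => ∑ j ∈ Finset.range i, Ψ j s :=
      Finset.measurable_fun_sum _ fun j hj => (hΨm j).mono (past_mono w (by
        have := Finset.mem_range.1 hj
        gcongr; omega)) le_rfl
    exact (Real.measurable_exp.comp h1).ennreal_ofReal.indicator
      (past_mono w (Nat.le_add_right n₀ _) _ hA)
  set φ : o.X → (ℕ → Ω) → ENNReal := fun x v =>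
    ENNReal.ofReal (Real.exp (ψ x (o.batchGrad a.L x v) (o.batchGrad a.L xs v)))
  have hφ : Measurable (Function.uncurry φ) := by
    have h1 : Measurable fun p : o.X × (ℕ → Ω) => o.batchGrad a.L p.1 p.2 :=
      hr.measurable_batchGrad (measurable_subtype_coe.comp measurable_fst)
        (fun l _ => (measurable_pi_apply l).comp measurable_snd) fun p => p.1.2
    have h2 : Measurable fun p : o.X × (ℕ → Ω) => o.batchGrad a.L xs p.2 :=
      hr.measurable_batchGrad measurable_const
        (fun l _ => (measurable_pi_apply l).comp measurable_snd) fun p => hs.mem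
    exact (Real.measurable_exp.comp
      (hψ.comp (measurable_fst.prodMk (h1.prodMk h2)))).ennreal_ofReal
  have hint : ∀ i, ∫⁻ s, M i s ∂μ ≤ 1 := by
    intro i
    induction i with
    | zero =>
      refine (lintegral_mono (g := fun _ => 1) fun s => ?_).trans (by simp)
      refine (Set.indicator_le_self' (fun _ _ => zero_le) s).trans ?_
      simp
    | succ i ih =>
      have hV : Measurable[future w (n₀ + i * a.L)] fun s l => w (n₀ + i * a.L + l) s :=
        measurable_future_shift w _
      -- The moment bound is needed only where `M i` is nonzero: there the start is within `R` of
      -- both the iterate and `xs`, so the iterate is within `2 R` of `xs`.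
      have key := lintegral_mul_le_of_indep hw hi (hMm i) (hxm i) hV hφ (c := 1) fun s hs' => by
        have hsA : s ∈ A := by
          by_contra h
          exact hs' (Set.indicator_of_notMem h _)
        refine hbound (x i s) ?_ _
        have h1 := (csmdIter_mem (d := d) hr.isClosed hR (hzX s) (fun j => w (n₀ + j) s) i).2
        calc ‖(x i s : E) - xs‖ = ‖((x i s : E) - z s) + (z s - xs)‖ := by congr 1; abel
          _ ≤ a.R + a.R := (norm_add_le _ _).trans (add_le_add h1 hsA)
          _ = 2 * a.R := by ring
      rw [mul_one] at key
      refine le_trans (le_of_eq (lintegral_congr fun s => ?_)) (key.trans ih)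
      by_cases hsA : s ∈ A
      · simp only [M, Set.indicator_of_mem hsA, φ]
        rw [← ENNReal.ofReal_mul (Real.exp_pos _).le, ← Real.exp_add, Finset.sum_range_succ]
        simp only [Ψ, iterGrad, add_assoc]
      · simp only [M, Set.indicator_of_notMem hsA, zero_mul]
  have hm' : AEMeasurable (M a.m) μ := ((hMm a.m).mono (past_le hw _) le_rfl).aemeasurable
  have hsub : {s | ‖z s - xs‖ ≤ a.R ∧ T < ∑ i ∈ Finset.range a.m, Ψ i s} ⊆
      {s | ENNReal.ofReal (Real.exp T) ≤ M a.m s} := by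
    rintro s ⟨h1, h2⟩
    have h1' : s ∈ A := h1
    simp only [M, Set.mem_ofPred_eq, Set.indicator_of_mem h1']
    exact ENNReal.ofReal_le_ofReal (Real.exp_le_exp.2 h2.le)
  calc _ ≤ _ := measure_mono hsub
    _ ≤ (∫⁻ s, M a.m s ∂μ) / ENNReal.ofReal (Real.exp T) :=
        meas_ge_le_lintegral_div hm' (by simp [Real.exp_pos]) ENNReal.ofReal_ne_top
    _ ≤ 1 / ENNReal.ofReal (Real.exp T) := by gcongr; exact hint _
    _ = _ := by
        rw [Real.exp_neg, ENNReal.ofReal_inv_of_pos (Real.exp_pos _), one_div]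

end Supermartingale

/-! ### One run halves the distance. -/

lemma rsc_radius_eq {δ r R : ℝ} (hδ : δ ≠ 0) (hr : r ≠ 0) (hR : R ≠ 0) (υ : ℝ) :
    δ * (r * (R / (8 * δ * r)) + υ / (R / (8 * δ * r))) =
      R / 8 + 8 * (δ ^ 2 * r * υ) / R := by
  field_simp

section Stage

variable {E Ω S : Type*} [NormedAddCommGroup E] [NormedSpace ℝ E] [FiniteDimensional ℝ E]
  [MeasurableSpace E] [BorelSpace E] [MeasurableSpace Ω] [MeasurableSpace S]
  {o : Oracle E Ω} {d : DGF E} {a : Run} {P : Measure Ω} [IsProbabilityMeasure P]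
  {μ : Measure S} [IsProbabilityMeasure μ] {ν σ : ℝ} {xs : E} {w : ℕ → S → Ω}
  {n₀ : ℕ} {z : S → E}

/-- The optimality gap of the output of one run, with high probability. -/
lemma measure_gap_le (hr : o.Regular P ν) (hs : o.IsSolution P σ xs) (hν : 0 < ν) (hσ : 0 < σ)
    (hw : ∀ i, MeasurePreserving (w i) μ P) (hi : iIndepFun w μ) (hR : 0 < a.R)
    (hγ : 0 < a.γ) (hκ : 0 ≤ a.κ) (hm : 1 ≤ a.m) (hL : 1 ≤ a.L) (hγν : a.γ * ν ≤ 1 / 4)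
    (hz : Measurable[past w n₀] z) (hzX : ∀ s, z s ∈ o.X) {T τ q : ℝ} (hT : 0 < T)
    (hΘT : d.Theta ≤ T) (hτ : 0 < τ) (hlt : LightTailed o xs μ w a.L τ q) :
    μ {s | ‖z s - xs‖ ≤ a.R ∧
      (a.R ^ 2 * T / a.γ + a.κ * a.R + 2 * a.γ * (τ * (q * a.m + T)) +
        4 * a.R * √(5 / 4 * σ ^ 2 / a.L * a.m * T) + 16 / 3 * ν * a.R ^ 2 * T) / a.m <
      o.F P a.κ (csmd o d a (z s) fun j => w (n₀ + j) s) - o.F P a.κ xs} ≤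
      3 * ENNReal.ofReal (Real.exp (-T)) := by
  have hm' : (0 : ℝ) < a.m := by exact_mod_cast hm
  have hL' : (0 : ℝ) < a.L := by exact_mod_cast hL
  set D := 5 / 4 * σ ^ 2 / a.L
  have hD : 0 < D := by positivity
  set Λ := √(D * a.m * T)
  have hΛ : 0 < Λ := Real.sqrt_pos.2 (by positivity)
  have hΛ2 : Λ ^ 2 = D * a.m * T := Real.sq_sqrt (by positivity)
  -- The Chernoff parameter that balances `T / l` and `4 D l R² m`; both equal `2 R Λ`, whence the
  -- term `4 R Λ`.
  set l := T / (2 * a.R * Λ)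
  have hl : 0 < l := by positivity
  -- The largest parameter that keeps the progress term within `1 / 2` for points at distance `2 R`
  -- from `xs`.
  set l₁ := 1 / (8 * ν * a.R ^ 2)
  have hl₁ : 0 < l₁ := by positivity
  have hgrad : Measurable fun x : o.X => o.meanGrad P x := hr.measurable_meanGrad
  have happ : Measurable fun p : StrongDual ℝ E × E => p.1 p.2 :=
    (isBoundedBilinearMap_apply (𝕜 := ℝ) (E := E) (F := ℝ)).continuous.measurable
  have hsubm : Measurable fun p : o.X × StrongDual ℝ E × StrongDual ℝ E => (p.1 : E) - xs :=
    (measurable_subtype_coe.comp measurable_fst).sub_const xs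
  have hwm := fun i => (hw i).measurable
  have e₁ := measure_lt_sum_le (a := a) (d := d) hr hs hR hγ.le hκ hwm hi hz hzX
    (ψ := fun x H K => 3 / 4 * l₁ * o.meanGrad P x (x - xs) - l₁ * (H - K) (x - xs))
    (by
      have h1 : Measurable fun p : o.X × StrongDual ℝ E × StrongDual ℝ E =>
          o.meanGrad P p.1 ((p.1 : E) - xs) :=
        happ.comp ((hgrad.comp measurable_fst).prodMk hsubm)
      have h2 : Measurable fun p : o.X × StrongDual ℝ E × StrongDual ℝ E =>
          (p.2.1 - p.2.2) ((p.1 : E) - xs) :=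
        happ.comp (((measurable_fst.comp measurable_snd).sub
          (measurable_snd.comp measurable_snd)).prodMk hsubm)
      exact (h1.const_mul _).sub (h2.const_mul _))
    (fun x hx k => by
      refine lintegral_exp_progress_le hr hs hw hi hL x.2 hl₁.le ?_ k
      calc l₁ * (ν * ‖(x : E) - xs‖ ^ 2) ≤ l₁ * (ν * (2 * a.R) ^ 2) := by gcongr
        _ = 1 / 2 := by simp only [l₁]; field_simp; norm_num) T
  have e₂ := measure_lt_sum_le (a := a) (d := d) hr hs hR hγ.le hκ hwm hi hz hzX
    (ψ := fun x _ K => K (-l • ((x : E) - xs)) - 4 * D * l ^ 2 * a.R ^ 2)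
    (by
      have h1 : Measurable fun p : o.X × StrongDual ℝ E × StrongDual ℝ E =>
          p.2.2 (-l • ((p.1 : E) - xs)) :=
        happ.comp ((measurable_snd.comp measurable_snd).prodMk (hsubm.const_smul (-l)))
      exact h1.sub_const _)
    (fun x hx k => by
      refine (lintegral_mono fun s => ?_).trans
        (lintegral_exp_noise_le hr hs hσ hw hi hL (-l • ((x : E) - xs)) k)
      refine ENNReal.ofReal_le_ofReal (Real.exp_le_exp.2 (sub_le_sub_left ?_ _))
      rw [norm_smul, norm_neg, Real.norm_of_nonneg hl.le, mul_pow]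
      calc 5 / 4 * (l ^ 2 * ‖(x : E) - xs‖ ^ 2) * σ ^ 2 / a.L = D * l ^ 2 * ‖(x : E) - xs‖ ^ 2 := by
            simp only [D]; ring
        _ ≤ D * l ^ 2 * (2 * a.R) ^ 2 := by gcongr
        _ = _ := by ring) T
  have e₃ := measure_lt_sum_le (a := a) (d := d) hr hs hR hγ.le hκ hwm hi hz hzX
    (ψ := fun _ _ K => ‖K‖ ^ 2 / τ - q)
    (by
      have h1 : Measurable fun p : o.X × StrongDual ℝ E × StrongDual ℝ E => ‖p.2.2‖ :=
        (measurable_snd.comp measurable_snd).norm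
      exact ((h1.pow_const 2).div_const _).sub_const _)
    (fun x hx k => hlt k) T
  have e₀ : μ {s | ¬ ∀ j, ∀ x ∈ o.X, ∀ x' ∈ o.X,
      ‖o.dG x (w j s) - o.dG x' (w j s)‖ ≤ ν * ‖x - x'‖} = 0 := by
    rw [← ae_iff, ae_all_iff]
    exact fun j => (hw j).quasiMeasurePreserving.ae hr.ae_lipschitz
  have hsplit : ∀ {X₀ X₁ X₂ X₃ X : Set S}, X ⊆ X₀ ∪ (X₁ ∪ (X₂ ∪ X₃)) → μ X₀ = 0 →
      μ X₁ ≤ ENNReal.ofReal (Real.exp (-T)) → μ X₂ ≤ ENNReal.ofReal (Real.exp (-T)) →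
      μ X₃ ≤ ENNReal.ofReal (Real.exp (-T)) → μ X ≤ 3 * ENNReal.ofReal (Real.exp (-T)) := by
    intro X₀ X₁ X₂ X₃ X hX h0 h1 h2 h3
    calc μ X ≤ μ X₀ + (μ X₁ + (μ X₂ + μ X₃)) :=
          (measure_mono hX).trans ((measure_union_le _ _).trans (add_le_add_right
            ((measure_union_le _ _).trans (add_le_add_right (measure_union_le _ _) _)) _))
      _ ≤ 0 + (ENNReal.ofReal (Real.exp (-T)) + (ENNReal.ofReal (Real.exp (-T)) +
          ENNReal.ofReal (Real.exp (-T)))) := by gcongr; exact h0.le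
      _ = _ := by ring
  refine hsplit ?_ e₀ e₁ e₂ e₃
  rintro s ⟨hsA, hgap⟩
  by_contra hcon
  simp only [Set.mem_union, Set.mem_ofPred_eq, not_or, not_and, not_lt, not_not] at hcon
  obtain ⟨g₀, g₁, g₂, g₃⟩ := hcon
  have g₁ := g₁ hsA
  have g₂ := g₂ hsA
  have g₃ := g₃ hsA
  rw [Finset.sum_sub_distrib, ← Finset.mul_sum, ← Finset.mul_sum] at g₁
  simp only [map_smul, smul_eq_mul] at g₂
  rw [Finset.sum_sub_distrib, ← Finset.mul_sum, Finset.sum_const, Finset.card_range,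
    nsmul_eq_mul] at g₂
  rw [Finset.sum_sub_distrib, ← Finset.sum_div, Finset.sum_const, Finset.card_range,
    nsmul_eq_mul] at g₃
  set X := csmdIter o d a (z s) (fun j => w (n₀ + j) s)
  have hfin := csmd_gap_le (d := d) hr hs hR hγ hκ hm hL hγν (hzX s) hsA
    (w := fun j => w (n₀ + j) s) (fun l => g₀ (n₀ + l)) (B₁ := 8 * ν * a.R ^ 2 * T)
    (B₂ := 4 * a.R * Λ) (B₃ := τ * (q * a.m + T)) ?_ ?_ ?_
  · have : a.R ^ 2 * d.Theta / a.γ ≤ a.R ^ 2 * T / a.γ := by gcongr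
    rw [div_lt_iff₀ hm'] at hgap
    linarith
  · have h := mul_le_mul_of_nonneg_left g₁ (by positivity : 0 ≤ 8 * ν * a.R ^ 2)
    have e : 8 * ν * a.R ^ 2 * l₁ = 1 := by simp only [l₁]; field_simp
    have h' : ∀ u v : ℝ, 8 * ν * a.R ^ 2 * (3 / 4 * l₁ * u - l₁ * v) = 3 / 4 * u - v := by
      intro u v
      linear_combination (3 / 4 * u - v) * e
    rw [h'] at h
    linarith
  · set U := ∑ i ∈ Finset.range a.m, iterGrad o a (fun j => w (n₀ + j) s) i xs (X i - xs)
    have e1 : l * (2 * a.R * Λ) = T := by simp only [l]; field_simp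
    have e2 : 4 * D * l ^ 2 * a.R ^ 2 * a.m = l * (2 * a.R * Λ) := by
      have : l * (2 * a.R * Λ) * (l * (2 * a.R * Λ)) = T * (4 * D * l ^ 2 * a.R ^ 2 * a.m) := by
        linear_combination (4 * l ^ 2 * a.R ^ 2) * hΛ2
      rw [e1] at this ⊢
      exact (mul_left_cancel₀ hT.ne' this).symm
    have e3 : l * -U ≤ l * (4 * a.R * Λ) := by linarith
    exact le_of_mul_le_mul_left e3 hl
  · rw [sub_le_iff_le_add, div_le_iff₀ hτ] at g₃
    linarith

/-- One run halves the distance to the solution, with high probability. -/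
lemma measure_half_lt_le {δ ρ : ℝ} {sp : ℕ} (hr : o.Regular P ν) (hs : o.IsSolution P σ xs)
    (hrsc : o.RSC P xs δ ρ sp) (hδ : 0 < δ) (hρ : 0 < ρ) (hsp : 1 ≤ sp) (hν : 0 < ν)
    (hσ : 0 < σ) (hw : ∀ i, MeasurePreserving (w i) μ P) (hi : iIndepFun w μ) (hR : 0 < a.R)
    (hγ : 0 < a.γ) (hm : 1 ≤ a.m) (hL : 1 ≤ a.L) (hγν : a.γ * ν ≤ 1 / 4)
    (hz : Measurable[past w n₀] z) (hzX : ∀ s, z s ∈ o.X) {T τ q : ℝ} (hT : 0 < T)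
    (hΘT : d.Theta ≤ T) (hτ : 0 < τ) (hq : 0 ≤ q) (hlt : LightTailed o xs μ w a.L τ q)
    (hκ : a.κ = a.R / (8 * δ * (ρ * sp)))
    (c₁ : 250 * (δ ^ 2 * (ρ * sp)) * T ≤ a.γ * a.m) (c₂ : 13 * δ ≤ a.m)
    (c₃ : 200 * (δ ^ 2 * (ρ * sp)) * a.γ * τ * (q + 1) ≤ a.R ^ 2) (c₄ : T ≤ a.m)
    (c₅ : (400 * (δ ^ 2 * (ρ * sp))) ^ 2 * (5 / 4 * σ ^ 2 / a.L) * T ≤ a.R ^ 2 * a.m) :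
    μ {s | ‖z s - xs‖ ≤ a.R ∧
      a.R / 2 < ‖csmd o d a (z s) (fun j => w (n₀ + j) s) - xs‖} ≤
      3 * ENNReal.ofReal (Real.exp (-T)) := by
  have hm' : (0 : ℝ) < a.m := by exact_mod_cast hm
  have hL' : (0 : ℝ) < a.L := by exact_mod_cast hL
  have hsp' : (0 : ℝ) < sp := by exact_mod_cast hsp
  set r := ρ * sp
  have hr0 : 0 < r := by positivity
  have hκ0 : 0 < a.κ := by rw [hκ]; positivity
  refine (measure_mono ?_).trans (measure_gap_le hr hs hν hσ hw hi hR hγ hκ0.le hm hL hγν hz hzX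
    hT hΘT hτ hlt)
  rintro s ⟨hsA, hfar⟩
  refine ⟨hsA, ?_⟩
  by_contra hcon
  rw [not_lt] at hcon
  -- By `rsc_radius_eq` the radius after the run is `R / 8 + 8 δ² ρ s υ / R`, so it suffices that
  -- `δ² ρ s υ ≤ (3 / 64) R²`. Each of the five terms of `υ` gets its share, a small fraction of `R²
  -- m` before division by `m`; the shares `1/250`, `1/104`, `1/100`, `1/100`, `1/150` sum to less
  -- than `3 / 64`.
  set D := 5 / 4 * σ ^ 2 / a.L
  have hD : 0 < D := by positivity
  set υ := (a.R ^ 2 * T / a.γ + a.κ * a.R + 2 * a.γ * (τ * (q * a.m + T)) +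
        4 * a.R * √(D * a.m * T) + 16 / 3 * ν * a.R ^ 2 * T) / a.m with hυ
  have hυ0 : 0 ≤ υ := by positivity
  have hnorm := hrsc.norm_sub_le hκ0 hυ0 (csmd_mem hr.isClosed hr.convex hR hm (hzX s) _) hcon
  have t₁ : δ ^ 2 * r * (a.R ^ 2 * T / a.γ) ≤ a.R ^ 2 * a.m / 250 := by
    have : δ ^ 2 * r * (a.R ^ 2 * T / a.γ) = a.R ^ 2 * (250 * (δ ^ 2 * r) * T) / (250 * a.γ) := by
      field_simp
    rw [this, div_le_div_iff₀ (by positivity) (by norm_num)]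
    linarith only [mul_le_mul_of_nonneg_left c₁ (sq_nonneg a.R)]
  have t₂ : δ ^ 2 * r * (a.κ * a.R) ≤ a.R ^ 2 * a.m / 104 := by
    have : δ ^ 2 * r * (a.κ * a.R) = a.R ^ 2 * (13 * δ) / 104 := by
      rw [hκ]; field_simp; norm_num
    rw [this]
    gcongr
  have t₃ : δ ^ 2 * r * (2 * a.γ * (τ * (q * a.m + T))) ≤ a.R ^ 2 * a.m / 100 := by
    have h1 : δ ^ 2 * r * (2 * a.γ * (τ * (q * a.m + T))) ≤
        δ ^ 2 * r * (2 * a.γ * (τ * (q * a.m + a.m))) := by gcongr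
    have h2 := mul_le_mul_of_nonneg_right c₃ hm'.le
    linarith only [h1, h2]
  have t₄ : δ ^ 2 * r * (4 * a.R * √(D * a.m * T)) ≤ a.R ^ 2 * a.m / 100 := by
    have h1 : 400 * (δ ^ 2 * r) * √(D * a.m * T) ≤ a.R * a.m := by
      refine (pow_le_pow_iff_left₀ (by positivity) (by positivity) two_ne_zero).1 ?_
      rw [mul_pow, Real.sq_sqrt (by positivity)]
      linarith only [mul_le_mul_of_nonneg_right c₅ hm'.le]
    linarith only [mul_le_mul_of_nonneg_left h1 hR.le]
  have t₅ : δ ^ 2 * r * (16 / 3 * ν * a.R ^ 2 * T) ≤ a.R ^ 2 * a.m / 150 := by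
    have h1 : δ ^ 2 * r * (16 / 3 * ν * a.R ^ 2 * T) =
        16 / 750 * (250 * (δ ^ 2 * r) * T) * (ν * a.R ^ 2) := by ring
    rw [h1]
    calc _ ≤ 16 / 750 * (a.γ * a.m) * (ν * a.R ^ 2) := by gcongr
      _ = 16 / 750 * (a.γ * ν) * (a.m * a.R ^ 2) := by ring
      _ ≤ 16 / 750 * (1 / 4) * (a.m * a.R ^ 2) := by gcongr
      _ ≤ _ := by linarith only [mul_nonneg hm'.le (sq_nonneg a.R)]
  have hυA : δ ^ 2 * r * υ ≤ 3 / 64 * a.R ^ 2 := by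
    rw [hυ, mul_div_assoc', div_le_iff₀ hm', mul_add, mul_add, mul_add, mul_add]
    linarith only [t₁, t₂, t₃, t₄, t₅, mul_nonneg (sq_nonneg a.R) hm'.le]
  have hfinal : δ * (r * a.κ + υ / a.κ) ≤ a.R / 2 := by
    have e : δ * (r * a.κ + υ / a.κ) = a.R / 8 + 8 * (δ ^ 2 * r * υ) / a.R := by
      rw [hκ]
      exact rsc_radius_eq hδ.ne' hr0.ne' hR.ne' υ
    rw [e]
    have : 8 * (δ ^ 2 * r * υ) / a.R ≤ 3 / 8 * a.R := by
      rw [div_le_iff₀ hR]; linarith only [hυA]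
    linarith only [this]
  linarith

end Stage

/-! ### Chaining runs. -/

section Stages

variable {E Ω S : Type*} [NormedAddCommGroup E] [NormedSpace ℝ E]
  [MeasurableSpace E] [MeasurableSpace Ω]

/-- From any admissible random starting point within the radius of the run, one run halves the
distance to the solution, up to an event of measure `ε`. -/
def Halves [MeasurableSpace S] (o : Oracle E Ω) (d : DGF E) (xs : E) (μ : Measure S)
    (w : ℕ → S → Ω) (ε : ENNReal) (a : Run) : Prop :=
  ∀ (n₀ : ℕ) (z : S → E), Measurable[past w n₀] z → (∀ s, z s ∈ o.X) →
    μ {s | ‖z s - xs‖ ≤ a.R ∧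
      a.R / 2 < ‖csmd o d a (z s) (fun j => w (n₀ + j) s) - xs‖} ≤ ε

lemma cost_succ (a : ℕ → Run) (k : ℕ) : cost a (k + 1) = cost a k + (a k).m * (a k).L :=
  Finset.sum_range_succ _ _

variable [FiniteDimensional ℝ E] [BorelSpace E] {o : Oracle E Ω} {d : DGF E} {P : Measure Ω}
  {ν : ℝ} {xs : E} {w : ℕ → S → Ω} {a : ℕ → Run} {n₀ : ℕ} {z : S → E}

lemma stages_mem_and_measurable (hr : o.Regular P ν) (hR : ∀ k, 0 < (a k).R)
    (hγ : ∀ k, 0 ≤ (a k).γ) (hκ : ∀ k, 0 ≤ (a k).κ) (hm : ∀ k, 1 ≤ (a k).m)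
    (hz : Measurable[past w n₀] z) (hzX : ∀ s, z s ∈ o.X) (k : ℕ) :
    (∀ s, stages o d a (z s) (fun j => w (n₀ + j) s) k ∈ o.X) ∧
      Measurable[past w (n₀ + cost a k)]
        fun s => stages o d a (z s) (fun j => w (n₀ + j) s) k := by
  induction k with
  | zero => exact ⟨hzX, hz.mono (past_mono w (Nat.le_add_right n₀ _)) le_rfl⟩
  | succ k ih =>
    refine ⟨fun s => csmd_mem hr.isClosed hr.convex (hR k) (hm k) (ih.1 s) _, ?_⟩
    have h := measurable_csmd (d := d) (a := a k) hr (hR k) (hγ k) (hκ k) ih.2 ih.1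
    rw [cost_succ, ← add_assoc n₀]
    simpa only [stages, ← add_assoc] using h

/-- If the final radius is missed, some stage started within its radius and failed to halve it; the
union over the stages is bounded by `K * ε`. Each start depends only on samples already consumed,
which is what `Halves` asks. -/
lemma measure_stages_le [MeasurableSpace S] (hr : o.Regular P ν) (hR : ∀ k, 0 < (a k).R)
    (hγ : ∀ k, 0 ≤ (a k).γ) (hκ : ∀ k, 0 ≤ (a k).κ) (hm : ∀ k, 1 ≤ (a k).m)
    (hz : Measurable[past w n₀] z) (hzX : ∀ s, z s ∈ o.X) {μ : Measure S} {ε : ENNReal} {r : ℝ}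
    (har : ∀ k, (a k).R = r / 2 ^ k) {K : ℕ} (hK : ∀ k < K, Halves o d xs μ w ε (a k)) :
    μ {s | ‖z s - xs‖ ≤ r ∧
      r / 2 ^ K < ‖stages o d a (z s) (fun j => w (n₀ + j) s) K - xs‖} ≤ K * ε := by
  induction K with
  | zero =>
    have : {s | ‖z s - xs‖ ≤ r ∧
        r / 2 ^ 0 < ‖stages o d a (z s) (fun j => w (n₀ + j) s) 0 - xs‖} = ∅ := by
      ext s
      simp [stages]
    rw [this]
    simp
  | succ K ih =>
    obtain ⟨h1, h2⟩ := stages_mem_and_measurable (d := d) hr hR hγ hκ hm hz hzX K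
    have h3 := hK K (Nat.lt_succ_self K) _ _ h2 h1
    have h4 := ih fun k hk => hK k (hk.trans (Nat.lt_succ_self K))
    rw [har K] at h3
    push_cast
    rw [add_mul, one_mul]
    refine le_trans (measure_mono ?_) ((measure_union_le _ _).trans (add_le_add h4 h3))
    rintro s ⟨hs1, hs2⟩
    by_cases hc : ‖stages o d a (z s) (fun j => w (n₀ + j) s) K - xs‖ ≤ r / 2 ^ K
    · refine Or.inr ⟨hc, ?_⟩
      rw [pow_succ, ← div_div] at hs2
      simpa only [stages, add_assoc] using hs2
    · exact Or.inl ⟨hs1, not_le.1 hc⟩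

end Stages

/-! ### Counting stages within the budget. -/

section Budget

variable {a : ℕ → Run}

lemma le_cost (ha : ∀ k, 1 ≤ (a k).m * (a k).L) (k : ℕ) : k ≤ cost a k := by
  induction k with
  | zero => exact Nat.zero_le _
  | succ k ih => rw [cost_succ]; exact add_le_add ih (ha k)

lemma cost_stageCount_le (a : ℕ → Run) (B : ℕ) : cost a (stageCount a B) ≤ B :=
  Nat.findGreatest_spec (P := fun k => cost a k ≤ B) (Nat.zero_le B) (by simp [cost])

lemma lt_cost_stageCount_succ (ha : ∀ k, 1 ≤ (a k).m * (a k).L) (B : ℕ) :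
    B < cost a (stageCount a B + 1) := by
  by_contra h
  rw [not_lt] at h
  have h1 : stageCount a B + 1 ≤ B := (le_cost ha _).trans h
  exact Nat.findGreatest_is_greatest (P := fun k => cost a k ≤ B)
    (Nat.lt_succ_self (stageCount a B)) h1 h

lemma stageCount_eq_zero {B M : ℕ} (ha : ∀ k, M ≤ (a k).m * (a k).L) (hB : B < M) :
    stageCount a B = 0 := by
  by_contra h
  obtain ⟨k, hk⟩ := Nat.exists_eq_succ_of_ne_zero h
  have h1 := cost_stageCount_le a B
  rw [hk, Nat.succ_eq_add_one, cost_succ] at h1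
  have := ha k
  omega

variable {W : ℝ}

/-- The last stage dominates a geometric series of ratio `4`; the induction closes because `23 + 17
* 4 ≤ 23 * 4`. -/
lemma cost_le_geometric (hW : 0 ≤ W)
    (hu : ∀ k, ((a k).m * (a k).L : ℝ) ≤ 17 * 4 ^ (k + 1) * W) (k : ℕ) :
    (cost a k : ℝ) ≤ 23 * 4 ^ k * W := by
  induction k with
  | zero => simp [cost, hW]
  | succ k ih =>
    rw [cost_succ]
    push_cast
    have := hu k
    have h4 : 0 ≤ 4 ^ k * W := by positivity
    rw [pow_succ] at this ⊢
    linarith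

/-- The budget bounds the number of stages from below. -/
lemma budget_lt (hW : 0 ≤ W) (ha : ∀ k, 1 ≤ (a k).m * (a k).L)
    (hu : ∀ k, ((a k).m * (a k).L : ℝ) ≤ 17 * 4 ^ (k + 1) * W) (B : ℕ) :
    (B : ℝ) < 92 * 4 ^ stageCount a B * W := by
  have h1 : (B : ℝ) < cost a (stageCount a B + 1) := by
    exact_mod_cast lt_cost_stageCount_succ ha B
  have h2 := cost_le_geometric hW hu (stageCount a B + 1)
  rw [pow_succ] at h2
  linarith

/-- The budget bounds the number of stages from above. -/
lemma stageCount_le_log (hW : 0 < W)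
    (hl : ∀ k, 4 ^ (k + 1) * W ≤ ((a k).m * (a k).L : ℝ)) {B N : ℕ} (hBN : B ≤ N) :
    (stageCount a B : ℝ) ≤ max 0 (Real.log (N / W)) := by
  rcases Nat.eq_zero_or_pos (stageCount a B) with h | h
  · rw [h]; simp
  · obtain ⟨k, hk⟩ := Nat.exists_eq_succ_of_ne_zero h.ne'
    have h1 := cost_stageCount_le a B
    rw [hk, Nat.succ_eq_add_one, cost_succ] at h1
    -- The last completed stage alone already fits in the budget, and `log 4 ≥ 1` turns its cost
    -- into a bound on its index.
    have h2 : ((a k).m * (a k).L : ℝ) ≤ N := by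
      exact_mod_cast (Nat.le_of_add_left_le h1).trans hBN
    have h3 : (4 : ℝ) ^ (k + 1) ≤ N / W := (le_div_iff₀ hW).2 ((hl k).trans h2)
    have h4 := Real.log_le_log (by positivity) h3
    rw [Real.log_pow] at h4
    have h5 : 1 ≤ Real.log 4 := by
      rw [Real.le_log_iff_exp_le (by norm_num)]
      linarith [Real.exp_one_lt_d9]
    refine le_trans ?_ (le_max_right _ _)
    rw [hk, Nat.succ_eq_add_one]
    refine le_trans ?_ h4
    exact le_mul_of_one_le_right (by positivity) h5

end Budget

/-- The values of the absolute constants of the algorithm. -/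
noncomputable def tuning : Tuning where
  -- The value of `pen` is the `1 / 8` in `κ = R / (8 δ ρ s)`, and `pen' = level / 4` gives the same
  -- relation in the asymptotic stages. The other values have slack: `len ≥ 1000` already gives `γ
  -- m₀ ≥ 250 δ² ρ s (Θ + t)` for `γ = 1 / (4 ν)`, `level² = 256` exceeds the `100` asked by the
  -- squared noise in the preliminary phase, and `batch` absorbs `Θ + 3` into a multiple of `Θ ≥ 1 /
  -- 2`.
  len := 4096
  pen := 1 / 8
  level := 16
  pen' := 4
  step := 1
  grow := 1
  batch := 16
  len_pos := by norm_num
  pen_pos := by norm_num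
  level_pos := by norm_num
  pen'_pos := by norm_num
  step_pos := by norm_num
  grow_pos := by norm_num
  batch_pos := by norm_num

/-- The constraints on the data of the algorithm. -/
structure Params.Admissible (p : Params) : Prop where
  ν_pos : 0 < p.ν
  ρ_pos : 0 < p.ρ
  σ_pos : 0 < p.σ
  R_pos : 0 < p.R
  one_le_s : 1 ≤ p.s
  one_le_δ : 1 ≤ p.δ
  one_le_ρν : 1 ≤ p.ρ * p.ν
  t_nonneg : 0 ≤ p.t

/-- The condition number `δ² ρ s` that governs the accuracy of a run. -/
noncomputable def Params.cond (p : Params) : ℝ := p.δ ^ 2 * (p.ρ * p.s)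

/-! ### Numerical consequences of the choice of constants. -/

section Constants

variable {E : Type*} [NormedAddCommGroup E] [NormedSpace ℝ E] {d : DGF E} {p : Params}

lemma Params.Admissible.s_pos (hp : p.Admissible) : (0 : ℝ) < p.s := by
  exact_mod_cast hp.one_le_s

lemma Params.Admissible.δ_pos (hp : p.Admissible) : 0 < p.δ := one_pos.trans_le hp.one_le_δ

lemma Params.Admissible.cond_pos (hp : p.Admissible) : 0 < p.cond := by
  have := hp.s_pos; have := hp.δ_pos; have := hp.ρ_pos
  unfold Params.cond; positivity

/-- Here `ρ ν ≥ 1`, `s ≥ 1` and `δ ≥ 1` come together. The consequence is that `m₀` dominates both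
`δ` and `Θ + t`, as one run requires. -/
lemma Params.Admissible.δ_le_cond_mul (hp : p.Admissible) : p.δ ≤ p.cond * p.ν := by
  have h1 : (1 : ℝ) ≤ p.s := by exact_mod_cast hp.one_le_s
  have h2 : 1 ≤ p.ρ * p.ν * p.s := one_le_mul_of_one_le_of_one_le hp.one_le_ρν h1
  have h3 : p.δ ≤ p.δ ^ 2 := by nlinarith [hp.one_le_δ]
  have e : p.cond * p.ν = p.δ ^ 2 * (p.ρ * p.ν * p.s) := by unfold Params.cond; ring
  rw [e]
  exact h3.trans (le_mul_of_one_le_right (sq_nonneg _) h2)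

lemma one_le_cond_mul (hp : p.Admissible) : 1 ≤ p.cond * p.ν :=
  hp.one_le_δ.trans hp.δ_le_cond_mul

lemma m₀_eq (d : DGF E) (p : Params) :
    tuning.m₀ p d = ⌈4096 * (p.cond * p.ν * (d.Theta + p.t))⌉₊ := by
  unfold Tuning.m₀ Params.cond tuning
  congr 1
  ring

lemma le_m₀ (d : DGF E) (p : Params) :
    4096 * (p.cond * p.ν * (d.Theta + p.t)) ≤ tuning.m₀ p d := by
  rw [m₀_eq]; exact Nat.le_ceil _

lemma half_le_complexity (hp : p.Admissible) (hΘ : 1 / 2 ≤ d.Theta) :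
    1 / 2 ≤ p.cond * p.ν * (d.Theta + p.t) := by
  have h1 := one_le_cond_mul hp
  have h2 : 1 / 2 ≤ d.Theta + p.t := by linarith [hp.t_nonneg]
  nlinarith

/-- Rounding up adds at most `1`, which is at most twice the complexity since the latter is at least
`1 / 2`. -/
lemma m₀_le (hp : p.Admissible) (hΘ : 1 / 2 ≤ d.Theta) :
    (tuning.m₀ p d : ℝ) ≤ 4098 * (p.cond * p.ν * (d.Theta + p.t)) := by
  have h := half_le_complexity hp hΘ
  rw [m₀_eq]
  have := (Nat.ceil_lt_add_one (by positivity : 0 ≤ 4096 * (p.cond * p.ν * (d.Theta + p.t)))).le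
  linarith

lemma one_le_m₀ (hp : p.Admissible) (hΘ : 1 / 2 ≤ d.Theta) :
    1 ≤ tuning.m₀ p d := by
  have h := half_le_complexity hp hΘ
  have h2 := le_m₀ d p
  have : (1 : ℝ) ≤ tuning.m₀ p d := by linarith
  exact_mod_cast this

lemma δ_le_m₀ (hp : p.Admissible) (hΘ : 1 / 2 ≤ d.Theta) : 13 * p.δ ≤ tuning.m₀ p d := by
  have h2 := le_m₀ d p
  have h3 := hp.δ_le_cond_mul
  have h4 := hp.δ_pos
  have h5 : 1 / 2 ≤ d.Theta + p.t := by linarith [hp.t_nonneg]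
  have h7 : 0 ≤ p.cond * p.ν := h4.le.trans h3
  have h6 : p.δ * (1 / 2) ≤ p.cond * p.ν * (d.Theta + p.t) := by gcongr
  linarith

lemma Theta_add_le_m₀ (hp : p.Admissible) (hΘ : 1 / 2 ≤ d.Theta) :
    d.Theta + p.t ≤ tuning.m₀ p d := by
  have h2 := le_m₀ d p
  have h5 : 1 / 2 ≤ d.Theta + p.t := by linarith [hp.t_nonneg]
  have h6 : d.Theta + p.t ≤ p.cond * p.ν * (d.Theta + p.t) :=
    le_mul_of_one_le_left (by linarith) (one_le_cond_mul hp)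
  linarith

lemma cond_mul_le_div (hp : p.Admissible) (hΘ : 1 / 2 ≤ d.Theta) :
    250 * p.cond * (d.Theta + p.t) ≤ (4 * p.ν)⁻¹ * tuning.m₀ p d := by
  have h2 := le_m₀ d p
  have h3 := half_le_complexity hp hΘ
  have hν := hp.ν_pos
  rw [inv_mul_eq_div, le_div_iff₀ (by positivity)]
  linarith

lemma r₀_pos (hp : p.Admissible) : 0 < tuning.r₀ p := by
  have := hp.s_pos; have := hp.δ_pos; have := hp.ρ_pos; have := hp.σ_pos; have := hp.ν_pos
  simp only [Tuning.r₀, tuning]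
  positivity

lemma r₀_sq (hp : p.Admissible) : tuning.r₀ p ^ 2 = 256 * (p.σ ^ 2 * p.cond / p.ν) := by
  have := hp.s_pos; have := hp.δ_pos; have := hp.ρ_pos; have := hp.ν_pos
  simp only [Tuning.r₀, tuning, Params.cond]
  rw [mul_pow, mul_pow, mul_pow, Real.sq_sqrt (by positivity)]
  ring

lemma asymPen_eq (hp : p.Admissible) (k : ℕ) :
    tuning.asymPen p (k + 1) = tuning.r₀ p / 2 ^ k / (8 * p.δ * (p.ρ * p.s)) := by
  have h1 := hp.s_pos; have h2 := hp.δ_pos; have h3 := hp.ρ_pos; have h4 := hp.ν_pos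
  have hq : 0 < √(p.ρ * p.ν * p.s) := Real.sqrt_pos.2 (by positivity)
  have e : √(p.ρ * p.s / p.ν) = p.ρ * p.s / √(p.ρ * p.ν * p.s) := by
    rw [eq_div_iff hq.ne', ← Real.sqrt_mul (by positivity),
      show p.ρ * p.s / p.ν * (p.ρ * p.ν * p.s) = (p.ρ * p.s) ^ 2 by field_simp]
    exact Real.sqrt_sq (by positivity)
  simp only [Tuning.r₀, Tuning.asymPen, tuning, e, pow_succ]
  field_simp
  ring

lemma asym_m (d : DGF E) (p : Params) (k : ℕ) :
    (tuning.asym p d k).m = 4 ^ (k + 1) * tuning.m₀ p d := by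
  simp only [Tuning.asym, tuning, one_mul]
  exact_mod_cast Nat.ceil_natCast _

lemma le_asymBatch_L (d : DGF E) (p : Params) (k : ℕ) :
    16 * (4 ^ (k + 1) * d.Theta) ≤ (tuning.asymBatch p d k).L :=
  Nat.le_ceil _

lemma asymBatch_L_le (hΘ : 1 / 2 ≤ d.Theta) (p : Params) (k : ℕ) :
    ((tuning.asymBatch p d k).L : ℝ) ≤ 17 * (4 ^ (k + 1) * d.Theta) := by
  have h4 : (1 : ℝ) ≤ 4 ^ k := one_le_pow₀ (by norm_num)
  have h5 : 1 ≤ 4 ^ (k + 1) * d.Theta := by rw [pow_succ]; nlinarith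
  have h : ((tuning.asymBatch p d k).L : ℝ) ≤ 16 * (4 ^ (k + 1) * d.Theta) + 1 :=
    (Nat.ceil_lt_add_one (by linarith : 0 ≤ 16 * (4 ^ (k + 1) * d.Theta))).le
  linarith

end Constants

/-! ### Each kind of stage halves the distance. -/

section Halving

variable {E Ω S : Type*} [NormedAddCommGroup E] [NormedSpace ℝ E] [FiniteDimensional ℝ E]
  [MeasurableSpace E] [BorelSpace E] [MeasurableSpace Ω] [MeasurableSpace S]
  {o : Oracle E Ω} {d : DGF E} {P : Measure Ω} [IsProbabilityMeasure P]
  {μ : Measure S} [IsProbabilityMeasure μ] {xs : E} {w : ℕ → S → Ω} {p : Params}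

/-- The probability that one run fails. -/
noncomputable def failure (d : DGF E) (p : Params) : ENNReal :=
  3 * ENNReal.ofReal (Real.exp (-(d.Theta + p.t)))

/-- Reduces a stage to three scaling checks: total step length `γ m`, squared noise against `R²`,
and linear noise against `R² m`, the last measured in units of `r₀²`. The deviation level is `T = Θ
+ t`. -/
lemma halves_of_le (hp : p.Admissible) (hΘ : 1 / 2 ≤ d.Theta) (hr : o.Regular P p.ν)
    (hs : o.IsSolution P p.σ xs) (hrsc : o.RSC P xs p.δ p.ρ p.s)
    (hw : ∀ i, MeasurePreserving (w i) μ P) (hi : iIndepFun w μ) {a : Run} (hR : 0 < a.R)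
    (hγ : 0 < a.γ) (hγν : a.γ * p.ν ≤ 1 / 4) (hL : 1 ≤ a.L) (hm : tuning.m₀ p d ≤ a.m)
    {τ q : ℝ} (hτ : 0 < τ) (hq : 0 ≤ q) (hlt : LightTailed o xs μ w a.L τ q)
    (hκ : a.κ = a.R / (8 * p.δ * (p.ρ * p.s)))
    (c₁ : (4 * p.ν)⁻¹ * tuning.m₀ p d ≤ a.γ * a.m)
    (c₃ : 200 * p.cond * a.γ * τ * (q + 1) ≤ a.R ^ 2)
    (c₅ : 256 * (p.σ ^ 2 * p.cond / p.ν) * tuning.m₀ p d / a.L ≤ a.R ^ 2 * a.m) :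
    Halves o d xs μ w (failure d p) a := by
  intro n₀ z hz hzX
  have hL' : (0 : ℝ) < a.L := by exact_mod_cast hL
  have hm' : (tuning.m₀ p d : ℝ) ≤ a.m := by exact_mod_cast hm
  have hA := hp.cond_pos
  have hν := hp.ν_pos
  have hT : 0 < d.Theta + p.t := by linarith [hp.t_nonneg]
  refine measure_half_lt_le hr hs hrsc hp.δ_pos hp.ρ_pos hp.one_le_s hp.ν_pos hp.σ_pos hw hi hR hγ
    ((one_le_m₀ hp hΘ).trans hm) hL hγν hz hzX hT (by linarith [hp.t_nonneg]) hτ hq hlt hκ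
    ((cond_mul_le_div hp hΘ).trans c₁) ((δ_le_m₀ hp hΘ).trans hm') c₃
    ((Theta_add_le_m₀ hp hΘ).trans hm') (le_trans ?_ c₅)
  have e : (400 * (p.δ ^ 2 * (p.ρ * p.s))) ^ 2 * (5 / 4 * p.σ ^ 2 / a.L) * (d.Theta + p.t) =
      200000 * (p.σ ^ 2 * p.cond / p.ν) * (p.cond * p.ν * (d.Theta + p.t)) / a.L := by
    unfold Params.cond
    field_simp
    ring
  rw [e]
  have h := le_m₀ d p
  have hU : 0 ≤ p.cond * p.ν * (d.Theta + p.t) := by positivity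
  have hB : 0 ≤ p.σ ^ 2 * p.cond / p.ν := by positivity
  rw [div_le_div_iff_of_pos_right hL']
  nlinarith [mul_le_mul_of_nonneg_left h hB, mul_nonneg hB hU]

/-- As long as the radius is at least `r₀`, both noise terms are below the scale of `R²` with the
maximal step `1 / (4 ν)` and single samples. -/
lemma halves_prelim (hp : p.Admissible) (hΘ : 1 / 2 ≤ d.Theta) (hr : o.Regular P p.ν)
    (hs : o.IsSolution P p.σ xs) (hrsc : o.RSC P xs p.δ p.ρ p.s)
    (hw : ∀ i, MeasurePreserving (w i) μ P) (hi : iIndepFun w μ) {k : ℕ}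
    (hk : tuning.r₀ p ≤ p.R / 2 ^ k) :
    Halves o d xs μ w (failure d p) (tuning.prelim p d k) := by
  have hR := hp.R_pos; have hν := hp.ν_pos; have hσ := hp.σ_pos; have hA := hp.cond_pos
  have hδ := hp.δ_pos; have hρ := hp.ρ_pos; have hsp := hp.s_pos
  have hsq : 256 * (p.σ ^ 2 * p.cond / p.ν) ≤ (p.R / 2 ^ k) ^ 2 := by
    rw [← r₀_sq hp]
    exact pow_le_pow_left₀ (r₀_pos hp).le hk 2
  have hB : 0 ≤ p.σ ^ 2 * p.cond / p.ν := by positivity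
  refine halves_of_le hp hΘ hr hs hrsc hw hi (a := tuning.prelim p d k) (τ := p.σ ^ 2) (q := 1)
    ?_ ?_ ?_ le_rfl le_rfl (by positivity) zero_le_one (lightTailed_one hr hs hw) ?_ le_rfl ?_ ?_
  · simp only [Tuning.prelim]; positivity
  · simp only [Tuning.prelim]; positivity
  · simp only [Tuning.prelim]; field_simp; exact le_rfl
  · simp only [Tuning.prelim, tuning]; field_simp
  · refine le_trans (le_of_eq ?_) (le_trans (mul_le_mul_of_nonneg_right
      (by norm_num : (100 : ℝ) ≤ 256) hB) hsq)
    simp only [Tuning.prelim]; field_simp; norm_num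
  · simp only [Tuning.prelim, Nat.cast_one, div_one]
    gcongr

/-- Dividing the step and multiplying the length by `4 ^ (k + 1)` keeps `γ m` fixed; the squared
noise then shrinks like `R²`, and `R² m` does not decrease with `k`. -/
lemma halves_asym (hp : p.Admissible) (hΘ : 1 / 2 ≤ d.Theta) (hr : o.Regular P p.ν)
    (hs : o.IsSolution P p.σ xs) (hrsc : o.RSC P xs p.δ p.ρ p.s)
    (hw : ∀ i, MeasurePreserving (w i) μ P) (hi : iIndepFun w μ) (k : ℕ) :
    Halves o d xs μ w (failure d p) (tuning.asym p d k) := by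
  have hν := hp.ν_pos; have hσ := hp.σ_pos; have hA := hp.cond_pos
  have hr₀ := r₀_pos hp
  have hB : 0 ≤ p.σ ^ 2 * p.cond / p.ν := by positivity
  have h4 : (1 : ℝ) ≤ 4 ^ k := one_le_pow₀ (by norm_num)
  have hsq : (tuning.r₀ p / 2 ^ k) ^ 2 = 256 * (p.σ ^ 2 * p.cond / p.ν) / 4 ^ k := by
    rw [div_pow, r₀_sq hp, ← pow_mul, mul_comm k 2, pow_mul]; norm_num
  have hγ : (tuning.asym p d k).γ = 1 / (4 ^ (k + 1) * p.ν) := rfl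
  have hRa : (tuning.asym p d k).R = tuning.r₀ p / 2 ^ k := rfl
  have hLa : (tuning.asym p d k).L = 1 := rfl
  refine halves_of_le hp hΘ hr hs hrsc hw hi (a := tuning.asym p d k) (τ := p.σ ^ 2) (q := 1)
    ?_ ?_ ?_ le_rfl ?_ (by positivity) zero_le_one (lightTailed_one hr hs hw) (asymPen_eq hp k)
    ?_ ?_ ?_
  · rw [hRa]; positivity
  · rw [hγ]; positivity
  · rw [hγ, pow_succ]
    rw [one_div_mul_eq_div, div_le_iff₀ (by positivity)]
    nlinarith
  · rw [asym_m]
    exact Nat.le_mul_of_pos_left _ (by positivity)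
  · rw [hγ, asym_m]
    push_cast
    have hm : (0 : ℝ) ≤ tuning.m₀ p d := Nat.cast_nonneg _
    have e : 1 / (4 ^ (k + 1) * p.ν) * (4 ^ (k + 1) * (tuning.m₀ p d : ℝ)) =
        p.ν⁻¹ * tuning.m₀ p d := by field_simp
    rw [e]
    gcongr
    linarith
  · rw [hγ, hRa, hsq]
    have e : 200 * p.cond * (1 / (4 ^ (k + 1) * p.ν)) * p.σ ^ 2 * (1 + 1) =
        100 * (p.σ ^ 2 * p.cond / p.ν) / 4 ^ k := by
      rw [pow_succ]; field_simp; norm_num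
    rw [e]
    gcongr
    norm_num
  · rw [hRa, hsq, hLa, asym_m]
    push_cast
    have hm : (0 : ℝ) ≤ tuning.m₀ p d := Nat.cast_nonneg _
    have e : 256 * (p.σ ^ 2 * p.cond / p.ν) / 4 ^ k * (4 ^ (k + 1) * (tuning.m₀ p d : ℝ)) =
        4 * (256 * (p.σ ^ 2 * p.cond / p.ν) * tuning.m₀ p d) := by
      field_simp; ring
    rw [e, div_one]
    have : 0 ≤ 256 * (p.σ ^ 2 * p.cond / p.ν) * (tuning.m₀ p d : ℝ) := by positivity
    linarith

/-- Step and length stay those of the preliminary phase; the batch divides the noise variance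
instead. The squared norm of the averaged noise carries the extra factor `Θ + 3`, which dictates
batches proportional to `Θ`. -/
lemma halves_asymBatch (hp : p.Admissible) (hΘ : 1 / 2 ≤ d.Theta) (hr : o.Regular P p.ν)
    (hs : o.IsSolution P p.σ xs) (hrsc : o.RSC P xs p.δ p.ρ p.s)
    (hw : ∀ i, MeasurePreserving (w i) μ P) (hi : iIndepFun w μ) (k : ℕ) :
    Halves o d xs μ w (failure d p) (tuning.asymBatch p d k) := by
  have hν := hp.ν_pos; have hσ := hp.σ_pos; have hA := hp.cond_pos
  have hr₀ := r₀_pos hp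
  have hB : 0 ≤ p.σ ^ 2 * p.cond / p.ν := by positivity
  have h4 : (1 : ℝ) ≤ 4 ^ k := one_le_pow₀ (by norm_num)
  have hsq : (tuning.r₀ p / 2 ^ k) ^ 2 = 256 * (p.σ ^ 2 * p.cond / p.ν) / 4 ^ k := by
    rw [div_pow, r₀_sq hp, ← pow_mul, mul_comm k 2, pow_mul]; norm_num
  have hγ : (tuning.asymBatch p d k).γ = (4 * p.ν)⁻¹ := rfl
  have hRa : (tuning.asymBatch p d k).R = tuning.r₀ p / 2 ^ k := rfl
  have hma : (tuning.asymBatch p d k).m = tuning.m₀ p d := rfl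
  have hLk := le_asymBatch_L d p k
  have hL4 : (4 : ℝ) ^ k ≤ (tuning.asymBatch p d k).L := by
    rw [pow_succ] at hLk; nlinarith
  have hL1 : 1 ≤ (tuning.asymBatch p d k).L := by exact_mod_cast h4.trans hL4
  have hL' : (0 : ℝ) < (tuning.asymBatch p d k).L := by exact_mod_cast hL1
  refine halves_of_le hp hΘ hr hs hrsc hw hi (a := tuning.asymBatch p d k)
    (τ := 40 * p.σ ^ 2 / (tuning.asymBatch p d k).L) (q := d.Theta + 2)
    ?_ ?_ ?_ hL1 le_rfl (by positivity) (by linarith) (lightTailed_batch d hr hs hσ hw hi hL1)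
    (asymPen_eq hp k) le_rfl ?_ ?_
  · rw [hRa]; positivity
  · rw [hγ]; positivity
  · rw [hγ]; field_simp; exact le_rfl
  · rw [hγ, hRa, hsq]
    have e : 200 * p.cond * (4 * p.ν)⁻¹ * (40 * p.σ ^ 2 / (tuning.asymBatch p d k).L) *
        (d.Theta + 2 + 1) = p.σ ^ 2 * p.cond / p.ν *
          (2000 * (d.Theta + 3) / (tuning.asymBatch p d k).L) := by
      field_simp; ring
    have h : 2000 * (d.Theta + 3) / (tuning.asymBatch p d k).L ≤ 256 / 4 ^ k := by
      rw [div_le_div_iff₀ hL' (by positivity)]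
      rw [pow_succ] at hLk
      nlinarith
    rw [e]
    refine (mul_le_mul_of_nonneg_left h hB).trans (le_of_eq ?_)
    ring
  · rw [hRa, hsq, hma, div_mul_eq_mul_div]
    gcongr

end Halving

/-! ### From stage counts to error bounds. -/

section Rate

lemma exp_half_le_two_pow (K : ℕ) : Real.exp (K / 2) ≤ 2 ^ K := by
  have h : Real.exp (1 / 2) ≤ 2 := by
    have h1 : Real.exp (1 / 2) ^ 2 = Real.exp 1 := by rw [← Real.exp_nat_mul]; norm_num
    nlinarith [Real.exp_one_lt_d9, Real.exp_pos (1 / 2)]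
  calc Real.exp (K / 2) = Real.exp (1 / 2) ^ K := by rw [← Real.exp_nat_mul]; ring_nf
    _ ≤ 2 ^ K := pow_le_pow_left₀ (Real.exp_pos _).le h K

variable {E : Type*} [NormedAddCommGroup E] [NormedSpace ℝ E] {d : DGF E} {p : Params}

/-- The linearly converging term of the error bound. -/
noncomputable def expTerm (d : DGF E) (p : Params) : ℝ :=
  p.R * Real.exp (-(1 / 20000 / (p.δ ^ 2 * p.ρ * p.ν) * (p.N / (p.s * (d.Theta + p.t)))))

lemma expTerm_eq (d : DGF E) (p : Params) : expTerm d p =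
    p.R * Real.exp (-(p.N / (20000 * (p.cond * p.ν * (d.Theta + p.t))))) := by
  unfold expTerm Params.cond
  congr 3
  rw [div_div, div_mul_div_comm, one_mul]
  ring

/-- Since `2 ^ (-K) ≤ exp (-K / 2)`, a sample budget linear in `K` yields exponential decay in `N`;
the offset `c` pays for an incomplete stage. -/
lemma le_expTerm (hp : p.Admissible) (hΘ : 1 / 2 ≤ d.Theta) {K : ℕ} {c : ℝ}
    (h : (p.N : ℝ) ≤ 20000 * (p.cond * p.ν * (d.Theta + p.t)) * (K / 2 + c)) :
    p.R / 2 ^ K ≤ Real.exp c * expTerm d p := by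
  have hU : 0 < 20000 * (p.cond * p.ν * (d.Theta + p.t)) := by
    have := half_le_complexity hp hΘ
    linarith
  have h1 : (p.N : ℝ) / (20000 * (p.cond * p.ν * (d.Theta + p.t))) ≤ K / 2 + c :=
    (div_le_iff₀' hU).2 h
  rw [expTerm_eq, mul_left_comm, div_eq_mul_inv]
  refine mul_le_mul_of_nonneg_left ?_ hp.R_pos.le
  calc ((2 : ℝ) ^ K)⁻¹ ≤ (Real.exp (K / 2))⁻¹ :=
        inv_anti₀ (Real.exp_pos _) (exp_half_le_two_pow K)
    _ = Real.exp c * Real.exp (-(K / 2 + c)) := by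
        rw [← Real.exp_neg, ← Real.exp_add]; ring_nf
    _ ≤ _ := by gcongr

/-- If the budget is exhausted in the preliminary phase, then the linear term dominates. -/
lemma prelim_radius_le (hp : p.Admissible) (hΘ : 1 / 2 ≤ d.Theta) :
    p.R / 2 ^ (p.N / tuning.m₀ p d) ≤ 3 * expTerm d p := by
  have h0 := one_le_m₀ hp hΘ
  have h1 : p.N < tuning.m₀ p d * (p.N / tuning.m₀ p d + 1) := Nat.lt_mul_div_succ _ h0
  have h1' : (p.N : ℝ) < tuning.m₀ p d * ((p.N / tuning.m₀ p d : ℕ) + 1) := by exact_mod_cast h1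
  set K := p.N / tuning.m₀ p d
  have hU := half_le_complexity hp hΘ
  have hK : (0 : ℝ) ≤ K := Nat.cast_nonneg _
  have h2 : (tuning.m₀ p d : ℝ) * (K + 1) ≤
      4098 * (p.cond * p.ν * (d.Theta + p.t)) * (K + 1) := by
    gcongr
    exact m₀_le hp hΘ
  have h3 := le_expTerm hp hΘ (K := K) (c := 1) (by nlinarith)
  have h4 : 0 ≤ expTerm d p := mul_nonneg hp.R_pos.le (Real.exp_pos _).le
  have h5 := Real.exp_one_lt_d9
  nlinarith

/-- If the preliminary phase is completed, then the final radius of the asymptotic phase obeys the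
error bound. -/
lemma asym_radius_le (hp : p.Admissible) (hΘ : 1 / 2 ≤ d.Theta) {K K' B : ℕ} {Θ' : ℝ}
    (hΘ' : 0 ≤ Θ') (hK : K = ⌈Real.logb 2 (p.R / tuning.r₀ p)⌉₊)
    (hB : p.N ≤ B + tuning.m₀ p d * K) (hN : tuning.m₀ p d ≤ p.N)
    (hbudget : (B : ℝ) < 92 * 4 ^ K' * (Θ' * tuning.m₀ p d)) :
    tuning.r₀ p / 2 ^ K' ≤ 20000 * (expTerm d p +
      p.δ ^ 2 * p.ρ * p.σ * p.s * √(Θ' * (d.Theta + p.t) / p.N)) := by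
  have hr₀ := r₀_pos hp
  have hR := hp.R_pos; have hν := hp.ν_pos; have hσ := hp.σ_pos; have hA := hp.cond_pos
  have hδ := hp.δ_pos; have hρ := hp.ρ_pos; have hs := hp.s_pos
  have hm1 : (1 : ℝ) ≤ tuning.m₀ p d := by exact_mod_cast one_le_m₀ hp hΘ
  have hN1 : (tuning.m₀ p d : ℝ) ≤ p.N := by exact_mod_cast hN
  have hNpos : (0 : ℝ) < p.N := by linarith
  have hT : 0 < d.Theta + p.t := by linarith [hp.t_nonneg]
  have hU := half_le_complexity hp hΘ
  have hm := m₀_le hp hΘ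
  have hB' : (p.N : ℝ) ≤ B + tuning.m₀ p d * K := by exact_mod_cast hB
  have he : 0 ≤ expTerm d p := mul_nonneg hR.le (Real.exp_pos _).le
  have hsq0 : 0 ≤ p.δ ^ 2 * p.ρ * p.σ * p.s * √(Θ' * (d.Theta + p.t) / p.N) := by positivity
  -- Whichever phase receives half of the budget provides the bound: the asymptotic phase gives the
  -- square-root term, the preliminary phase the exponential one.
  rcases le_or_gt ((p.N : ℝ) / 2) B with h | h
  · have h1 : tuning.r₀ p / 2 ^ K' ≤
        20000 * (p.δ ^ 2 * p.ρ * p.σ * p.s * √(Θ' * (d.Theta + p.t) / p.N)) := by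
      refine (pow_le_pow_iff_left₀ (by positivity) (by positivity) two_ne_zero).1 ?_
      have e1 : (20000 * (p.δ ^ 2 * p.ρ * p.σ * p.s * √(Θ' * (d.Theta + p.t) / p.N))) ^ 2 =
          400000000 * (p.cond * p.σ) ^ 2 * (Θ' * (d.Theta + p.t)) / p.N := by
        have hpos : 0 ≤ Θ' * (d.Theta + p.t) / p.N := by positivity
        rw [mul_pow, mul_pow, Real.sq_sqrt hpos]
        unfold Params.cond
        ring
      have e2 : ((2 : ℝ) ^ K') ^ 2 = 4 ^ K' := by
        rw [← pow_mul, mul_comm, pow_mul]; norm_num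
      rw [e1, div_pow, r₀_sq hp, e2, div_le_div_iff₀ (by positivity) hNpos]
      have h2 : (p.N : ℝ) ≤ 184 * 4 ^ K' * (Θ' * tuning.m₀ p d) := by linarith
      calc 256 * (p.σ ^ 2 * p.cond / p.ν) * p.N
          ≤ 256 * (p.σ ^ 2 * p.cond / p.ν) * (184 * 4 ^ K' * (Θ' *
            (4098 * (p.cond * p.ν * (d.Theta + p.t))))) := by
            gcongr
            exact h2.trans (by gcongr)
        _ = 256 * 184 * 4098 * ((p.cond * p.σ) ^ 2 * (Θ' * (d.Theta + p.t)) * 4 ^ K') := by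
            field_simp
        _ ≤ 400000000 * ((p.cond * p.σ) ^ 2 * (Θ' * (d.Theta + p.t)) * 4 ^ K') := by
            gcongr
            norm_num
        _ = _ := by ring
    linarith
  · have hK0 : 0 < K := by
      rcases Nat.eq_zero_or_pos K with h0 | h0
      · rw [h0, Nat.cast_zero, mul_zero, add_zero] at hB'
        linarith
      · exact h0
    -- The ceiling is minimal: one stage earlier the radius was still above `r₀`. Hence `r₀` is
    -- comparable with the exponentially small radius.
    have h1 : tuning.r₀ p ≤ 2 * (p.R / 2 ^ K) := by
      obtain ⟨j, rfl⟩ := Nat.exists_eq_succ_of_ne_zero hK0.ne'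
      have h2 : (j : ℝ) < Real.logb 2 (p.R / tuning.r₀ p) := by
        rw [← Nat.lt_ceil, ← hK]; exact Nat.lt_succ_self j
      rw [Real.lt_logb_iff_rpow_lt (by norm_num) (by positivity), Real.rpow_natCast,
        lt_div_iff₀ hr₀] at h2
      have e : 2 * (p.R / 2 ^ (j + 1)) = p.R / 2 ^ j := by rw [pow_succ]; field_simp
      rw [Nat.succ_eq_add_one, e, le_div_iff₀ (by positivity)]
      linarith
    have hKr : (0 : ℝ) ≤ K := Nat.cast_nonneg _
    have h2 : (tuning.m₀ p d : ℝ) * K ≤ 4098 * (p.cond * p.ν * (d.Theta + p.t)) * K := by gcongr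
    have h3 := le_expTerm hp hΘ (K := K) (c := 0) (by nlinarith)
    rw [Real.exp_zero, one_mul] at h3
    have h4 : tuning.r₀ p / 2 ^ K' ≤ tuning.r₀ p :=
      div_le_self hr₀.le (one_le_pow₀ (by norm_num))
    linarith

lemma cost_prelim (d : DGF E) (p : Params) (k : ℕ) :
    cost (tuning.prelim p d) k = tuning.m₀ p d * k := by
  simp [cost, Tuning.prelim, mul_comm]

end Rate

/-! ### Both phases together. -/

section Main

variable {E Ω S : Type*} [NormedAddCommGroup E] [NormedSpace ℝ E] [FiniteDimensional ℝ E]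
  [MeasurableSpace E] [BorelSpace E] [MeasurableSpace Ω] [MeasurableSpace S]
  {o : Oracle E Ω} {d : DGF E} {P : Measure Ω} [IsProbabilityMeasure P]
  {μ : Measure S} [IsProbabilityMeasure μ] {xs : E} {w : ℕ → S → Ω} {p : Params}

/-- The error bound for an asymptotic phase whose `k`-th stage costs about `4 ^ k Θ' m₀`. -/
theorem run_error_le (hp : p.Admissible) (hΘ : 1 / 2 ≤ d.Theta) (hr : o.Regular P p.ν)
    (hs : o.IsSolution P p.σ xs) (hrsc : o.RSC P xs p.δ p.ρ p.s)
    (hw : ∀ i, MeasurePreserving (w i) μ P) (hi : iIndepFun w μ) {a : ℕ → Run} {Θ' : ℝ}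
    (hΘ' : 0 < Θ') (haR : ∀ k, (a k).R = tuning.r₀ p / 2 ^ k) (haγ : ∀ k, 0 ≤ (a k).γ)
    (haκ : ∀ k, 0 ≤ (a k).κ) (ha : ∀ k, Halves o d xs μ w (failure d p) (a k))
    (hlow : ∀ k, tuning.m₀ p d ≤ (a k).m * (a k).L)
    (hl : ∀ k, 4 ^ (k + 1) * (Θ' * tuning.m₀ p d) ≤ ((a k).m * (a k).L : ℝ))
    (hu : ∀ k, ((a k).m * (a k).L : ℝ) ≤ 17 * 4 ^ (k + 1) * (Θ' * tuning.m₀ p d))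
    {x₀ : E} (hx₀ : x₀ ∈ o.X) (hx₀s : ‖x₀ - xs‖ ≤ p.R) (hN : tuning.m₀ p d ≤ p.N) :
    1 - 20000 * (tuning.K₁ p d + (1 + max 0 (Real.log (p.N / (Θ' * tuning.m₀ p d))))) *
        Real.exp (-p.t) ≤
      μ.real {s | ‖tuning.run p o d a x₀ (fun i => w i s) - xs‖ ≤ 20000 * (expTerm d p +
        p.δ ^ 2 * p.ρ * p.σ * p.s * √(Θ' * (d.Theta + p.t) / p.N))} := by
  have hr₀ := r₀_pos hp
  have hR := hp.R_pos; have hν := hp.ν_pos; have hδ := hp.δ_pos; have hρ := hp.ρ_pos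
  have hsp := hp.s_pos
  have hm1 := one_le_m₀ hp hΘ
  have hm1' : (1 : ℝ) ≤ tuning.m₀ p d := by exact_mod_cast hm1
  have ham : ∀ k, 1 ≤ (a k).m := fun k => Nat.one_le_iff_ne_zero.2 fun h => by
    have := (hm1.trans (hlow k))
    simp [h] at this
  set K := tuning.K₁ p d with hKdef
  set B := p.N - tuning.m₀ p d * K with hBdef
  set K' := stageCount a B
  set bound := 20000 * (expTerm d p +
    p.δ ^ 2 * p.ρ * p.σ * p.s * √(Θ' * (d.Theta + p.t) / p.N)) with hbound
  -- the preliminary phase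
  have hpR : ∀ k, (tuning.prelim p d k).R = p.R / 2 ^ k := fun k => rfl
  have hpR0 : ∀ k, 0 < (tuning.prelim p d k).R := fun k => by rw [hpR]; positivity
  have hpγ : ∀ k, 0 ≤ (tuning.prelim p d k).γ := fun k => by
    simp only [Tuning.prelim]; positivity
  have hpκ : ∀ k, 0 ≤ (tuning.prelim p d k).κ := fun k => by
    simp only [Tuning.prelim, tuning]; positivity
  have hz₀ : Measurable[past w 0] fun _ : S => x₀ := measurable_const
  have hprel := measure_stages_le (d := d) (μ := μ) (a := tuning.prelim p d) (K := K)
    (ε := failure d p) hr hpR0 hpγ hpκ (fun _ => hm1) hz₀ (fun _ => hx₀) hpR fun k hk => by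
      refine halves_prelim hp hΘ hr hs hrsc hw hi ?_
      have h1 : k < ⌈Real.logb 2 (p.R / tuning.r₀ p)⌉₊ := hk.trans_le (min_le_left _ _)
      rw [Nat.lt_ceil, Real.lt_logb_iff_rpow_lt (by norm_num) (by positivity), Real.rpow_natCast,
        lt_div_iff₀ hr₀] at h1
      rw [le_div_iff₀ (by positivity)]
      linarith
  obtain ⟨hzX, hzm⟩ := stages_mem_and_measurable (d := d) (a := tuning.prelim p d) hr hpR0 hpγ
    hpκ (fun _ => hm1) hz₀ (fun _ => hx₀) K
  rw [zero_add, cost_prelim] at hzm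
  simp only [zero_add] at hprel hzX hzm
  -- the asymptotic phase
  have hasym := measure_stages_le (d := d) (a := a) (K := K') (ε := failure d p) hr
    (fun k => by rw [haR]; positivity) haγ haκ ham hzm hzX haR fun k _ => ha k
  -- Missing the bound forces one of the two phases to miss its final radius although it started
  -- within its initial one.
  have hbad : {s | ‖tuning.run p o d a x₀ (fun i => w i s) - xs‖ ≤ bound}ᶜ ⊆
      {s | ‖x₀ - xs‖ ≤ p.R ∧
        p.R / 2 ^ K < ‖stages o d (tuning.prelim p d) x₀ (fun j => w j s) K - xs‖} ∪
      {s | ‖stages o d (tuning.prelim p d) x₀ (fun j => w j s) K - xs‖ ≤ tuning.r₀ p ∧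
        tuning.r₀ p / 2 ^ K' < ‖stages o d a (stages o d (tuning.prelim p d) x₀
          (fun j => w j s) K) (fun j => w (tuning.m₀ p d * K + j) s) K' - xs‖} := by
    intro s hs'
    rw [Set.mem_compl_iff, Set.mem_ofPred_eq, not_le] at hs'
    by_contra hcon
    rw [Set.mem_union, not_or] at hcon
    obtain ⟨hc1, hc2⟩ := hcon
    simp only [Set.mem_ofPred_eq, not_and, not_lt] at hc1 hc2
    have hc1 := hc1 hx₀s
    have hrun : tuning.run p o d a x₀ (fun i => w i s) = stages o d a
      (stages o d (tuning.prelim p d) x₀ (fun j => w j s) K)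
      (fun j => w (tuning.m₀ p d * K + j) s) K' := rfl
    have hKle : K ≤ ⌈Real.logb 2 (p.R / tuning.r₀ p)⌉₊ := min_le_left _ _
    rcases hKle.lt_or_eq with hlt | heq
    -- The budget stopped the preliminary phase: fewer than `m₀` samples remain, no asymptotic stage
    -- fits, and the output is the preliminary point.
    · have hKN : K = p.N / tuning.m₀ p d := by
        rcases min_choice ⌈Real.logb 2 (p.R / tuning.r₀ p)⌉₊ (p.N / tuning.m₀ p d) with h | h
        · exact absurd h hlt.ne
        · exact h
      have hB0 : B < tuning.m₀ p d := by
        have := Nat.lt_mul_div_succ p.N (Nat.pos_of_ne_zero (by omega : tuning.m₀ p d ≠ 0))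
        rw [← hKN, mul_add, mul_one] at this
        omega
      have hK0 : K' = 0 := stageCount_eq_zero hlow hB0
      rw [hrun, hK0] at hs'
      have h1 := prelim_radius_le hp hΘ
      rw [← hKN] at h1
      have h2 : 0 ≤ expTerm d p := mul_nonneg hR.le (Real.exp_pos _).le
      have h3 : 0 ≤ p.δ ^ 2 * p.ρ * p.σ * p.s * √(Θ' * (d.Theta + p.t) / p.N) := by
        have := hp.σ_pos
        positivity
      simp only [stages] at hs'
      linarith
    · have h1 := asym_radius_le hp hΘ (B := B) (K' := K') hΘ'.le heq
        (Nat.le_add_of_sub_le le_rfl) hN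
        (budget_lt (by positivity) (fun k => hm1.trans (hlow k)) hu B)
      have h2 : p.R / 2 ^ K ≤ tuning.r₀ p := by
        have h3 : Real.logb 2 (p.R / tuning.r₀ p) ≤ K := by rw [heq]; exact Nat.le_ceil _
        rw [Real.logb_le_iff_le_rpow (by norm_num) (by positivity), Real.rpow_natCast,
          div_le_iff₀ hr₀] at h3
        rw [div_le_iff₀ (by positivity)]
        linarith
      have h4 := hc2 (hc1.trans h2)
      rw [← hrun] at h4
      linarith
  have hprob : μ {s | ‖tuning.run p o d a x₀ (fun i => w i s) - xs‖ ≤ bound}ᶜ ≤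
      ENNReal.ofReal (3 * (K + K') * Real.exp (-p.t)) := by
    refine (measure_mono hbad).trans ((measure_union_le _ _).trans
      ((add_le_add hprel hasym).trans ?_))
    rw [← add_mul, failure]
    have e3 : (3 : ENNReal) = ENNReal.ofReal 3 := by simp
    rw [e3, ← ENNReal.ofReal_natCast, ← ENNReal.ofReal_natCast,
      ← ENNReal.ofReal_add (Nat.cast_nonneg _) (Nat.cast_nonneg _),
      ← ENNReal.ofReal_mul (by norm_num), ← ENNReal.ofReal_mul (by positivity)]
    refine ENNReal.ofReal_le_ofReal ?_
    have : Real.exp (-(d.Theta + p.t)) ≤ Real.exp (-p.t) := Real.exp_le_exp.2 (by linarith)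
    calc ((K : ℝ) + K') * (3 * Real.exp (-(d.Theta + p.t))) ≤
        ((K : ℝ) + K') * (3 * Real.exp (-p.t)) := by gcongr
      _ = _ := by ring
  have hreal : μ.real {s | ‖tuning.run p o d a x₀ (fun i => w i s) - xs‖ ≤ bound}ᶜ ≤
      3 * (K + K') * Real.exp (-p.t) :=
    ENNReal.toReal_le_of_le_ofReal (by positivity) hprob
  have htot : 1 ≤ μ.real {s | ‖tuning.run p o d a x₀ (fun i => w i s) - xs‖ ≤ bound} +
      μ.real {s | ‖tuning.run p o d a x₀ (fun i => w i s) - xs‖ ≤ bound}ᶜ := by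
    have h := measureReal_union_le (μ := μ)
      {s | ‖tuning.run p o d a x₀ (fun i => w i s) - xs‖ ≤ bound}
      {s | ‖tuning.run p o d a x₀ (fun i => w i s) - xs‖ ≤ bound}ᶜ
    rwa [Set.union_compl_self, probReal_univ] at h
  have hK' : (K' : ℝ) ≤ max 0 (Real.log (p.N / (Θ' * tuning.m₀ p d))) :=
    stageCount_le_log (by positivity) hl (Nat.sub_le _ _)
  have hlast : 3 * ((K : ℝ) + K') * Real.exp (-p.t) ≤
      20000 * (K + (1 + max 0 (Real.log (p.N / (Θ' * tuning.m₀ p d))))) * Real.exp (-p.t) := by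
    have : (0 : ℝ) ≤ K := Nat.cast_nonneg _
    have : (0 : ℝ) ≤ K' := Nat.cast_nonneg _
    gcongr ?_ * _
    linarith
  linarith

theorem csmdSR_error_le (hp : p.Admissible) (hΘ : 1 / 2 ≤ d.Theta) (hr : o.Regular P p.ν)
    (hs : o.IsSolution P p.σ xs) (hrsc : o.RSC P xs p.δ p.ρ p.s)
    (hw : ∀ i, MeasurePreserving (w i) μ P) (hi : iIndepFun w μ)
    {x₀ : E} (hx₀ : x₀ ∈ o.X) (hx₀s : ‖x₀ - xs‖ ≤ p.R) (hN : tuning.m₀ p d ≤ p.N) :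
    1 - 20000 * (tuning.K₁ p d + tuning.K₂ p d) * Real.exp (-p.t) ≤
      μ.real {s | ‖tuning.csmdSR p o d x₀ (fun i => w i s) - xs‖ ≤ 20000 * (expTerm d p +
        p.δ ^ 2 * p.ρ * p.σ * p.s * √((d.Theta + p.t) / p.N))} := by
  have hν := hp.ν_pos; have hρ := hp.ρ_pos; have hσ := hp.σ_pos; have hsp := hp.s_pos
  have hm1 : (1 : ℝ) ≤ tuning.m₀ p d := by exact_mod_cast one_le_m₀ hp hΘ
  have hL : ∀ k, (tuning.asym p d k).L = 1 := fun k => rfl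
  have hN' : (tuning.m₀ p d : ℝ) ≤ p.N := by exact_mod_cast hN
  have h := run_error_le hp hΘ hr hs hrsc hw hi (a := tuning.asym p d) one_pos (fun k => rfl)
    (fun k => by simp only [Tuning.asym, tuning]; positivity)
    (fun k => by simp only [Tuning.asym, Tuning.asymPen, tuning]; positivity)
    (fun k => halves_asym hp hΘ hr hs hrsc hw hi k)
    (fun k => by
      rw [asym_m, hL, mul_one]
      exact Nat.le_mul_of_pos_left _ (by positivity))
    (fun k => by rw [asym_m, hL]; push_cast; simp)
    (fun k => by
      rw [asym_m, hL]
      push_cast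
      have : (0 : ℝ) ≤ 4 ^ (k + 1) * tuning.m₀ p d := by positivity
      linarith) hx₀ hx₀s hN
  have hlog : 0 ≤ Real.log (p.N / tuning.m₀ p d) :=
    Real.log_nonneg ((one_le_div (by linarith)).2 hN')
  simp only [one_mul, max_eq_right hlog] at h
  exact h

theorem csmdSRBatch_error_le (hp : p.Admissible) (hΘ : 1 / 2 ≤ d.Theta) (hr : o.Regular P p.ν)
    (hs : o.IsSolution P p.σ xs) (hrsc : o.RSC P xs p.δ p.ρ p.s)
    (hw : ∀ i, MeasurePreserving (w i) μ P) (hi : iIndepFun w μ)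
    {x₀ : E} (hx₀ : x₀ ∈ o.X) (hx₀s : ‖x₀ - xs‖ ≤ p.R) (hN : tuning.m₀ p d ≤ p.N) :
    1 - 20000 * (tuning.K₁ p d + tuning.K₂Batch p d) * Real.exp (-p.t) ≤
      μ.real {s | ‖tuning.csmdSRBatch p o d x₀ (fun i => w i s) - xs‖ ≤ 20000 * (expTerm d p +
        p.δ ^ 2 * p.ρ * p.σ * p.s * √(d.Theta * (d.Theta + p.t) / p.N))} := by
  have hν := hp.ν_pos; have hρ := hp.ρ_pos; have hσ := hp.σ_pos; have hsp := hp.s_pos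
  have hm1 : (1 : ℝ) ≤ tuning.m₀ p d := by exact_mod_cast one_le_m₀ hp hΘ
  have hΘ0 : 0 < d.Theta := by linarith
  have hm : ∀ k, (tuning.asymBatch p d k).m = tuning.m₀ p d := fun k => rfl
  refine run_error_le hp hΘ hr hs hrsc hw hi (a := tuning.asymBatch p d) hΘ0 (fun k => rfl)
    (fun k => by simp only [Tuning.asymBatch]; positivity)
    (fun k => by simp only [Tuning.asymBatch, Tuning.asymPen, tuning]; positivity)
    (fun k => halves_asymBatch hp hΘ hr hs hrsc hw hi k)
    (fun k => ?_) (fun k => ?_) (fun k => ?_) hx₀ hx₀s hN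
  · rw [hm]
    refine Nat.le_mul_of_pos_right _ ?_
    have h1 := le_asymBatch_L d p k
    have h2 : (0 : ℝ) < 16 * (4 ^ (k + 1) * d.Theta) := by positivity
    exact_mod_cast h2.trans_le h1
  · have h1 := le_asymBatch_L d p k
    have h2 : (0 : ℝ) ≤ 4 ^ (k + 1) * d.Theta := by positivity
    rw [hm]
    nlinarith
  · have h1 := asymBatch_L_le hΘ p k
    rw [hm]
    nlinarith

end Main

/-- Covers the zero space, where `Θ ≥ 1 / 2` fails but every error is zero. -/
lemma one_sub_le_measureReal_of_subsingleton {E S : Type*} [NormedAddCommGroup E] [Subsingleton E]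
    [MeasurableSpace S] {μ : Measure S} [IsProbabilityMeasure μ] {K b : ℝ} (hK : 0 ≤ K) (hb : 0 ≤ b)
    (y : S → E) (x : E) : 1 - K ≤ μ.real {s | ‖y s - x‖ ≤ b} := by
  have h : {s | ‖y s - x‖ ≤ b} = Set.univ := Set.eq_univ_of_forall fun s => by
    rw [Set.mem_ofPred_eq, Subsingleton.elim (y s - x) 0, norm_zero]
    exact hb
  rw [h, probReal_univ]
  linarith

lemma Tuning.K₂_nonneg {E : Type*} [NormedAddCommGroup E] [NormedSpace ℝ E] {T : Tuning}
    {d : DGF E} {p : Params} (hN : T.m₀ p d ≤ p.N) : 0 ≤ T.K₂ p d := by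
  have h : 0 ≤ Real.log (p.N / T.m₀ p d) := by
    rcases Nat.eq_zero_or_pos (T.m₀ p d) with h0 | h0
    · simp [h0]
    · have h0' : (0 : ℝ) < T.m₀ p d := by exact_mod_cast h0
      exact Real.log_nonneg ((one_le_div h0').2 (by exact_mod_cast hN))
  unfold Tuning.K₂
  linarith

lemma Tuning.K₂Batch_nonneg {E : Type*} [NormedAddCommGroup E] [NormedSpace ℝ E] (T : Tuning)
    (d : DGF E) (p : Params) : 0 ≤ T.K₂Batch p d :=
  add_nonneg zero_le_one (le_max_left _ _)

end CSMD

theorem theorem1 :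
    ∃ (T : CSMD.Tuning) (ct C c : ℝ), 0 < ct ∧ 0 < C ∧ 0 < c ∧
      ∀ (E : Type*) [NormedAddCommGroup E] [NormedSpace ℝ E] [FiniteDimensional ℝ E]
        [MeasurableSpace E] [BorelSpace E]
        (Ω : Type*) [MeasurableSpace Ω] (P : Measure Ω) [IsProbabilityMeasure P]
        (o : CSMD.Oracle E Ω) (d : CSMD.DGF E) (p : CSMD.Params) (xs x₀ : E)
        (S : Type*) [MeasurableSpace S] (μ : Measure S) [IsProbabilityMeasure μ] (w : ℕ → S → Ω),
        0 < p.ν → 0 < p.ρ → 0 < p.σ → 0 < p.R → 1 ≤ p.s → 1 ≤ p.δ → 1 ≤ p.ρ * p.ν →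
        o.Regular P p.ν → o.IsSolution P p.σ xs → o.RSC P xs p.δ p.ρ p.s →
        x₀ ∈ o.X → ‖x₀ - xs‖ ≤ p.R →
        (∀ i, MeasurePreserving (w i) μ P) → iIndepFun w μ →
        T.m₀ p d ≤ p.N → ct * √(Real.log p.N) ≤ p.t →
        1 - C * (T.K₁ p d + T.K₂ p d) * Real.exp (-p.t) ≤
            μ.real {a | ‖T.csmdSR p o d x₀ (fun i => w i a) - xs‖ ≤
              C * (p.R * Real.exp (-(c / (p.δ ^ 2 * p.ρ * p.ν) * (p.N / (p.s * (d.Theta + p.t)))))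
                + p.δ ^ 2 * p.ρ * p.σ * p.s * √((d.Theta + p.t) / p.N))} ∧
        1 - C * (T.K₁ p d + T.K₂Batch p d) * Real.exp (-p.t) ≤
            μ.real {a | ‖T.csmdSRBatch p o d x₀ (fun i => w i a) - xs‖ ≤
              C * (p.R * Real.exp (-(c / (p.δ ^ 2 * p.ρ * p.ν) * (p.N / (p.s * (d.Theta + p.t)))))
                + p.δ ^ 2 * p.ρ * p.σ * p.s * √(d.Theta * (d.Theta + p.t) / p.N))} := by
  refine ⟨CSMD.tuning, 1, 20000, 1 / 20000, by norm_num, by norm_num, by norm_num, ?_⟩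
  intro E _ _ _ _ _ Ω _ P _ o d p xs x₀ S _ μ _ w hν hρ hσ hR hs1 hδ hρν hr hs hrsc hx₀ hx₀s hw hi
    hN ht
  rw [one_mul] at ht
  -- The lower bound on `t` enters through `0 ≤ t`; deviations at level `Θ + t` and a union over
  -- stages do the rest.
  have hp : p.Admissible := ⟨hν, hρ, hσ, hR, hs1, hδ, hρν, (Real.sqrt_nonneg _).trans ht⟩
  rcases subsingleton_or_nontrivial E with hE | hE
  · have h₂ := CSMD.Tuning.K₂_nonneg hN
    have h₃ := CSMD.tuning.K₂Batch_nonneg d p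
    exact ⟨CSMD.one_sub_le_measureReal_of_subsingleton (by positivity) (by positivity) _ _,
      CSMD.one_sub_le_measureReal_of_subsingleton (by positivity) (by positivity) _ _⟩
  · exact ⟨CSMD.csmdSR_error_le hp d.half_le_Theta hr hs hrsc hw hi hx₀ hx₀s hN,
      CSMD.csmdSRBatch_error_le hp d.half_le_Theta hr hs hrsc hw hi hx₀ hx₀s hN⟩
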